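/- Let $\psi\in C^\infty(\mathbb{R},[0,1])$ be even, non-increasing on $[0,\infty)$, supported in $[-\frac85,\frac85]$, with $\psi=1$ on $[-\frac45,\frac45]$, and put $\varphi(x)=\psi(x)-\psi(2x)$. Let $\mathfrak{Z}_n=\frac{2n+1}{4\pi}L_n$, where $L_n(z)=\frac{1}{2^n n!}\frac{d^n}{dz^n}\left[(z^2-1)^n\right]$ is the Legendre polynomial, and let $\nu$ be the standard surface measure on $\mathbb{S}^2\subset\mathbb{R}^3$ ($\nu(\mathbb{S}^2)=4\pi$). For $\ell\in\mathbb{Z}$ and $f:\mathbb{R}^3\to\mathbb{C}$ define $$\bar R_\ell f(x)=\sum_{n\ge0}\varphi(2^{-\ell}n)\int_{\mathbb{S}^2}f(|x|\vartheta)\,\mathfrak{Z}_n\big(\langle\vartheta,\tfrac{x}{|x|}\rangle\big)\,d\nu(\vartheta),\qquad \bar R_{\le\ell}f(x)=\sum_{n\ge0}\psi(2^{-\ell}n)\int_{\mathbb{S}^2}f(|x|\vartheta)\,\mathfrak{Z}_n\big(\langle\vartheta,\tfrac{x}{|x|}\rangle\big)\,d\nu(\vartheta)$$ (at $x=0$,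 replace $x/|x|$ by any unit vector). Let $\Omega_{ab}=x_a\partial_{x_b}-x_b\partial_{x_a}$ for $a,b\in\{1,2,3\}$ and $Sf=x\cdot\nabla f$. Fix any normalization $c>0$ of the Fourier transform $\mathcal{F}f(\xi)=\int_{\mathbb{R}^3} e^{-ic\,x\cdot\xi}f(x)\,dx$ (extended to $L^2$ by Plancherel, up to a constant factor), and let $P_k$, $k\in\mathbb{Z}$, be given on $L^2$ by $\mathcal{F}(P_kf)(\xi)=\varphi(2^{-k}|\xi|)\mathcal{F}f(\xi)$. Then, with a constant $C$ depending only on $\psi$ (in particular not on $\ell$, $r$, $f$): (i) For every $\ell\in\mathbb{Z}$, $\bar R_\ell$ maps $C^1(\mathbb{R}^3)$ to itself, and $\Omega_{ab}\bar R_\ell f=\bar R_\ell\Omega_{ab}f$ and $S\bar R_\ell f=\bar R_\ell Sf$ for $f\in C^1(\mathbb{R}^3)$. $\bar R_\ell$ commutes with multiplication by $\varphi(2^{-k}|x|)$ for every $k\in\mathbb{Z}$. $\bar R_\ell$ maps $L^1$ to $L^1$ and $L^2$ to $L^2$, commutes with $\mathcal{F}$ on $L^1$ (pointwise) and on $L^2$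 (a.e.), and commutes with $P_k$ on $L^2$ for every $k\in\mathbb{Z}$. (ii) For $f\in L^2(\mathbb{R}^3)$, $$f=\bar R_{\le-1}f+\sum_{\ell\ge0}\bar R_\ell f\quad\text{(unconditionally in }L^2),\qquad C^{-1}\Vert f\Vert_{L^2}^2\le\Vert\bar R_{\le-1}f\Vert_{L^2}^2+\sum_{\ell\ge0}\Vert\bar R_\ell f\Vert_{L^2}^2\le C\Vert f\Vert_{L^2}^2 .$$ For $f,g\in L^1_{loc}(\mathbb{R}^3)$ and integers $\ell,\ell',\ell_1,\ell_2$, almost everywhere, $\bar R_\ell\bar R_{\ell'}f=0$ whenever $|\ell-\ell'|\ge4$, and $\bar R_\ell\left[\bar R_{\ell_1}f\cdot\bar R_{\ell_2}g\right]=0$ whenever $\max\{\ell,\ell_1,\ell_2\}\ge\mathrm{med}\{\ell,\ell_1,\ell_2\}+4$, where $\mathrm{med}$ is the median. (iii) For all $\ell\in\mathbb{Z}$, $1\le r\le\infty$ and $f\in L^r(\mathbb{R}^3)$, the functions $\bar R_\ell f$ and $\bar R_{\le\ell}f$ are in $L^r$ and $$\Vert\bar R_\ell f\Vert_{L^r}+\Vert\bar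 R_{\le\ell}f\Vert_{L^r}\le C\Vert f\Vert_{L^r}.$$ (iv) For all $\ell\in\mathbb{Z}$, $1\le r\le\infty$ and $f\in L^r(\mathbb{R}^3)$, the distributions $\Omega_{ab}\bar R_\ell f$ are in $L^r$ and $$C^{-1}\,2^\ell\Vert\bar R_\ell f\Vert_{L^r}\le\sum_{1\le a<b\le3}\Vert\Omega_{ab}\bar R_\ell f\Vert_{L^r}\le C\,2^\ell\Vert\bar R_\ell f\Vert_{L^r}.$$ -/

import Mathlib

open MeasureTheory Filter Topology
open scoped ENNReal NNReal ContDiff FourierTransform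

noncomputable section

namespace AngularLP

/-- Euclidean three-space. -/
abbrev E3 : Type := EuclideanSpace ℝ (Fin 3)

/-- A smooth even bump `ψ : ℝ → [0,1]`, non-increasing on `[0,∞)`, supported in `[-8/5, 8/5]`
and equal to `1` on `[-4/5, 4/5]`. -/
structure Bump where
  toFun : ℝ → ℝ
  smooth : ContDiff ℝ ∞ toFun
  mem_Icc : ∀ x, toFun x ∈ Set.Icc (0 : ℝ) 1
  even : ∀ x, toFun (-x) = toFun x
  antitoneOn : AntitoneOn toFun (Set.Ici 0)
  support_subset : Function.support toFun ⊆ Set.Icc (-(8 / 5)) (8 / 5)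
  eq_one : ∀ x ∈ Set.Icc (-(4 / 5) : ℝ) (4 / 5), toFun x = 1

/-- `φ(x) = ψ(x) - ψ(2x)`. -/
def Bump.phi (ψ : Bump) (x : ℝ) : ℝ := ψ.toFun x - ψ.toFun (2 * x)

/-- The Legendre polynomial `L_n(z) = (2^n n!)⁻¹ (d/dz)^n (z^2 - 1)^n`. -/
def legendre (n : ℕ) (z : ℝ) : ℝ :=
  1 / (2 ^ n * (n.factorial : ℝ)) *
    (Polynomial.derivative^[n] ((Polynomial.X ^ 2 - 1 : Polynomial ℝ) ^ n)).eval z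

/-- The zonal function `𝔷_n(z) = (2n+1)/(4π) L_n(z)`. -/
def zonal (n : ℕ) (z : ℝ) : ℝ := (2 * (n : ℝ) + 1) / (4 * Real.pi) * legendre n z

/-- The standard surface measure on the unit sphere (of total mass `4π`). -/
def sphereMeasure : Measure (Metric.sphere (0 : E3) 1) := (volume : Measure E3).toSphere

/-- The direction `x / |x|` of `x ≠ 0`; at the origin the north pole is used (in `angMult` below,
the integrand is then the constant `f 0` times a zonal harmonic, so any other unit vector
gives the same value). -/
def direction (x : E3) : E3 := if x = 0 then EuclideanSpace.single 2 1 else ‖x‖⁻¹ • x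

/-- `f ↦ ∑_{n ≥ 0} χ(2^{-ℓ} n) ∫_{𝕊²} f(|x| θ) 𝔷_n(⟨θ, x/|x|⟩) dν(θ)`. For `χ` of bounded support
the sum is finite. -/
def angMult (χ : ℝ → ℝ) (l : ℤ) (f : E3 → ℂ) (x : E3) : ℂ :=
  ∑' n : ℕ, (χ ((2 : ℝ) ^ (-l) * (n : ℝ)) : ℂ) *
    ∫ θ : Metric.sphere (0 : E3) 1,
      f (‖x‖ • (θ : E3)) * (zonal n (inner ℝ (θ : E3) (direction x)) : ℂ) ∂sphereMeasure

/-- The angular Littlewood-Paley projector `R̄_ℓ`. -/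
def Bump.R (ψ : Bump) (l : ℤ) (f : E3 → ℂ) : E3 → ℂ := angMult ψ.phi l f

/-- The angular Littlewood-Paley projector `R̄_{≤ℓ}`. -/
def Bump.Rle (ψ : Bump) (l : ℤ) (f : E3 → ℂ) : E3 → ℂ := angMult ψ.toFun l f

/-- The rotation field `Ω_{ab} f = x_a ∂_b f - x_b ∂_a f`. -/
def Omega (a b : Fin 3) (f : E3 → ℂ) (x : E3) : ℂ :=
  (x a : ℂ) * fderiv ℝ f x (EuclideanSpace.single b 1) -
    (x b : ℂ) * fderiv ℝ f x (EuclideanSpace.single a 1)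

/-- The scaling field `S f = x · ∇ f`. -/
def scalingS (f : E3 → ℂ) (x : E3) : ℂ := fderiv ℝ f x x

/-- `h = Ω_{ab} g` in the sense of distributions (for locally integrable `g`, `h`);
the field `Ω_{ab}` is divergence free. -/
def IsWeakOmega (a b : Fin 3) (g h : E3 → ℂ) : Prop :=
  ∀ η : E3 → ℂ, ContDiff ℝ ∞ η → HasCompactSupport η →
    ∫ x, g x * Omega a b η x = -∫ x, h x * η x

/-- The Littlewood-Paley projector in space: multiplication by `φ(2^{-k} |x|)`. -/
def Bump.spaceLP (ψ : Bump) (k : ℤ) (f : E3 → ℂ) (x : E3) : ℂ :=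
  (ψ.phi ((2 : ℝ) ^ (-k) * ‖x‖) : ℂ) * f x

/-- The Fourier transform `f ↦ ∫ e^{-i c ⟨x, ξ⟩} f(x) dx` of an integrable function, with
normalization constant `c`. -/
def fourierL1 (c : ℝ) (f : E3 → ℂ) (ξ : E3) : ℂ :=
  ∫ x, Complex.exp (-(Complex.I * (c : ℂ) * (inner ℝ x ξ : ℂ))) * f x

/-- The Fourier transform of `f ∈ L²` with kernel `e^{-i c ⟨x, ξ⟩}`: a dilation of the
Plancherel extension `𝓕` of the transform with kernel `e^{-2π i ⟨x, ξ⟩}`. -/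
def fourierL2 (c : ℝ) (f : Lp ℂ 2 (volume : Measure E3)) (ξ : E3) : ℂ :=
  (𝓕 f : Lp ℂ 2 (volume : Measure E3)) ((c / (2 * Real.pi)) • ξ)

/-- The symbol `φ(2^{-k} |ξ|)`, in the variable `ζ = (c / 2π) ξ` of the transform `𝓕`. -/
def Bump.symbol (ψ : Bump) (c : ℝ) (k : ℤ) (ζ : E3) : ℂ :=
  (ψ.phi ((2 : ℝ) ^ (-k) * ‖(2 * Real.pi / c) • ζ‖) : ℂ)

theorem Bump.continuous_phi (ψ : Bump) : Continuous ψ.phi := by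
  have h := ψ.smooth.continuous
  unfold Bump.phi
  fun_prop

theorem Bump.abs_phi_le (ψ : Bump) (x : ℝ) : |ψ.phi x| ≤ 1 := by
  have h1 := ψ.mem_Icc x
  have h2 := ψ.mem_Icc (2 * x)
  rw [Set.mem_Icc] at h1 h2
  rw [abs_le, Bump.phi]
  constructor <;> linarith [h1.1, h1.2, h2.1, h2.2]

theorem Bump.memLp_symbol_mul (ψ : Bump) (c : ℝ) (k : ℤ) (f : Lp ℂ 2 (volume : Measure E3)) :
    MemLp (fun ζ => ψ.symbol c k ζ * f ζ) 2 volume := by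
  have hc : Continuous (ψ.symbol c k) := by
    have h := ψ.continuous_phi
    unfold Bump.symbol
    fun_prop
  refine (Lp.memLp f).of_le (hc.aestronglyMeasurable.mul (Lp.aestronglyMeasurable f)) ?_
  refine Eventually.of_forall fun ζ => ?_
  rw [norm_mul]
  have : ‖ψ.symbol c k ζ‖ ≤ 1 := by
    rw [Bump.symbol, Complex.norm_real, Real.norm_eq_abs]
    exact ψ.abs_phi_le _
  exact mul_le_of_le_one_left (norm_nonneg _) this

/-- The Littlewood-Paley projector `P_k` in frequency, on `L²`: the Fourier transform of `P_k f`
is `φ(2^{-k} |ξ|)` times that of `f`, for the Fourier transform with kernel `e^{-i c ⟨x, ξ⟩}`. -/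
def Bump.freqLP (ψ : Bump) (c : ℝ) (k : ℤ) (f : Lp ℂ 2 (volume : Measure E3)) :
    Lp ℂ 2 (volume : Measure E3) :=
  𝓕⁻ ((ψ.memLp_symbol_mul c k (𝓕 f)).toLp _)

/-- The median of three integers. -/
def med (a b c : ℤ) : ℤ := max (min a b) (min (max a b) c)

/-- The pairs `1 ≤ a < b ≤ 3` (indexed from `0`). -/
def pairs : Finset (Fin 3 × Fin 3) := Finset.univ.filter fun p => p.1 < p.2

end AngularLP

end

/-!
The operators `R̄_l` and `R̄_{≤ l}` act on every sphere `|x| = ρ` separately, by integration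
against a zonal kernel `∑_n a_n 𝔷_n(⟨θ, η⟩)` whose coefficients are sampled from `φ` or `ψ` at
scale `2^l`. They are written as `zonOp a = sphOp (polyKer (zon a))` for a finitely supported
sequence `a`, and every assertion becomes one about the sequence `a` and its kernel.

*Algebra.* Legendre polynomials about two axes are orthogonal, by Green's identity on the sphere
(`integral_zonal`, `integral_leg_mul_leg_of_ne`). The low-frequency kernels are an approximate
identity (`Bump.tendsto_integral_zon`), and with orthogonality this yields that zonal kernels
compose by multiplying their coefficients (`Bump.integral_zon_mul_zon`). No addition theorem and
no basis of spherical harmonics is needed. Bands at distance at least four have disjoint supports,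
and a product of kernels of degrees `D` and `D'` is orthogonal to every kernel of degree above
`D + D'` (`integral_zon_mul_zon_mul_zon`), which is the product rule.

*Kernel bounds.* Multiplication by `1 - ⟨σ, η⟩` acts on Legendre coefficients as a second
difference, through the three-term recurrence, and gains `2^{-2 l}` for coefficients sampled from
a smooth function whose derivative vanishes at the origin (`SymBound`). Parseval and
Cauchy-Schwarz with the weight `1 + 2^{-2 l} - ⟨σ, η⟩` bound the kernel in `L¹` by a constant and
its tangential gradient by `O(2^l)` (`SymBound.integral_abs_le`,
`SymBound.integral_abs_deriv_le`). The map `(x, θ) ↦ (|x| θ, x / |x|)` preserves the measure of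
`ℝ³ × 𝕊²` (`measurePreserving_dirSwap`). This gives Schur's test on every `L^r`
(`SchurKernel.eLpNorm_le`) and the transposition formula (`integral_sphOp_mul`).

*Square integrable functions.* The quadratic form of `zonOp a` is monotone in `a`, since a
nonnegative symbol is a square (`Bump.zonForm_mono`). Pointwise inequalities between symbols then
give the square function estimate, and the unconditional convergence follows from the approximate
identity.

*Commutation.* A zonal operator acts in the same way on both variables of a plane wave, because
the reflection that exchanges two points of the sphere preserves its measure
(`integral_dot_mul_polyKer_comm`). Transposition gives the commutation with the Fourier transform
on `L¹`, and duality against test functions gives it on `L²`. For continuously differentiable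
functions the rotation fields and the scaling field commute with `zonOp a` away from the origin,
where they span all directions. At the origin the first-order Taylor polynomial, on which
`zonOp a` acts by scalars, is subtracted first (`Bump.contDiff_zonOp`).

*Bernstein property.* A rotation field applied to `zonOp a f` is an operator with kernel
`wedgeKer (zon a)`, of norm `O(2^l)` by the gradient bound. The sum of the squares of the
rotation fields is the spherical Laplacian, with symbol `-n (n + 1)`. On the band `l` it is
inverted by a smooth multiplier (`Bump.cutInvPair`), so that `R̄_l f` is recovered from its rotational derivatives
(`Bump.R_eq_sum_sphOp`).
-/

noncomputable section

namespace AngularLP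

/-- The unit sphere of Euclidean three-space. -/
abbrev S2 : Type := Metric.sphere (0 : E3) 1

instance : IsFiniteMeasure sphereMeasure := by
  unfold sphereMeasure; infer_instance

theorem sphereMeasure_univ : sphereMeasure.real Set.univ = 4 * Real.pi := by
  rw [sphereMeasure, Measure.toSphere_real_apply_univ, measureReal_def,
    EuclideanSpace.volume_ball_fin_three, finrank_euclideanSpace_fin]
  rw [ENNReal.ofReal_one, one_pow, one_mul, ENNReal.toReal_ofReal (by positivity)]
  push_cast; ring

theorem norm_direction (x : E3) : ‖direction x‖ = 1 := by
  unfold direction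
  split_ifs with h
  · simp
  · rw [norm_smul, norm_inv, norm_norm, inv_mul_cancel₀ (norm_ne_zero_iff.2 h)]

/-- The direction of a vector, as a point of the sphere. -/
def dirS (x : E3) : S2 := ⟨direction x, by simp [norm_direction]⟩

@[simp] theorem coe_dirS (x : E3) : (dirS x : E3) = direction x := rfl

theorem norm_smul_direction (x : E3) : ‖x‖ • direction x = x := by
  unfold direction
  split_ifs with h
  · simp [h]
  · rw [smul_smul, mul_inv_cancel₀ (norm_ne_zero_iff.2 h), one_smul]

@[simp] theorem S2.norm_coe (θ : S2) : ‖(θ : E3)‖ = 1 := by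
  simp

theorem norm_smul_S2 {r : ℝ} (hr : 0 ≤ r) (θ : S2) : ‖r • (θ : E3)‖ = r := by
  rw [norm_smul, S2.norm_coe, mul_one, Real.norm_of_nonneg hr]

/-- The value of `dirS` at the origin is an arbitrary unit vector, so that `r` must be positive
here. -/
theorem dirS_smul {r : ℝ} (hr : 0 < r) (θ : S2) : dirS (r • (θ : E3)) = θ := by
  apply Subtype.ext
  have h : r • (θ : E3) ≠ 0 := by
    rw [← norm_ne_zero_iff, norm_smul_S2 hr.le]; exact hr.ne'
  rw [coe_dirS, direction, if_neg h, norm_smul_S2 hr.le, smul_smul, inv_mul_cancel₀ hr.ne',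
    one_smul]

theorem measurable_dirS : Measurable dirS := by
  refine Measurable.subtype_mk ?_
  unfold direction
  exact Measurable.ite (measurableSet_singleton 0) measurable_const (by fun_prop)

/-- The involution `(x, θ) ↦ (|x| θ, x / |x|)` of `ℝ³ × 𝕊²`, which exchanges the direction of `x`
with the free direction `θ`. -/
def dirSwap (p : E3 × S2) : E3 × S2 := (‖p.1‖ • (p.2 : E3), dirS p.1)

/-- In polar coordinates `dirSwap` is the exchange of two factors `𝕊²` of a product measure. -/
theorem measurePreserving_dirSwap :
    MeasurePreserving dirSwap ((volume : Measure E3).prod sphereMeasure)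
      ((volume : Measure E3).prod sphereMeasure) := by
  set ρ : Measure (Set.Ioi (0 : ℝ)) := Measure.volumeIoiPow (Module.finrank ℝ E3 - 1)
  have h1 : MeasurePreserving (homeomorphUnitSphereProd E3).symm (sphereMeasure.prod ρ)
      (Measure.comap Subtype.val (volume : Measure E3)) :=
    MeasurePreserving.symm (homeomorphUnitSphereProd E3).toMeasurableEquiv
      (Measure.measurePreserving_homeomorphUnitSphereProd (volume : Measure E3))
  have h2 := (measurePreserving_subtype_coe (μa := (volume : Measure E3))
    (measurableSet_singleton (0 : E3)).compl)
  rw [restrict_compl_singleton] at h2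
  have h3 := (h2.comp h1).prod (MeasurePreserving.id sphereMeasure)
  have h4 : MeasurePreserving (fun p : (S2 × Set.Ioi (0 : ℝ)) × S2 => ((p.2, p.1.2), p.1.1))
      ((sphereMeasure.prod ρ).prod sphereMeasure) ((sphereMeasure.prod ρ).prod sphereMeasure) := by
    have e1 := Measure.measurePreserving_swap (μ := sphereMeasure.prod ρ) (ν := sphereMeasure)
    have e2 := (MeasurePreserving.id sphereMeasure).prod
      (Measure.measurePreserving_swap (μ := sphereMeasure) (ν := ρ))
    have e3 := MeasurePreserving.symm _ (measurePreserving_prodAssoc sphereMeasure ρ sphereMeasure)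
    exact e3.comp (e2.comp e1)
  refine MeasurePreserving.of_semiconj h3 h4 ?_ ?_
  · rintro ⟨⟨η, r⟩, θ⟩
    have hr : (0 : ℝ) < r := r.2
    simp only [Prod.map, Function.comp, dirSwap, homeomorphUnitSphereProd_symm_apply_coe, id,
      norm_smul_S2 hr.le, dirS_smul hr]
  · have := measurable_dirS
    unfold dirSwap
    fun_prop

/-! ### Rotations of the sphere -/

/-- The action of a linear isometry on the unit sphere. -/
def sphereMap (U : E3 ≃ₗᵢ[ℝ] E3) (θ : S2) : S2 := ⟨U θ, by simp⟩

@[simp] theorem coe_sphereMap (U : E3 ≃ₗᵢ[ℝ] E3) (θ : S2) : (sphereMap U θ : E3) = U θ := rfl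

theorem continuous_sphereMap (U : E3 ≃ₗᵢ[ℝ] E3) : Continuous (sphereMap U) := by
  unfold sphereMap
  have := U.continuous
  fun_prop

open scoped Pointwise in
theorem measurePreserving_sphereMap (U : E3 ≃ₗᵢ[ℝ] E3) :
    MeasurePreserving (sphereMap U) sphereMeasure sphereMeasure := by
  refine ⟨(continuous_sphereMap U).measurable, ?_⟩
  ext A hA
  have hA' := (continuous_sphereMap U).measurable hA
  rw [Measure.map_apply (continuous_sphereMap U).measurable hA, sphereMeasure,
    Measure.toSphere_apply' _ hA, Measure.toSphere_apply' _ hA']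
  congr 1
  have hU : MeasurePreserving U.toHomeomorph.toMeasurableEquiv (volume : Measure E3) volume :=
    LinearIsometryEquiv.measurePreserving U
  rw [← hU.measure_preimage_equiv (Set.Ioo (0 : ℝ) 1 • (Subtype.val '' A))]
  congr 1
  ext x
  simp only [Set.mem_smul, Set.mem_image, Set.mem_preimage]
  constructor
  · rintro ⟨r, hr, y, ⟨θ, hθ, rfl⟩, rfl⟩
    exact ⟨r, hr, U θ, ⟨sphereMap U θ, hθ, rfl⟩, (map_smul U r (θ : E3)).symm⟩
  · rintro ⟨r, hr, y, ⟨θ, hθ, rfl⟩, h⟩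
    refine ⟨r, hr, U.symm θ, ⟨sphereMap U.symm θ, ?_, rfl⟩, ?_⟩
    · convert hθ
      exact Subtype.ext (U.apply_symm_apply _)
    · apply U.injective
      rw [map_smul, U.apply_symm_apply]
      exact h

theorem integral_sphereMap {V : Type*} [NormedAddCommGroup V] [NormedSpace ℝ V]
    (U : E3 ≃ₗᵢ[ℝ] E3) (f : S2 → V) :
    ∫ θ, f (sphereMap U θ) ∂sphereMeasure = ∫ θ, f θ ∂sphereMeasure := by
  have hinv : ∀ W : E3 ≃ₗᵢ[ℝ] E3, ∀ θ, sphereMap W (sphereMap W.symm θ) = θ := fun W θ =>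
    Subtype.ext (by simp)
  let e : S2 ≃ₜ S2 :=
    { toFun := sphereMap U
      invFun := sphereMap U.symm
      left_inv := fun θ => Subtype.ext (by simp)
      right_inv := hinv U
      continuous_toFun := continuous_sphereMap U
      continuous_invFun := continuous_sphereMap U.symm }
  exact (measurePreserving_sphereMap U).integral_comp e.measurableEmbedding f

theorem integrable_sphere {V : Type*} [NormedAddCommGroup V] {f : S2 → V}
    (hf : Continuous f) : Integrable f sphereMeasure :=
  hf.integrable_of_hasCompactSupport (HasCompactSupport.of_compactSpace f)

/-- The infinitesimal rotation `x ↦ x_a e_b - x_b e_a`, so that `Ω_{ab} f (x)` is the derivative of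
`f` at `x` along `rotGen a b x`. -/
def rotGen (a b : Fin 3) : E3 →L[ℝ] E3 :=
  (EuclideanSpace.proj a).smulRight (EuclideanSpace.single b (1 : ℝ)) -
    (EuclideanSpace.proj b).smulRight (EuclideanSpace.single a (1 : ℝ))

theorem rotGen_apply (a b : Fin 3) (x : E3) : rotGen a b x =
    x a • EuclideanSpace.single b (1 : ℝ) - x b • EuclideanSpace.single a (1 : ℝ) := by
  simp [rotGen]

theorem Omega_eq (a b : Fin 3) (f : E3 → ℂ) (x : E3) :
    Omega a b f x = fderiv ℝ f x (rotGen a b x) := by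
  rw [rotGen_apply, map_sub, map_smul, map_smul, Omega, Complex.real_smul, Complex.real_smul]

/-- The linear map `x ↦ x + (cos s - 1) (x_a e_a + x_b e_b) + sin s (x_a e_b - x_b e_a)`. -/
def rotLin (a b : Fin 3) (s : ℝ) : E3 →ₗ[ℝ] E3 :=
  LinearMap.id + (Real.cos s - 1) •
    (((EuclideanSpace.proj a).smulRight (EuclideanSpace.single a (1 : ℝ)) +
    (EuclideanSpace.proj b).smulRight (EuclideanSpace.single b (1 : ℝ)) : E3 →L[ℝ] E3) :
      E3 →ₗ[ℝ] E3) + Real.sin s • (rotGen a b : E3 →ₗ[ℝ] E3)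

theorem rotLin_apply (a b : Fin 3) (s : ℝ) (x : E3) : rotLin a b s x =
    x + (Real.cos s - 1) • (x a • EuclideanSpace.single a (1 : ℝ) +
      x b • EuclideanSpace.single b (1 : ℝ)) + Real.sin s • rotGen a b x := by
  simp [rotLin]

theorem norm_rotLin {a b : Fin 3} (hab : a ≠ b) (s : ℝ) (x : E3) : ‖rotLin a b s x‖ = ‖x‖ := by
  rw [← sq_eq_sq₀ (norm_nonneg _) (norm_nonneg _), EuclideanSpace.real_norm_sq_eq,
    EuclideanSpace.real_norm_sq_eq]
  have h := Real.sin_sq_add_cos_sq s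
  simp only [rotLin_apply, rotGen_apply]
  fin_cases a <;> fin_cases b <;> simp at hab <;>
    simp [Fin.sum_univ_three]
  · linear_combination (x 0 ^ 2 + x 1 ^ 2) * h
  · linear_combination (x 0 ^ 2 + x 2 ^ 2) * h
  · linear_combination (x 0 ^ 2 + x 1 ^ 2) * h
  · linear_combination (x 1 ^ 2 + x 2 ^ 2) * h
  · linear_combination (x 0 ^ 2 + x 2 ^ 2) * h
  · linear_combination (x 1 ^ 2 + x 2 ^ 2) * h

/-- The rotation by the angle `s` in the plane of the coordinates `a ≠ b`. -/
def rot {a b : Fin 3} (hab : a ≠ b) (s : ℝ) : E3 ≃ₗᵢ[ℝ] E3 :=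
  LinearIsometry.toLinearIsometryEquiv ⟨rotLin a b s, norm_rotLin hab s⟩ rfl

theorem rot_apply {a b : Fin 3} (hab : a ≠ b) (s : ℝ) (x : E3) :
    rot hab s x = rotLin a b s x := rfl

theorem hasDerivAt_rot {a b : Fin 3} (hab : a ≠ b) (s : ℝ) (x : E3) :
    HasDerivAt (fun s => rot hab s x) (rotGen a b (rot hab s x)) s := by
  have h1 : HasDerivAt (fun s => rot hab s x)
      ((-Real.sin s) • (x a • EuclideanSpace.single a (1 : ℝ)
      + x b • EuclideanSpace.single b (1 : ℝ)) + Real.cos s • rotGen a b x) s := by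
    simp only [rot_apply, rotLin_apply]
    exact ((((Real.hasDerivAt_cos s).sub_const 1).smul_const _).const_add x).add
      ((Real.hasDerivAt_sin s).smul_const _)
  convert h1 using 1
  rw [rotGen_apply, rot_apply, rotLin_apply, rotGen_apply]
  have h2 : b ≠ a := hab.symm
  simp [hab, h2]
  module

/-- Integration by parts on the sphere: a rotation preserves the integral of `F` over the sphere,
and the derivative of this identity in the angle of rotation is the claim. -/
theorem integral_fderiv_rotGen {V : Type*} [NormedAddCommGroup V] [NormedSpace ℝ V]
    {F : E3 → V} {U : Set E3} (hU : IsOpen U) (hsU : ∀ θ : S2, (θ : E3) ∈ U)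
    (hF : ContDiffOn ℝ 1 F U) (a b : Fin 3) :
    ∫ θ : S2, fderiv ℝ F θ (rotGen a b θ) ∂sphereMeasure = 0 := by
  rcases eq_or_ne a b with rfl | hab
  · simp [rotGen]
  have hc : Continuous fun θ : S2 => fderiv ℝ F θ (rotGen a b θ) := by
    have h1 : ContinuousOn (fderiv ℝ F) U := hF.continuousOn_fderiv_of_isOpen hU le_rfl
    have h2 : Continuous fun θ : S2 => fderiv ℝ F θ :=
      h1.comp_continuous continuous_subtype_val hsU
    exact h2.clm_apply ((rotGen a b).continuous.comp continuous_subtype_val)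
  have hFc : Continuous fun θ : S2 => F θ :=
    hF.continuousOn.comp_continuous continuous_subtype_val hsU
  obtain ⟨M, hM⟩ := (isCompact_range hc.norm).bddAbove
  have hM' : ∀ θ : S2, ‖fderiv ℝ F θ (rotGen a b θ)‖ ≤ M := fun θ => hM ⟨θ, rfl⟩
  have key := (hasDerivAt_integral_of_dominated_loc_of_deriv_le (μ := sphereMeasure) (s := Set.univ)
    (F := fun s (θ : S2) => F (sphereMap (rot hab s) θ))
    (F' := fun s (θ : S2) => fderiv ℝ F (sphereMap (rot hab s) θ)
      (rotGen a b (sphereMap (rot hab s) θ))) (bound := fun _ => M) (x₀ := (0 : ℝ))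
    univ_mem
    (Eventually.of_forall fun s =>
      (hFc.comp (continuous_sphereMap _)).aestronglyMeasurable)
    (integrable_sphere (hFc.comp (continuous_sphereMap _)))
    (hc.comp (continuous_sphereMap _)).aestronglyMeasurable
    (Eventually.of_forall fun θ s _ => hM' _)
    (integrable_const _)
    (Eventually.of_forall fun θ s _ => by
      have h1 : HasFDerivAt F (fderiv ℝ F (rot hab s θ)) (rot hab s θ) :=
        ((hF.differentiableOn one_ne_zero).differentiableAt
          (hU.mem_nhds (hsU (sphereMap (rot hab s) θ)))).hasFDerivAt
      exact h1.comp_hasDerivAt s (hasDerivAt_rot hab s θ))).2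
  have hconst : (fun s => ∫ θ : S2, F (sphereMap (rot hab s) θ) ∂sphereMeasure) =
      fun _ => ∫ θ : S2, F θ ∂sphereMeasure := by
    funext s
    exact integral_sphereMap (rot hab s) (fun θ : S2 => F θ)
  rw [hconst] at key
  have h0 := key.unique (hasDerivAt_const _ _)
  rwa [integral_sphereMap (rot hab 0) (fun θ : S2 => fderiv ℝ F θ (rotGen a b θ))] at h0

/-! ### Legendre polynomials -/

section Legendre

open Polynomial

/-- The Legendre polynomial `P_n`, given by Rodrigues' formula. -/
def leg (n : ℕ) : ℝ[X] :=
  C (1 / (2 ^ n * (n.factorial : ℝ))) * derivative^[n] ((X ^ 2 - 1 : ℝ[X]) ^ n)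

theorem legendre_eq (n : ℕ) (z : ℝ) : legendre n z = (leg n).eval z := by
  simp [legendre, leg]

theorem leg_zero : leg 0 = 1 := by simp [leg]

theorem leg_one : leg 1 = X := by
  rw [leg]
  simp only [Function.iterate_one, pow_one, derivative_sub, derivative_X_sq, derivative_one,
    sub_zero, Nat.factorial_one]
  rw [← mul_assoc, ← C_mul]
  norm_num

/-- Obtained by differentiating `((X² - 1)^{n+1})' = 2 (n + 1) X (X² - 1)^n` another `n + 1`
times. -/
theorem derivative_leg_succ (n : ℕ) :
    derivative (leg (n + 1)) = X * derivative (leg n) + C ((n : ℝ) + 1) * leg n := by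
  have h1 : derivative ((X ^ 2 - 1 : ℝ[X]) ^ (n + 1)) =
      C (2 * ((n : ℝ) + 1)) * (X * (X ^ 2 - 1 : ℝ[X]) ^ n) := by
    rw [derivative_pow_succ]
    simp only [derivative_sub, derivative_X_sq, derivative_one, sub_zero, map_mul, map_add,
      map_natCast, map_one]
    ring
  have h2 : derivative^[n + 2] ((X ^ 2 - 1 : ℝ[X]) ^ (n + 1)) =
      C (2 * ((n : ℝ) + 1)) * (X * derivative^[n + 1] ((X ^ 2 - 1 : ℝ[X]) ^ n) +
        C ((n : ℝ) + 1) * derivative^[n] ((X ^ 2 - 1 : ℝ[X]) ^ n)) := by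
    rw [show n + 2 = (n + 1) + 1 from rfl, Function.iterate_succ_apply, h1,
      iterate_derivative_C_mul, mul_comm X, iterate_derivative_mul_X]
    simp only [nsmul_eq_mul, Nat.add_sub_cancel, map_add, map_natCast, map_one]
    push_cast
    ring
  have h3 : (1 / (2 ^ (n + 1) * ((n + 1).factorial : ℝ))) * (2 * ((n : ℝ) + 1)) =
      1 / (2 ^ n * (n.factorial : ℝ)) := by
    rw [Nat.factorial_succ]; push_cast
    have : ((n.factorial : ℕ) : ℝ) ≠ 0 := by positivity
    have : (n : ℝ) + 1 ≠ 0 := by positivity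
    field_simp
    ring
  simp only [leg, derivative_C_mul, ← Function.iterate_succ_apply' derivative]
  rw [h2, ← mul_assoc, ← C_mul, h3]
  ring

theorem derivative_leg_succ_succ (n : ℕ) :
    derivative (leg (n + 2)) = C (2 * (n : ℝ) + 3) * leg (n + 1) + derivative (leg n) := by
  have h1 : derivative^[2] ((X ^ 2 - 1 : ℝ[X]) ^ (n + 2)) =
      C (2 * ((n : ℝ) + 2) * (2 * n + 3)) * (X ^ 2 - 1 : ℝ[X]) ^ (n + 1) +
      C (4 * ((n : ℝ) + 1) * (n + 2)) * (X ^ 2 - 1 : ℝ[X]) ^ n := by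
    rw [Function.iterate_succ_apply, Function.iterate_one, derivative_pow_succ, derivative_mul,
      derivative_mul, derivative_pow_succ]
    simp only [derivative_sub, derivative_X_sq, derivative_one, sub_zero, map_mul, map_add,
      map_natCast, map_one, derivative_natCast, map_ofNat]
    have h2 : derivative (2 * X : ℝ[X]) = 2 := by
      rw [derivative_mul, derivative_X, derivative_ofNat]; ring
    rw [h2]
    push_cast
    ring
  have h2 : derivative^[n + 3] ((X ^ 2 - 1 : ℝ[X]) ^ (n + 2)) =
      C (2 * ((n : ℝ) + 2) * (2 * n + 3)) * derivative^[n + 1] ((X ^ 2 - 1 : ℝ[X]) ^ (n + 1)) +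
      C (4 * ((n : ℝ) + 1) * (n + 2)) * derivative^[n + 1] ((X ^ 2 - 1 : ℝ[X]) ^ n) := by
    rw [show n + 3 = (n + 1) + 2 by ring, Function.iterate_add_apply, h1,
      iterate_map_add, iterate_derivative_C_mul, iterate_derivative_C_mul]
  have hf : ((n.factorial : ℕ) : ℝ) ≠ 0 := by positivity
  have hn1 : (n : ℝ) + 1 ≠ 0 := by positivity
  have hn2 : (n : ℝ) + 2 ≠ 0 := by positivity
  have h3 : (1 / (2 ^ (n + 2) * ((n + 2).factorial : ℝ))) * (2 * ((n : ℝ) + 2) * (2 * n + 3)) =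
      (2 * n + 3) * (1 / (2 ^ (n + 1) * ((n + 1).factorial : ℝ))) := by
    rw [Nat.factorial_succ, Nat.factorial_succ]; push_cast
    rw [show (n : ℝ) + 1 + 1 = n + 2 by ring]
    field_simp
    ring
  have h4 : (1 / (2 ^ (n + 2) * ((n + 2).factorial : ℝ))) * (4 * ((n : ℝ) + 1) * (n + 2)) =
      1 / (2 ^ n * (n.factorial : ℝ)) := by
    rw [Nat.factorial_succ, Nat.factorial_succ]; push_cast
    rw [show (n : ℝ) + 1 + 1 = n + 2 by ring]
    field_simp
    ring
  simp only [leg, derivative_C_mul, ← Function.iterate_succ_apply' derivative]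
  rw [h2, mul_add, ← mul_assoc, ← mul_assoc, ← C_mul, ← C_mul, h3, h4, C_mul, mul_assoc]

theorem derivative_leg_eq (n : ℕ) :
    derivative (leg n) = X * derivative (leg (n + 1)) - C ((n : ℝ) + 1) * leg (n + 1) := by
  have h1 := derivative_leg_succ_succ n
  have h2 := derivative_leg_succ (n + 1)
  push_cast at h2
  rw [h1] at h2
  simp only [map_add, map_mul, map_natCast, map_one, map_ofNat] at h2 ⊢
  linear_combination h2

theorem one_sub_sq_mul_derivative_leg (n : ℕ) :
    (1 - X ^ 2) * derivative (leg n) = C ((n : ℝ) + 1) * (X * leg n - leg (n + 1)) := by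
  have h1 := derivative_leg_eq n
  have h2 := derivative_leg_succ n
  rw [h2] at h1
  linear_combination h1

theorem one_sub_sq_mul_derivative_leg_succ (n : ℕ) :
    (1 - X ^ 2) * derivative (leg (n + 1)) =
      C ((n : ℝ) + 1) * (leg n - X * leg (n + 1)) := by
  have h1 := derivative_leg_eq n
  have h2 := derivative_leg_succ n
  rw [h1] at h2
  linear_combination h2

/-- The three-term recurrence. -/
theorem leg_recurrence (n : ℕ) :
    C (2 * (n : ℝ) + 3) * (X * leg (n + 1)) =
      C ((n : ℝ) + 2) * leg (n + 2) + C ((n : ℝ) + 1) * leg n := by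
  have h1 := one_sub_sq_mul_derivative_leg (n + 1)
  have h2 := one_sub_sq_mul_derivative_leg_succ n
  rw [h1] at h2
  push_cast at h2
  simp only [map_add, map_mul, map_natCast, map_one, map_ofNat] at h2 ⊢
  linear_combination h2

/-- The Legendre differential equation. -/
theorem leg_ode (n : ℕ) :
    (1 - X ^ 2) * derivative (derivative (leg n)) - 2 * X * derivative (leg n) =
      -(C ((n : ℝ) * (n + 1)) * leg n) := by
  have h1 := congrArg derivative (one_sub_sq_mul_derivative_leg n)
  have h2 := derivative_leg_succ n
  simp only [derivative_mul, derivative_sub, derivative_one, derivative_X_sq, derivative_C,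
    derivative_X, h2] at h1
  simp only [map_add, map_mul, map_natCast, map_one, map_ofNat] at h1 ⊢
  linear_combination h1

/-- Powers are combinations of Legendre polynomials of no larger degree. -/
theorem X_pow_mem_span_leg (d : ℕ) :
    (X ^ d : ℝ[X]) ∈ Submodule.span ℝ (leg '' Set.Iic d) := by
  induction d with
  | zero => exact Submodule.subset_span ⟨0, by simp, by simp [leg_zero]⟩
  | succ d ih =>
    rw [pow_succ']
    have h : ∀ p ∈ Submodule.span ℝ (leg '' Set.Iic d),
        X * p ∈ Submodule.span ℝ (leg '' Set.Iic (d + 1)) := by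
      intro p hp
      induction hp using Submodule.span_induction with
      | zero => simp
      | add p q _ _ hp hq => rw [mul_add]; exact Submodule.add_mem _ hp hq
      | smul c p _ hp => rw [mul_smul_comm]; exact Submodule.smul_mem _ _ hp
      | mem p hp =>
        obtain ⟨r, hr, rfl⟩ := hp
        have hr' : r ≤ d := hr
        rcases r with _ | r
        · refine Submodule.subset_span ⟨1, by simp, by simp [leg_one, leg_zero]⟩
        · have h1 := leg_recurrence r
          have h2 : X * leg (r + 1) = (2 * (r : ℝ) + 3)⁻¹ •
              (((r : ℝ) + 2) • leg (r + 2) + ((r : ℝ) + 1) • leg r) := by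
            rw [smul_eq_C_mul, smul_eq_C_mul, smul_eq_C_mul, ← h1, ← mul_assoc, ← C_mul,
              inv_mul_cancel₀ (by positivity), C_1, one_mul]
          rw [h2]
          refine Submodule.smul_mem _ _ (Submodule.add_mem _ (Submodule.smul_mem _ _ ?_)
            (Submodule.smul_mem _ _ ?_))
          · exact Submodule.subset_span ⟨r + 2, by simp; omega, rfl⟩
          · exact Submodule.subset_span ⟨r, by simp; omega, rfl⟩
    exact h _ ih

end Legendre

/-! ### Integrals of zonal functions -/

section Zonal

open Polynomial

/-- The inner product of two points of the unit sphere. -/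
def dot (θ η : S2) : ℝ := inner ℝ (θ : E3) (η : E3)

theorem dot_comm (θ η : S2) : dot θ η = dot η θ := real_inner_comm _ _

@[simp] theorem dot_self (θ : S2) : dot θ θ = 1 := by
  rw [dot, real_inner_self_eq_norm_sq, S2.norm_coe, one_pow]

theorem abs_dot_le (θ η : S2) : |dot θ η| ≤ 1 := by
  simpa [dot] using abs_real_inner_le_norm (θ : E3) (η : E3)

theorem dot_le_one (θ η : S2) : dot θ η ≤ 1 := (abs_le.1 (abs_dot_le θ η)).2

theorem dot_sq_le_one (θ η : S2) : dot θ η ^ 2 ≤ 1 := by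
  rw [← sq_abs]; exact pow_le_one₀ (abs_nonneg _) (abs_dot_le θ η)

theorem one_sub_dot (θ η : S2) : 1 - dot θ η = ‖(θ : E3) - η‖ ^ 2 / 2 := by
  rw [norm_sub_sq_real, S2.norm_coe, S2.norm_coe, dot]; ring

@[fun_prop]
theorem continuous_dot {α : Type*} [TopologicalSpace α] {f g : α → S2} (hf : Continuous f)
    (hg : Continuous g) : Continuous fun x => dot (f x) (g x) :=
  (continuous_subtype_val.comp hf).inner (continuous_subtype_val.comp hg)

theorem dot_sphereMap (U : E3 ≃ₗᵢ[ℝ] E3) (θ η : S2) :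
    dot (sphereMap U θ) (sphereMap U η) = dot θ η := U.inner_map_map _ _

theorem dot_eq (θ η : S2) : dot θ η =
    (θ : E3) 0 * (η : E3) 0 + (θ : E3) 1 * (η : E3) 1 + (θ : E3) 2 * (η : E3) 2 := by
  simp [dot, PiLp.inner_apply, Fin.sum_univ_three, mul_comm]

/-- The coordinates `x_a y_b - x_b y_a` of the wedge product of two vectors. -/
def wedge (a b : Fin 3) (x y : E3) : ℝ := x a * y b - x b * y a

theorem inner_rotGen (a b : Fin 3) (x y : E3) : inner ℝ (rotGen a b x) y = wedge a b x y := by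
  rw [rotGen_apply, inner_sub_left, real_inner_smul_left, real_inner_smul_left,
    EuclideanSpace.inner_single_left, EuclideanSpace.inner_single_left]
  simp [wedge]

theorem wedge_swap (a b : Fin 3) (x y : E3) : wedge a b y x = -wedge a b x y := by
  simp only [wedge]; ring

/-- The Lagrange identity on the sphere. -/
theorem wedge_mul_wedge_sum (σ θ η : S2) :
    wedge 0 1 σ η * wedge 0 1 σ θ + wedge 0 2 σ η * wedge 0 2 σ θ +
      wedge 1 2 σ η * wedge 1 2 σ θ = dot η θ - dot η σ * dot σ θ := by
  have h := dot_self σ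
  rw [dot_eq] at h
  simp only [dot_eq, wedge]
  linear_combination ((η : E3) 0 * (θ : E3) 0 + (η : E3) 1 * (θ : E3) 1 +
    (η : E3) 2 * (θ : E3) 2) * h

theorem wedge_sq_le (a b : Fin 3) (σ θ : S2) : wedge a b σ θ ^ 2 ≤ 1 - dot σ θ ^ 2 := by
  have h := wedge_mul_wedge_sum σ θ θ
  rw [dot_self, dot_comm θ σ] at h
  have h1 := sq_nonneg (wedge 0 1 σ θ)
  have h2 := sq_nonneg (wedge 0 2 σ θ)
  have h3 := sq_nonneg (wedge 1 2 σ θ)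
  have h4 : wedge 1 0 σ θ = - wedge 0 1 σ θ := by simp only [wedge]; ring
  have h5 : wedge 2 0 σ θ = - wedge 0 2 σ θ := by simp only [wedge]; ring
  have h6 : wedge 2 1 σ θ = - wedge 1 2 σ θ := by simp only [wedge]; ring
  have h7 : ∀ c, wedge c c σ θ = 0 := fun c => by simp only [wedge]; ring
  fin_cases a <;> fin_cases b <;>
    simp only [Fin.zero_eta, Fin.mk_one, Fin.reduceFinMk, h4, h5, h6, h7] <;> nlinarith

/-- Green's identity before the summation over the coordinate planes: `integral_fderiv_rotGen` for
the function `g(⟨σ, η⟩) h(⟨σ, θ⟩) ⟨rotGen a b σ, θ⟩`. -/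
theorem integral_zonal_aux {g h : ℝ → ℝ} {c : ℝ} (hc : 1 < c) (hg : ContDiff ℝ 1 g)
    (hh : ContDiffOn ℝ 1 h (Set.Iio c)) (θ η : S2) {a b : Fin 3} (hab : a ≠ b) :
    ∫ σ : S2, (deriv g (dot σ η) * h (dot σ θ) * (wedge a b σ η * wedge a b σ θ) +
      g (dot σ η) * (deriv h (dot σ θ) * (wedge a b σ θ * wedge a b σ θ) -
        h (dot σ θ) * ((σ : E3) a * (θ : E3) a + (σ : E3) b * (θ : E3) b)))
      ∂sphereMeasure = 0 := by
  set W : E3 →L[ℝ] ℝ := (innerSL ℝ (θ : E3)).comp (rotGen a b) with hW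
  set U : Set E3 := (innerSL ℝ (θ : E3)) ⁻¹' Set.Iio c with hUdef
  have hU : IsOpen U := isOpen_Iio.preimage (innerSL ℝ (θ : E3)).continuous
  have hsU : ∀ σ : S2, (σ : E3) ∈ U := fun σ => by
    change inner ℝ (θ : E3) σ < c
    exact (dot_le_one θ σ).trans_lt hc
  have hF : ContDiffOn ℝ 1 (fun x => g (innerSL ℝ (η : E3) x) * h (innerSL ℝ (θ : E3) x) * W x)
      U := by
    refine ContDiffOn.mul (ContDiffOn.mul ?_ ?_) W.contDiff.contDiffOn
    · exact (hg.comp (innerSL ℝ (η : E3)).contDiff).contDiffOn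
    · exact hh.comp (innerSL ℝ (θ : E3)).contDiff.contDiffOn fun x hx => hx
  rw [← integral_fderiv_rotGen hU hsU hF a b]
  congr 1
  funext σ
  have e1 : innerSL ℝ (η : E3) (σ : E3) = dot σ η := dot_comm η σ
  have e2 : innerSL ℝ (θ : E3) (σ : E3) = dot σ θ := dot_comm θ σ
  have d1 : HasFDerivAt (fun x : E3 => g (innerSL ℝ (η : E3) x))
      (deriv g (dot σ η) • innerSL ℝ (η : E3)) (σ : E3) := by
    rw [← e1]
    exact ((hg.differentiable one_ne_zero).differentiableAt.hasDerivAt).comp_hasFDerivAt (σ : E3)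
      (innerSL ℝ (η : E3)).hasFDerivAt
  have d2 : HasFDerivAt (fun x : E3 => h (innerSL ℝ (θ : E3) x))
      (deriv h (dot σ θ) • innerSL ℝ (θ : E3)) (σ : E3) := by
    rw [← e2]
    exact (((hh.differentiableOn one_ne_zero).differentiableAt
      (isOpen_Iio.mem_nhds (hsU σ))).hasDerivAt).comp_hasFDerivAt (σ : E3)
      (innerSL ℝ (θ : E3)).hasFDerivAt
  have d3 := (d1.fun_mul d2).fun_mul W.hasFDerivAt
  rw [HasFDerivAt.fderiv d3]
  have e3 : ∀ x y : E3, innerSL ℝ y (rotGen a b x) = wedge a b x y := fun x y => by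
    rw [← inner_rotGen]; exact real_inner_comm (rotGen a b x) y
  have e4 : W σ = wedge a b σ θ := e3 _ _
  have e5 : W (rotGen a b σ) = -((σ : E3) a * (θ : E3) a + (σ : E3) b * (θ : E3) b) := by
    have : W (rotGen a b σ) = wedge a b (rotGen a b σ) θ := e3 _ _
    rw [this, wedge, rotGen_apply]
    simp [hab, hab.symm]
    ring
  simp only [add_apply, smul_apply, e1, e2, e3, e4, e5,
    smul_eq_mul]
  ring

/-- Green's identity for two zonal functions with different axes, in its general form: the vector
field is `g(⟨σ, η⟩) h(⟨σ, θ⟩)` times the gradient of `⟨·, θ⟩` on the sphere. -/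
theorem integral_zonal {g h : ℝ → ℝ} {c : ℝ} (hc : 1 < c) (hg : ContDiff ℝ 1 g)
    (hh : ContDiffOn ℝ 1 h (Set.Iio c)) (θ η : S2) :
    ∫ σ : S2, (deriv g (dot σ η) * h (dot σ θ) * (dot η θ - dot η σ * dot σ θ) +
      g (dot σ η) * ((1 - dot σ θ ^ 2) * deriv h (dot σ θ) - 2 * dot σ θ * h (dot σ θ)))
      ∂sphereMeasure = 0 := by
  have hgc : Continuous fun σ : S2 => g (dot σ η) := hg.continuous.comp (by fun_prop)
  have hg'c : Continuous fun σ : S2 => deriv g (dot σ η) :=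
    (hg.continuous_deriv le_rfl).comp (by fun_prop)
  have hlt : ∀ σ : S2, dot σ θ ∈ Set.Iio c := fun σ => (dot_le_one σ θ).trans_lt hc
  have hhc : Continuous fun σ : S2 => h (dot σ θ) :=
    hh.continuousOn.comp_continuous (by fun_prop) hlt
  have hh'c : Continuous fun σ : S2 => deriv h (dot σ θ) :=
    (hh.continuousOn_deriv_of_isOpen isOpen_Iio le_rfl).comp_continuous (by fun_prop) hlt
  have hco : ∀ i, Continuous fun σ : S2 => (σ : E3) i := fun i => by fun_prop
  have hw : ∀ (a b : Fin 3) (y : E3), Continuous fun σ : S2 => wedge a b σ y := fun a b y =>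
    ((hco a).mul continuous_const).sub ((hco b).mul continuous_const)
  set G : Fin 3 → Fin 3 → S2 → ℝ := fun a b σ =>
    deriv g (dot σ η) * h (dot σ θ) * (wedge a b σ η * wedge a b σ θ) +
      g (dot σ η) * (deriv h (dot σ θ) * (wedge a b σ θ * wedge a b σ θ) -
        h (dot σ θ) * ((σ : E3) a * (θ : E3) a + (σ : E3) b * (θ : E3) b)) with hG
  have hint : ∀ a b : Fin 3, Integrable (G a b) sphereMeasure := fun a b =>
    integrable_sphere (((hg'c.mul hhc).mul ((hw a b η).mul (hw a b θ))).add
      (hgc.mul ((hh'c.mul ((hw a b θ).mul (hw a b θ))).sub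
        (hhc.mul (((hco a).mul continuous_const).add ((hco b).mul continuous_const))))))
  have h01 := integral_zonal_aux hc hg hh θ η (a := 0) (b := 1) (by decide)
  have h02 := integral_zonal_aux hc hg hh θ η (a := 0) (b := 2) (by decide)
  have h12 := integral_zonal_aux hc hg hh θ η (a := 1) (b := 2) (by decide)
  have hi : Integrable (fun σ => G 0 1 σ + G 0 2 σ) sphereMeasure := (hint 0 1).add (hint 0 2)
  have hs : ∫ σ, (G 0 1 σ + G 0 2 σ + G 1 2 σ) ∂sphereMeasure = 0 := by
    rw [integral_add hi (hint 1 2), integral_add (hint 0 1) (hint 0 2)]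
    simp only [hG, h01, h02, h12, add_zero]
  rw [← hs]
  congr 1
  funext σ
  have k1 := wedge_mul_wedge_sum σ θ η
  have k2 := wedge_mul_wedge_sum σ θ θ
  rw [dot_self, dot_comm θ σ] at k2
  have k3 := dot_eq σ θ
  simp only [hG]
  linear_combination (-(deriv g (dot σ η) * h (dot σ θ))) * k1 -
    (g (dot σ η) * deriv h (dot σ θ)) * k2 - 2 * g (dot σ η) * h (dot σ θ) * k3

theorem continuous_eval_dot (p : ℝ[X]) (η : S2) :
    Continuous fun σ : S2 => p.eval (dot σ η) := p.continuous.comp (by fun_prop)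

theorem contDiff_eval (p : ℝ[X]) : ContDiff ℝ 1 fun t => p.eval t := by
  simpa [Polynomial.aeval_def] using p.contDiff_aeval (𝕜 := ℝ) 1

/-- Green's identity for a Legendre polynomial. -/
theorem green_leg (q : ℝ[X]) (n : ℕ) (θ η : S2) :
    ∫ σ : S2, (derivative q).eval (dot σ η) * (derivative (leg n)).eval (dot σ θ) *
      (dot η θ - dot η σ * dot σ θ) ∂sphereMeasure =
    (n : ℝ) * (n + 1) * ∫ σ : S2, q.eval (dot σ η) * (leg n).eval (dot σ θ) ∂sphereMeasure := by
  have h := integral_zonal (g := fun t => q.eval t) (h := fun t => (derivative (leg n)).eval t)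
    (c := 2) (by norm_num) (contDiff_eval q)
    (contDiff_eval (derivative (leg n))).contDiffOn θ η
  have hode : ∀ t : ℝ, (1 - t ^ 2) * (derivative (derivative (leg n))).eval t -
      2 * t * (derivative (leg n)).eval t = -((n : ℝ) * (n + 1) * (leg n).eval t) := fun t => by
    simpa using congrArg (eval t) (leg_ode n)
  simp only [Polynomial.deriv, hode] at h
  have hc := continuous_eval_dot
  have c1 := hc q η
  have c2 := hc (leg n) θ
  have c3 := hc (derivative q) η
  have c4 := hc (derivative (leg n)) θ
  rw [integral_add (integrable_sphere (by fun_prop)) (integrable_sphere (by fun_prop))] at h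
  rw [← integral_const_mul, ← sub_eq_zero, sub_eq_add_neg, ← integral_neg, ← h]
  congr 2
  funext σ
  ring

/-- The gradient side of Green's identity `green_leg` is symmetric in the two polynomials, while the
eigenvalues `n (n + 1)` and `m (m + 1)` differ. -/
theorem integral_leg_mul_leg_of_ne {n m : ℕ} (hnm : n ≠ m) (θ η : S2) :
    ∫ σ : S2, (leg n).eval (dot σ η) * (leg m).eval (dot σ θ) ∂sphereMeasure = 0 := by
  have h1 := green_leg (leg n) m θ η
  have h2 := green_leg (leg m) n η θ
  have h3 : ∫ σ : S2, (leg m).eval (dot σ θ) * (leg n).eval (dot σ η) ∂sphereMeasure =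
      ∫ σ : S2, (leg n).eval (dot σ η) * (leg m).eval (dot σ θ) ∂sphereMeasure := by
    simp only [mul_comm]
  have h4 : ∫ σ : S2, (derivative (leg m)).eval (dot σ θ) * (derivative (leg n)).eval (dot σ η) *
      (dot θ η - dot θ σ * dot σ η) ∂sphereMeasure =
      ∫ σ : S2, (derivative (leg n)).eval (dot σ η) * (derivative (leg m)).eval (dot σ θ) *
      (dot η θ - dot η σ * dot σ θ) ∂sphereMeasure := by
    congr 1
    funext σ
    rw [dot_comm θ η, dot_comm θ σ, dot_comm σ η]
    ring
  rw [h3, h4, h1] at h2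
  have h5 : ((m : ℝ) * (m + 1) - n * (n + 1)) * ∫ σ : S2, (leg n).eval (dot σ η) *
      (leg m).eval (dot σ θ) ∂sphereMeasure = 0 := by
    rw [sub_mul, h2, sub_self]
  refine (mul_eq_zero.1 h5).resolve_left fun h6 => hnm ?_
  have h7 : ((m : ℝ) - n) * (m + n + 1) = 0 := by linear_combination h6
  rcases mul_eq_zero.1 h7 with h8 | h8
  · exact_mod_cast (sub_eq_zero.1 h8).symm
  · have : (0 : ℝ) < m + n + 1 := by positivity
    exact absurd h8 this.ne'

theorem integral_eval_dot_linear {p q r : ℝ[X]} {u v : ℝ} (h : p = C u * q + C v * r) (w : ℝ[X])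
    (η : S2) : ∫ σ : S2, p.eval (dot σ η) * w.eval (dot σ η) ∂sphereMeasure =
      u * ∫ σ : S2, q.eval (dot σ η) * w.eval (dot σ η) ∂sphereMeasure +
      v * ∫ σ : S2, r.eval (dot σ η) * w.eval (dot σ η) ∂sphereMeasure := by
  have hc := continuous_eval_dot
  have c1 := hc q η
  have c2 := hc r η
  have c3 := hc w η
  rw [← integral_const_mul, ← integral_const_mul, ← integral_add
    (integrable_sphere (by fun_prop)) (integrable_sphere (by fun_prop))]
  congr 1
  funext σ
  rw [h]
  simp only [eval_add, eval_mul, eval_C]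
  ring

/-- The three-term recurrence and orthogonality determine the ratio of consecutive norms, so that no
integral over the sphere has to be computed besides its area. -/
theorem integral_leg_sq (n : ℕ) (η : S2) :
    ∫ σ : S2, (leg n).eval (dot σ η) * (leg n).eval (dot σ η) ∂sphereMeasure =
      4 * Real.pi / (2 * n + 1) := by
  set I : ℝ[X] → ℝ[X] → ℝ := fun p q =>
    ∫ σ : S2, p.eval (dot σ η) * q.eval (dot σ η) ∂sphereMeasure with hI
  have hX : ∀ p q : ℝ[X], I (X * p) q = I (X * q) p := fun p q => by
    simp only [hI, eval_mul, eval_X]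
    congr 1
    funext σ
    ring
  have hrec : ∀ (n : ℕ) (w : ℝ[X]), (2 * (n : ℝ) + 3) * I (X * leg (n + 1)) w =
      ((n : ℝ) + 2) * I (leg (n + 2)) w + ((n : ℝ) + 1) * I (leg n) w := fun n w => by
    have h1 := integral_eval_dot_linear (leg_recurrence n) w η
    have h2 : (∫ σ : S2, (C (2 * (n : ℝ) + 3) * (X * leg (n + 1))).eval (dot σ η) *
        w.eval (dot σ η) ∂sphereMeasure) = (2 * (n : ℝ) + 3) * I (X * leg (n + 1)) w := by
      rw [hI, ← integral_const_mul]
      congr 1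
      funext σ
      simp only [eval_mul, eval_C]
      ring
    rw [← h2, h1]
  have hzero : ∀ {n m : ℕ}, n ≠ m → I (leg n) (leg m) = 0 := fun h =>
    integral_leg_mul_leg_of_ne h η η
  have h0 : I (leg 0) (leg 0) = 4 * Real.pi := by
    simp [hI, leg_zero, sphereMeasure_univ]
  have hdown : ∀ n : ℕ, (2 * (n : ℝ) + 3) * I (leg (n + 1)) (leg (n + 1)) =
      (2 * (n : ℝ) + 1) * I (leg n) (leg n) := by
    intro n
    have h1 := hrec n (leg n)
    rw [hzero (by omega : n + 2 ≠ n), mul_zero, zero_add, hX] at h1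
    rcases n with _ | n
    · have : X * leg 0 = leg 1 := by rw [leg_zero, leg_one, mul_one]
      rw [this] at h1
      simpa using h1
    · have h2 := hrec n (leg (n + 2))
      rw [hzero (by omega : n ≠ n + 2), mul_zero, add_zero] at h2
      push_cast at h1 ⊢
      have hn : (n : ℝ) + 2 ≠ 0 := by positivity
      apply mul_left_cancel₀ hn
      rw [show n + 1 + 1 = n + 2 from rfl] at h1 ⊢
      linear_combination (2 * (n : ℝ) + 3) * h1 - (2 * (n + 1) + 3) * h2
  change I (leg n) (leg n) = _
  induction n with
  | zero => simp [h0]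
  | succ n ih =>
    have h1 := hdown n
    rw [ih] at h1
    have h2 : 2 * (n : ℝ) + 1 ≠ 0 := by positivity
    have h3 : 2 * (n : ℝ) + 3 ≠ 0 := by positivity
    apply mul_left_cancel₀ h3
    rw [h1]
    push_cast
    rw [show 2 * ((n : ℝ) + 1) + 1 = 2 * n + 3 by ring]
    field_simp

/-- The polynomial `∑_{n < M} c_n P_n`. -/
def legSum (c : ℕ → ℝ) (M : ℕ) : ℝ[X] := ∑ n ∈ Finset.range M, C (c n) * leg n

theorem integral_sum_mul_sum {F : ℕ → S2 → ℝ} {w : S2 → ℝ} (hF : ∀ n, Continuous (F n))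
    (hw : Continuous w) {d : ℕ → ℝ} (hd : ∀ n, ∫ σ, w σ * F n σ * F n σ ∂sphereMeasure = d n)
    (h0 : ∀ n m, n ≠ m → ∫ σ, w σ * F n σ * F m σ ∂sphereMeasure = 0) (c : ℕ → ℝ) (M : ℕ) :
    ∫ σ, w σ * (∑ n ∈ Finset.range M, c n * F n σ) ^ 2 ∂sphereMeasure =
      ∑ n ∈ Finset.range M, c n ^ 2 * d n := by
  have h1 : ∀ σ, w σ * (∑ n ∈ Finset.range M, c n * F n σ) ^ 2 = ∑ n ∈ Finset.range M,
      ∑ m ∈ Finset.range M, c n * c m * (w σ * F n σ * F m σ) := fun σ => by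
    rw [sq, Finset.sum_mul_sum, Finset.mul_sum]
    refine Finset.sum_congr rfl fun n _ => ?_
    rw [Finset.mul_sum]
    exact Finset.sum_congr rfl fun m _ => by ring
  have hi : ∀ n m, Integrable (fun σ => c n * c m * (w σ * F n σ * F m σ)) sphereMeasure :=
    fun n m => integrable_sphere (continuous_const.mul ((hw.mul (hF n)).mul (hF m)))
  simp_rw [h1]
  rw [integral_finsetSum _ fun n _ => integrable_finsetSum _ fun m _ => hi n m]
  refine Finset.sum_congr rfl fun n hn => ?_
  rw [integral_finsetSum _ fun m _ => hi n m, Finset.sum_eq_single n]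
  · rw [integral_const_mul, hd]; ring
  · intro m _ hm
    rw [integral_const_mul, h0 n m hm.symm, mul_zero]
  · exact fun h => absurd hn h

theorem integral_legSum_sq (c : ℕ → ℝ) (M : ℕ) (η : S2) :
    ∫ σ : S2, (legSum c M).eval (dot σ η) ^ 2 ∂sphereMeasure =
      ∑ n ∈ Finset.range M, c n ^ 2 * (4 * Real.pi / (2 * n + 1)) := by
  rw [← integral_sum_mul_sum (F := fun n σ => (leg n).eval (dot σ η)) (w := fun _ => 1)
    (fun n => continuous_eval_dot _ _) continuous_const
    (fun n => by simpa only [one_mul] using integral_leg_sq n η)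
    (fun n m h => by simpa only [one_mul] using integral_leg_mul_leg_of_ne h η η)]
  simp only [legSum, eval_finsetSum, eval_mul, eval_C, one_mul]

/-- The Dirichlet integral of a zonal function. -/
theorem integral_derivative_legSum_sq (c : ℕ → ℝ) (M : ℕ) (η : S2) :
    ∫ σ : S2, (1 - dot σ η ^ 2) * (derivative (legSum c M)).eval (dot σ η) ^ 2 ∂sphereMeasure =
      ∑ n ∈ Finset.range M, c n ^ 2 * ((n : ℝ) * (n + 1) * (4 * Real.pi / (2 * n + 1))) := by
  have hg : ∀ n m, ∫ σ : S2, (1 - dot σ η ^ 2) * (derivative (leg n)).eval (dot σ η) *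
      (derivative (leg m)).eval (dot σ η) ∂sphereMeasure = (m : ℝ) * (m + 1) *
      ∫ σ : S2, (leg n).eval (dot σ η) * (leg m).eval (dot σ η) ∂sphereMeasure := fun n m => by
    rw [← green_leg]
    congr 1
    funext σ
    rw [dot_self, dot_comm η σ]
    ring
  rw [← integral_sum_mul_sum (F := fun n σ => (derivative (leg n)).eval (dot σ η))
    (w := fun σ => 1 - dot σ η ^ 2)
    (fun n => continuous_eval_dot _ _) (by fun_prop)
    (fun n => by rw [hg, integral_leg_sq])
    (fun n m h => by rw [hg, integral_leg_mul_leg_of_ne h, mul_zero])]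
  simp only [legSum, derivative_sum, derivative_C_mul, eval_finsetSum, eval_mul, eval_C]

/-- Green's identity with `g = 1` and `h(t) = (1 + d - t)⁻¹`, whose divergence is
`1 - d (2 + d) h²`. -/
theorem integral_inv_sq {d : ℝ} (hd : 0 < d) (η : S2) :
    ∫ σ : S2, ((1 + d - dot σ η) ^ 2)⁻¹ ∂sphereMeasure = 4 * Real.pi / (d * (2 + d)) := by
  have hpos : ∀ σ : S2, 0 < 1 + d - dot σ η := fun σ => by linarith [dot_le_one σ η]
  have hh : ContDiffOn ℝ 1 (fun t : ℝ => (1 + d - t)⁻¹) (Set.Iio (1 + d)) := by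
    refine ContDiffOn.inv (by fun_prop) fun t ht => ?_
    exact (sub_pos.2 ht).ne'
  have h := integral_zonal (g := fun _ => 1) (by linarith : 1 < 1 + d) contDiff_const hh η η
  have hder : ∀ σ : S2, deriv (fun t : ℝ => (1 + d - t)⁻¹) (dot σ η) =
      ((1 + d - dot σ η) ^ 2)⁻¹ := fun σ => by
    have h1 : HasDerivAt (fun t : ℝ => 1 + d - t) (-1) (dot σ η) := by
      simpa using (hasDerivAt_id (dot σ η)).const_sub (1 + d)
    rw [(h1.fun_inv (hpos σ).ne').deriv, neg_neg, one_div]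
  have hc : Continuous fun σ : S2 => ((1 + d - dot σ η) ^ 2)⁻¹ :=
    Continuous.inv₀ (by fun_prop) fun σ => (pow_pos (hpos σ) 2).ne'
  have h2 : ∀ σ : S2, (deriv (fun _ : ℝ => (1 : ℝ)) (dot σ η) * (1 + d - dot σ η)⁻¹ *
      (dot η η - dot η σ * dot σ η) + 1 * ((1 - dot σ η ^ 2) *
      deriv (fun t : ℝ => (1 + d - t)⁻¹) (dot σ η) - 2 * dot σ η * (1 + d - dot σ η)⁻¹)) =
      1 - d * (2 + d) * ((1 + d - dot σ η) ^ 2)⁻¹ := fun σ => by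
    rw [hder, deriv_const]
    have := (hpos σ).ne'
    field_simp
    ring
  simp_rw [h2] at h
  rw [integral_sub (integrable_const _) (integrable_sphere (by fun_prop)),
    integral_const_mul, integral_const, sphereMeasure_univ, smul_eq_mul, mul_one] at h
  have : d * (2 + d) ≠ 0 := by positivity
  rw [eq_div_iff this]
  linarith

end Zonal

/-! ### Bounds for kernels of smooth multipliers -/

section Kernel

open Polynomial

/-- The zonal kernel `∑_n a_n 𝔷_n` of the angular multiplier with coefficients `a`. -/
def zon : (ℕ →₀ ℝ) →ₗ[ℝ] ℝ[X] :=
  Finsupp.linearCombination ℝ fun n : ℕ => ((2 * (n : ℝ) + 1) / (4 * Real.pi)) • leg n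

theorem zon_eq_legSum {a : ℕ →₀ ℝ} {M : ℕ} (h : ∀ n, M ≤ n → a n = 0) :
    zon a = legSum (fun n => a n * ((2 * (n : ℝ) + 1) / (4 * Real.pi))) M := by
  rw [zon, Finsupp.linearCombination_apply, Finsupp.sum_of_support_subset (s := Finset.range M)]
  · refine Finset.sum_congr rfl fun n _ => ?_
    rw [smul_smul, smul_eq_C_mul]
  · intro n hn
    rw [Finset.mem_range]
    by_contra hc
    exact (Finsupp.mem_support_iff.1 hn) (h n (not_lt.1 hc))
  · simp

/-- The sequence `a` looks like `n ↦ χ(n / N)` for a function `χ` supported below `B`, with `χ` and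
`χ''` bounded by `A` and `χ'(0) = 0`. -/
structure SymBound (a : ℕ → ℝ) (A : ℝ) (B N : ℕ) : Prop where
  one_le : 1 ≤ N
  vanish : ∀ n, B * N < n → a n = 0
  bound : ∀ n, |a n| ≤ A
  diff : ∀ n, |a (n + 1) - a n| ≤ A * (n + 1) / N ^ 2
  diff2 : ∀ n, |a (n + 2) - 2 * a (n + 1) + a n| ≤ A / N ^ 2

/-- The condition `χ'(0) = 0` is what gains the factor `(n + 1) / N` in the bound of the first
difference. -/
theorem symBound_of_fun {χ : ℝ → ℝ} {A : ℝ} {B N : ℕ} (hN : 1 ≤ N) (hχ : ContDiff ℝ 2 χ)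
    (h0 : ∀ x, |χ x| ≤ A) (h2 : ∀ x, |deriv (deriv χ) x| ≤ A) (h1 : deriv χ 0 = 0)
    (hB : ∀ x, (B : ℝ) < x → χ x = 0) : SymBound (fun n => χ ((n : ℝ) / N)) A B N := by
  have hN0 : (0 : ℝ) < N := by exact_mod_cast hN
  have hd : Differentiable ℝ χ := hχ.differentiable two_ne_zero
  have hdd : Differentiable ℝ (deriv χ) := by
    have : ContDiff ℝ 1 (deriv χ) := by
      have h : ContDiff ℝ (1 + 1) χ := by rw [one_add_one_eq_two]; exact hχ
      exact (contDiff_succ_iff_deriv.1 h).2.2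
    exact this.differentiable one_ne_zero
  have hlip : ∀ x y, |deriv χ y - deriv χ x| ≤ A * |y - x| := fun x y => by
    have := Convex.norm_image_sub_le_of_norm_deriv_le (f := deriv χ) (s := Set.univ) (C := A)
      (fun x _ => hdd x) (fun x _ => h2 x) convex_univ (Set.mem_univ x) (Set.mem_univ y)
    simpa [Real.norm_eq_abs] using this
  have hA : 0 ≤ A := (abs_nonneg _).trans (h0 0)
  refine ⟨hN, fun n hn => hB _ ?_, fun n => h0 _, fun n => ?_, fun n => ?_⟩
  · rw [lt_div_iff₀ hN0]; exact_mod_cast hn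
  · have hx : (n : ℝ) / N ≤ ((n + 1 : ℕ) : ℝ) / N := by gcongr; simp
    have := Convex.norm_image_sub_le_of_norm_deriv_le (f := χ)
      (s := Set.Icc (0 : ℝ) (((n + 1 : ℕ) : ℝ) / N)) (C := A * (((n + 1 : ℕ) : ℝ) / N))
      (fun x _ => hd x) (fun x hx => by
        have h := hlip 0 x
        rw [h1, sub_zero, sub_zero, abs_of_nonneg hx.1] at h
        exact h.trans (by gcongr; exact hx.2))
      (convex_Icc _ _) ⟨by positivity, hx⟩ ⟨by positivity, le_rfl⟩
    rw [Real.norm_eq_abs, Real.norm_eq_abs] at this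
    refine this.trans (le_of_eq ?_)
    rw [← sub_div, abs_of_nonneg (by push_cast; rw [add_sub_cancel_left]; positivity)]
    push_cast
    field_simp
    ring
  · have := Convex.norm_image_sub_le_of_norm_deriv_le
      (f := fun x => χ (x + 1 / N) - χ x) (s := Set.univ) (C := A * (1 / N))
      (x := (n : ℝ) / N) (y := (n : ℝ) / N + 1 / N)
      (fun x _ => ((hd _).comp x (by fun_prop)).sub (hd x)) (fun x _ => by
        have hh : HasDerivAt (fun x => χ (x + 1 / N) - χ x)
            (deriv χ (x + 1 / N) - deriv χ x) x :=
          ((hd (x + 1 / N)).hasDerivAt.comp_add_const x (1 / N)).sub (hd x).hasDerivAt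
        rw [hh.deriv, Real.norm_eq_abs]
        refine (hlip _ _).trans (le_of_eq ?_)
        rw [add_sub_cancel_left, abs_of_nonneg (by positivity)])
      convex_univ (Set.mem_univ _) (Set.mem_univ _)
    rw [Real.norm_eq_abs, Real.norm_eq_abs, add_sub_cancel_left,
      abs_of_nonneg (by positivity : (0 : ℝ) ≤ 1 / N)] at this
    have e1 : ((n + 1 : ℕ) : ℝ) / N = (n : ℝ) / N + 1 / N := by push_cast; ring
    have e2 : ((n + 2 : ℕ) : ℝ) / N = (n : ℝ) / N + 1 / N + 1 / N := by push_cast; ring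
    rw [e1, e2]
    calc _ = |χ ((n : ℝ) / N + 1 / N + 1 / N) - χ ((n : ℝ) / N + 1 / N) -
          (χ ((n : ℝ) / N + 1 / N) - χ ((n : ℝ) / N))| := by congr 1; ring
      _ ≤ _ := this
      _ = _ := by field_simp

/-- The coefficients of `(1 - X) ∑ (2 n + 1) a_n P_n` in the Legendre polynomials. -/
def tentCoeff (a : ℕ → ℝ) (m : ℕ) : ℝ :=
  (2 * (m : ℝ) + 1) * a m - m * a (m - 1) - ((m : ℝ) + 1) * a (m + 1)

/-- By the three-term recurrence, multiplication by `1 - X` acts on Legendre coefficients as a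
second difference. -/
theorem one_sub_X_mul_legSum (a : ℕ → ℝ) (M : ℕ) :
    (1 - X) * legSum (fun n => (2 * (n : ℝ) + 1) * a n) (M + 1) =
      legSum (tentCoeff a) (M + 1) - C (((M : ℝ) + 1) * a M) * leg (M + 1) +
        C (((M : ℝ) + 1) * a (M + 1)) * leg M := by
  induction M with
  | zero =>
    simp [legSum, tentCoeff, leg_zero, leg_one]
    ring
  | succ M ih =>
    have h1 : ∀ c : ℕ → ℝ, legSum c (M + 1 + 1) = legSum c (M + 1) + C (c (M + 1)) * leg (M + 1) :=
      fun c => Finset.sum_range_succ _ _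
    rw [h1, h1, mul_add, ih, tentCoeff]
    have h2 := leg_recurrence M
    push_cast
    simp only [map_add, map_sub, map_mul, map_natCast, map_one, map_ofNat] at h2 ⊢
    linear_combination (-C (a (M + 1))) * h2

/-- The weighted second difference `tentCoeff a m` is `-m` times a plain second difference minus one
first difference, and both are of size `m / N²`. -/
theorem SymBound.abs_tentCoeff_le {a : ℕ → ℝ} {A : ℝ} {B N : ℕ} (h : SymBound a A B N) (m : ℕ) :
    |tentCoeff a m| ≤ 2 * A * (m + 1) / N ^ 2 := by
  have hA : 0 ≤ A := (abs_nonneg _).trans (h.bound 0)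
  have hN : (0 : ℝ) < N := by exact_mod_cast h.one_le
  rcases m with _ | m
  · have h1 := h.diff 0
    have h2 : tentCoeff a 0 = -(a 1 - a 0) := by simp [tentCoeff]
    rw [h2, abs_neg]
    refine h1.trans ?_
    gcongr
    linarith
  · have h1 := h.diff (m + 1)
    have h2 := h.diff2 m
    have h3 : tentCoeff a (m + 1) = -(((m : ℝ) + 1) * (a (m + 2) - 2 * a (m + 1) + a m) +
        (a (m + 1 + 1) - a (m + 1))) := by
      simp only [tentCoeff, Nat.add_sub_cancel]
      push_cast
      ring
    rw [h3, abs_neg]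
    refine (abs_add_le _ _).trans ?_
    rw [abs_mul, abs_of_nonneg (by positivity : (0 : ℝ) ≤ (m : ℝ) + 1)]
    calc _ ≤ ((m : ℝ) + 1) * (A / N ^ 2) + A * (((m + 1 : ℕ) : ℝ) + 1) / N ^ 2 := by gcongr
      _ ≤ _ := by
        push_cast
        rw [← mul_div_assoc, ← add_div]
        gcongr
        nlinarith

theorem sum_range_le_of_le {M D : ℕ} (hM : M ≤ D) {f : ℕ → ℝ} {b : ℝ} (hb : 0 ≤ b)
    (h : ∀ n < M, f n ≤ b) : ∑ n ∈ Finset.range M, f n ≤ D * b := by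
  calc ∑ n ∈ Finset.range M, f n ≤ ∑ n ∈ Finset.range M, b :=
        Finset.sum_le_sum fun n hn => h n (Finset.mem_range.1 hn)
    _ = M * b := by simp
    _ ≤ D * b := by gcongr

variable {a : ℕ →₀ ℝ} {A : ℝ} {B N : ℕ}

theorem SymBound.pos (h : SymBound a A B N) : (0 : ℝ) < N := by exact_mod_cast h.one_le

theorem SymBound.le_mul (h : SymBound a A B N) : B * N + 2 ≤ (B + 2) * N := by
  have := h.one_le
  nlinarith

theorem SymBound.zon_eq (h : SymBound a A B N) :
    zon a = legSum (fun n => (2 * (n : ℝ) + 1) * a n / (4 * Real.pi)) (B * N + 2) := by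
  rw [zon_eq_legSum (M := B * N + 2) fun n hn => h.vanish n (by omega)]
  congr 1
  funext n
  ring

theorem SymBound.one_sub_X_mul_zon (h : SymBound a A B N) :
    (1 - X) * zon a = legSum (fun n => tentCoeff a n / (4 * Real.pi)) (B * N + 2) := by
  have hdiv : ∀ c : ℕ → ℝ, legSum (fun n => c n / (4 * Real.pi)) (B * N + 2) =
      C (4 * Real.pi)⁻¹ * legSum c (B * N + 2) := fun c => by
    rw [legSum, legSum, Finset.mul_sum]
    refine Finset.sum_congr rfl fun n _ => ?_
    rw [div_eq_inv_mul, C_mul, mul_assoc]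
  have h1 := one_sub_X_mul_legSum a (B * N + 1)
  rw [h.vanish (B * N + 1) (by omega), h.vanish (B * N + 1 + 1) (by omega), mul_zero, C_0,
    zero_mul, zero_mul, sub_zero, add_zero] at h1
  rw [h.zon_eq, hdiv, hdiv, mul_left_comm, ← h1]

theorem SymBound.index_le (h : SymBound a A B N) {n : ℕ} (hn : n < B * N + 2) :
    (n : ℝ) + 1 ≤ (B + 2) * N := by
  have := h.le_mul
  have h2 : n + 1 ≤ (B + 2) * N := by omega
  exact_mod_cast h2

theorem SymBound.sq_le (h : SymBound a A B N) (n : ℕ) : a n ^ 2 ≤ A ^ 2 :=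
  sq_le_sq' (abs_le.1 (h.bound n)).1 (abs_le.1 (h.bound n)).2

theorem SymBound.tent_sq_le (h : SymBound a A B N) (n : ℕ) :
    tentCoeff a n ^ 2 ≤ 4 * A ^ 2 * (n + 1) ^ 2 / N ^ 4 := by
  have h1 := abs_le.1 (h.abs_tentCoeff_le n)
  refine (sq_le_sq' h1.1 h1.2).trans (le_of_eq ?_)
  have := h.pos.ne'
  field_simp
  ring

/-- By Parseval, as `∑_{n ≲ N} (2 n + 1) ≲ N²`. -/
theorem SymBound.integral_sq_le (h : SymBound a A B N) (η : S2) :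
    ∫ σ : S2, (zon a).eval (dot σ η) ^ 2 ∂sphereMeasure ≤ A ^ 2 * (B + 2) ^ 2 * N ^ 2 := by
  rw [h.zon_eq, integral_legSum_sq]
  have hN := h.pos
  refine (sum_range_le_of_le h.le_mul (b := A ^ 2 * ((B + 2) * N)) (by positivity)
    fun n hn => ?_).trans (le_of_eq (by push_cast; ring))
  have e : ((2 * (n : ℝ) + 1) * a n / (4 * Real.pi)) ^ 2 * (4 * Real.pi / (2 * n + 1)) =
      a n ^ 2 * ((2 * n + 1) / (4 * Real.pi)) := by
    have : 2 * (n : ℝ) + 1 ≠ 0 := by positivity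
    field_simp
  rw [e]
  refine mul_le_mul (h.sq_le n) ?_ (by positivity) (sq_nonneg A)
  · refine le_trans ?_ (h.index_le hn)
    rw [div_le_iff₀ (by positivity)]
    have := Real.pi_gt_three
    nlinarith

theorem SymBound.integral_tent_sq_le (h : SymBound a A B N) (η : S2) :
    ∫ σ : S2, ((1 - dot σ η) * (zon a).eval (dot σ η)) ^ 2 ∂sphereMeasure ≤
      A ^ 2 * (B + 2) ^ 2 / N ^ 2 := by
  have hN := h.pos
  have e0 : ∀ σ : S2, (1 - dot σ η) * (zon a).eval (dot σ η) =
      (legSum (fun n => tentCoeff a n / (4 * Real.pi)) (B * N + 2)).eval (dot σ η) := fun σ => by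
    rw [← h.one_sub_X_mul_zon]; simp
  simp_rw [e0]
  rw [integral_legSum_sq]
  refine (sum_range_le_of_le h.le_mul (b := A ^ 2 * ((B + 2) * N) / N ^ 4) (by positivity)
    fun n hn => ?_).trans (le_of_eq (by push_cast; field_simp))
  have e : (tentCoeff a n / (4 * Real.pi)) ^ 2 * (4 * Real.pi / (2 * n + 1)) =
      tentCoeff a n ^ 2 * (1 / ((4 * Real.pi) * (2 * n + 1))) := by
    field_simp
  rw [e]
  calc _ ≤ (4 * A ^ 2 * (n + 1) ^ 2 / N ^ 4) * (1 / ((4 * Real.pi) * (2 * n + 1))) := by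
        gcongr
        exact h.tent_sq_le n
    _ ≤ (4 * A ^ 2 * (n + 1) ^ 2 / N ^ 4) * (1 / (4 * (n + 1))) := by
        have h1 : 4 * ((n : ℝ) + 1) ≤ 4 * Real.pi * (2 * n + 1) := by
          have := Real.pi_gt_three
          nlinarith [Nat.cast_nonneg (α := ℝ) n]
        exact mul_le_mul_of_nonneg_left (one_div_le_one_div_of_le (by positivity) h1)
          (by positivity)
    _ = A ^ 2 * (n + 1) / N ^ 4 := by
        have : (n : ℝ) + 1 ≠ 0 := by positivity
        field_simp
    _ ≤ _ := by
        gcongr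
        exact h.index_le hn

theorem SymBound.integral_deriv_sq_le (h : SymBound a A B N) (η : S2) :
    ∫ σ : S2, (1 - dot σ η ^ 2) * (derivative (zon a)).eval (dot σ η) ^ 2 ∂sphereMeasure ≤
      A ^ 2 * (B + 2) ^ 4 * N ^ 4 := by
  rw [h.zon_eq, integral_derivative_legSum_sq]
  have hN := h.pos
  refine (sum_range_le_of_le h.le_mul (b := A ^ 2 * ((B + 2) * N) ^ 3) (by positivity)
    fun n hn => ?_).trans (le_of_eq (by push_cast; ring))
  have e : ((2 * (n : ℝ) + 1) * a n / (4 * Real.pi)) ^ 2 *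
      ((n : ℝ) * (n + 1) * (4 * Real.pi / (2 * n + 1))) =
      a n ^ 2 * (((2 * n + 1) / (4 * Real.pi)) * (n * (n + 1))) := by
    have : 2 * (n : ℝ) + 1 ≠ 0 := by positivity
    field_simp
  have hi := h.index_le hn
  have h1 : (2 * (n : ℝ) + 1) / (4 * Real.pi) ≤ n + 1 := by
    rw [div_le_iff₀ (by positivity)]
    have := Real.pi_gt_three
    nlinarith [Nat.cast_nonneg (α := ℝ) n]
  rw [e]
  calc _ ≤ A ^ 2 * (((n : ℝ) + 1) * (((n : ℝ) + 1) * ((n : ℝ) + 1))) := by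
        refine mul_le_mul (h.sq_le n) ?_ (by positivity) (sq_nonneg A)
        gcongr
        linarith
    _ = A ^ 2 * ((n : ℝ) + 1) ^ 3 := by ring
    _ ≤ _ := by gcongr

/-- Multiplication by `1 - X` gains `N⁻²`, as in `integral_tent_sq_le`, and the derivative loses
`N`. -/
theorem SymBound.integral_deriv_tent_sq_le (h : SymBound a A B N) (η : S2) :
    ∫ σ : S2, (1 - dot σ η ^ 2) * ((derivative ((1 - X) * zon a)).eval (dot σ η)) ^ 2
      ∂sphereMeasure ≤ A ^ 2 * (B + 2) ^ 4 := by
  have hN := h.pos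
  rw [h.one_sub_X_mul_zon, integral_derivative_legSum_sq]
  refine (sum_range_le_of_le h.le_mul (b := A ^ 2 * ((B + 2) * N) ^ 3 / N ^ 4) (by positivity)
    fun n hn => ?_).trans (le_of_eq (by push_cast; field_simp))
  have e : (tentCoeff a n / (4 * Real.pi)) ^ 2 *
      ((n : ℝ) * (n + 1) * (4 * Real.pi / (2 * n + 1))) =
      tentCoeff a n ^ 2 * (n * (n + 1) / ((4 * Real.pi) * (2 * n + 1))) := by
    field_simp
  rw [e]
  have h1 : (n : ℝ) * (n + 1) / ((4 * Real.pi) * (2 * n + 1)) ≤ (n + 1) / 4 := by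
    rw [div_le_div_iff₀ (by positivity) (by norm_num)]
    have := Real.pi_gt_three
    have hn0 := Nat.cast_nonneg (α := ℝ) n
    have h4 : (n : ℝ) * 4 ≤ 4 * Real.pi * (2 * n + 1) := by nlinarith
    calc (n : ℝ) * (n + 1) * 4 = (n + 1) * (n * 4) := by ring
      _ ≤ (n + 1) * (4 * Real.pi * (2 * n + 1)) := by gcongr
  calc _ ≤ (4 * A ^ 2 * (n + 1) ^ 2 / N ^ 4) * ((n + 1) / 4) := by
        gcongr
        exact h.tent_sq_le n
    _ = A ^ 2 * ((n : ℝ) + 1) ^ 3 / N ^ 4 := by ring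
    _ ≤ _ := by
        gcongr
        exact h.index_le hn

theorem integral_inv_sq_le (hN : 1 ≤ N) (η : S2) :
    ∫ σ : S2, ((1 + ((N : ℝ) ^ 2)⁻¹ - dot σ η) ^ 2)⁻¹ ∂sphereMeasure ≤ 7 * (N : ℝ) ^ 2 := by
  have hN0 : (0 : ℝ) < N := by exact_mod_cast hN
  rw [integral_inv_sq (by positivity), div_le_iff₀ (by positivity)]
  have h1 : 7 * (N : ℝ) ^ 2 * (((N : ℝ) ^ 2)⁻¹ * (2 + ((N : ℝ) ^ 2)⁻¹)) =
      14 + 7 * ((N : ℝ) ^ 2)⁻¹ := by field_simp; ring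
  rw [h1]
  have h2 : (0 : ℝ) < ((N : ℝ) ^ 2)⁻¹ := by positivity
  have := Real.pi_lt_d2
  linarith

theorem SymBound.weight_pos (h : SymBound a A B N) (σ η : S2) :
    0 < 1 + ((N : ℝ) ^ 2)⁻¹ - dot σ η := by
  have : (0 : ℝ) < ((N : ℝ) ^ 2)⁻¹ := by have := h.pos; positivity
  linarith [dot_le_one σ η]

theorem SymBound.continuous_inv_weight (h : SymBound a A B N) (η : S2) :
    Continuous fun σ : S2 => ((1 + ((N : ℝ) ^ 2)⁻¹ - dot σ η) ^ 2)⁻¹ :=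
  Continuous.inv₀ (by fun_prop) fun σ => (pow_pos (h.weight_pos σ η) 2).ne'

/-- The kernel of a smooth multiplier at scale `N` is bounded in `L¹`: Cauchy-Schwarz with the
weight `s = 1 + N⁻² - ⟨σ, η⟩`, in the form `2 |K| ≤ N² K² s² + N⁻² s⁻²`. -/
theorem SymBound.integral_abs_le (h : SymBound a A B N) (η : S2) :
    ∫ σ : S2, |(zon a).eval (dot σ η)| ∂sphereMeasure ≤ 2 * A ^ 2 * (B + 2) ^ 2 + 4 := by
  have hN := h.pos
  have hK := continuous_eval_dot (zon a) η
  have hw := h.continuous_inv_weight η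
  have i1 := h.integral_sq_le η
  have i2 := h.integral_tent_sq_le η
  have i3 := integral_inv_sq_le h.one_le η
  have hpt : ∀ σ : S2, |(zon a).eval (dot σ η)| ≤
      N ^ 2 * ((1 - dot σ η) * (zon a).eval (dot σ η)) ^ 2 +
      ((N : ℝ) ^ 2)⁻¹ * (zon a).eval (dot σ η) ^ 2 +
      (1 / 2) * (((N : ℝ) ^ 2)⁻¹ * ((1 + ((N : ℝ) ^ 2)⁻¹ - dot σ η) ^ 2)⁻¹) := fun σ => by
    set K := (zon a).eval (dot σ η)
    set t := dot σ η
    set s := 1 + ((N : ℝ) ^ 2)⁻¹ - t with hs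
    have hs0 : 0 < s := h.weight_pos σ η
    have h1 : |K| = (N * |K| * s) * ((N : ℝ)⁻¹ * s⁻¹) := by field_simp
    have h2 := two_mul_le_add_sq (N * |K| * s) ((N : ℝ)⁻¹ * s⁻¹)
    have h3 : s ^ 2 ≤ 2 * (1 - t) ^ 2 + 2 * (((N : ℝ) ^ 2)⁻¹) ^ 2 := by
      have : s = (1 - t) + ((N : ℝ) ^ 2)⁻¹ := by rw [hs]; ring
      rw [this]
      nlinarith [sq_nonneg ((1 - t) - ((N : ℝ) ^ 2)⁻¹)]
    have h4 : (N * |K| * s) ^ 2 ≤ 2 * (N ^ 2 * ((1 - t) * K) ^ 2 + ((N : ℝ) ^ 2)⁻¹ * K ^ 2) := by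
      calc (N * |K| * s) ^ 2 = N ^ 2 * K ^ 2 * s ^ 2 := by rw [mul_pow, mul_pow, sq_abs]
        _ ≤ N ^ 2 * K ^ 2 * (2 * (1 - t) ^ 2 + 2 * (((N : ℝ) ^ 2)⁻¹) ^ 2) := by gcongr
        _ = _ := by field_simp
    have h5 : ((N : ℝ)⁻¹ * s⁻¹) ^ 2 = ((N : ℝ) ^ 2)⁻¹ * (s ^ 2)⁻¹ := by
      rw [mul_pow, inv_pow, inv_pow]
    rw [h1]
    rw [h5] at h2
    linarith
  have hmono := integral_mono (μ := sphereMeasure) (integrable_sphere hK.abs)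
    (integrable_sphere (by fun_prop)) hpt
  refine hmono.trans ?_
  rw [integral_add (integrable_sphere (by fun_prop)) (integrable_sphere (by fun_prop)),
    integral_add (integrable_sphere (by fun_prop)) (integrable_sphere (by fun_prop)),
    integral_const_mul, integral_const_mul, integral_const_mul, integral_const_mul]
  have j1 : ((N : ℝ) ^ 2)⁻¹ * ∫ σ : S2, (zon a).eval (dot σ η) ^ 2 ∂sphereMeasure ≤
      A ^ 2 * (B + 2) ^ 2 := by
    rw [inv_mul_le_iff₀ (by positivity)]
    linarith
  have j2 : (N : ℝ) ^ 2 * ∫ σ : S2, ((1 - dot σ η) * (zon a).eval (dot σ η)) ^ 2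
      ∂sphereMeasure ≤ A ^ 2 * (B + 2) ^ 2 := by
    rw [le_div_iff₀ (by positivity)] at i2
    linarith
  have j3 : ((N : ℝ) ^ 2)⁻¹ * ∫ σ : S2, ((1 + ((N : ℝ) ^ 2)⁻¹ - dot σ η) ^ 2)⁻¹
      ∂sphereMeasure ≤ 7 := by
    rw [inv_mul_le_iff₀ (by positivity)]
    linarith
  linarith

/-- The first moment of the kernel gains a factor `N⁻¹`, so that the kernels concentrate at the
diagonal as `N → ∞`. -/
theorem SymBound.integral_tent_abs_le (h : SymBound a A B N) (η : S2) :
    ∫ σ : S2, (1 - dot σ η) * |(zon a).eval (dot σ η)| ∂sphereMeasure ≤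
      (A ^ 2 * (B + 2) ^ 2 + 7) / N := by
  have hN := h.pos
  have hK := continuous_eval_dot (zon a) η
  have i2 := h.integral_tent_sq_le η
  have hpt : ∀ σ : S2, (1 - dot σ η) * |(zon a).eval (dot σ η)| ≤
      N / 2 * ((1 - dot σ η) * (zon a).eval (dot σ η)) ^ 2 + (N : ℝ)⁻¹ / 2 := fun σ => by
    set K := (zon a).eval (dot σ η)
    set t := dot σ η
    have h2 := sq_nonneg (N * ((1 - t) * |K|) - 1)
    have h3 : ((1 - t) * K) ^ 2 = ((1 - t) * |K|) ^ 2 := by rw [mul_pow, mul_pow, sq_abs]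
    rw [h3]
    have h4 : 0 ≤ (N : ℝ)⁻¹ * (N * ((1 - t) * |K|) - 1) ^ 2 := by positivity
    have h5 : (N : ℝ)⁻¹ * (N * ((1 - t) * |K|) - 1) ^ 2 =
      N * ((1 - t) * |K|) ^ 2 - 2 * ((1 - t) * |K|) + (N : ℝ)⁻¹ := by field_simp; ring
    linarith
  have hmono := integral_mono (μ := sphereMeasure) (integrable_sphere (by fun_prop))
    (integrable_sphere (by fun_prop)) hpt
  refine hmono.trans ?_
  rw [integral_add (integrable_sphere (by fun_prop)) (integrable_const _),
    integral_const_mul, integral_const, sphereMeasure_univ, smul_eq_mul]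
  have j2 : (N : ℝ) / 2 * ∫ σ : S2, ((1 - dot σ η) * (zon a).eval (dot σ η)) ^ 2
      ∂sphereMeasure ≤ N / 2 * (A ^ 2 * (B + 2) ^ 2 / N ^ 2) := by gcongr
  have j3 : (N : ℝ) / 2 * (A ^ 2 * (B + 2) ^ 2 / N ^ 2) + 4 * Real.pi * ((N : ℝ)⁻¹ / 2) =
      (A ^ 2 * (B + 2) ^ 2 / 2 + 2 * Real.pi) / N := by field_simp; ring
  refine (add_le_add_left j2 _).trans ?_
  rw [j3]
  gcongr
  · have : 0 ≤ A ^ 2 * ((B : ℝ) + 2) ^ 2 := by positivity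
    linarith
  · have := Real.pi_lt_d2
    linarith

/-- The tangential gradient of the kernel of a smooth multiplier at scale `N` has `L¹` norm
`O(N)`. -/
theorem SymBound.integral_abs_deriv_le (h : SymBound a A B N) (η : S2) :
    ∫ σ : S2, |(derivative (zon a)).eval (dot σ η)| * √(1 - dot σ η ^ 2) ∂sphereMeasure ≤
      (7 * A ^ 2 * (B + 2) ^ 4 + 4) * N := by
  have hN := h.pos
  have hK := continuous_eval_dot (zon a) η
  have hK' := continuous_eval_dot (derivative (zon a)) η
  have hT' := continuous_eval_dot (derivative ((1 - X) * zon a)) η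
  have hw := h.continuous_inv_weight η
  have i1 := h.integral_sq_le η
  have i2 := h.integral_tent_sq_le η
  have i3 := integral_inv_sq_le h.one_le η
  have i4 := h.integral_deriv_sq_le η
  have i5 := h.integral_deriv_tent_sq_le η
  have hpt : ∀ σ : S2, |(derivative (zon a)).eval (dot σ η)| * √(1 - dot σ η ^ 2) ≤
      ((N : ℝ) ^ 3)⁻¹ * ((1 - dot σ η ^ 2) * (derivative (zon a)).eval (dot σ η) ^ 2) +
      2 * N * ((1 - dot σ η ^ 2) * ((derivative ((1 - X) * zon a)).eval (dot σ η)) ^ 2) +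
      2 * N ^ 3 * ((1 - dot σ η) * (zon a).eval (dot σ η)) ^ 2 +
      2 * (N : ℝ)⁻¹ * (zon a).eval (dot σ η) ^ 2 +
      (1 / 2) * ((N : ℝ)⁻¹ * ((1 + ((N : ℝ) ^ 2)⁻¹ - dot σ η) ^ 2)⁻¹) := fun σ => by
    have e : (derivative ((1 - X) * zon a)).eval (dot σ η) =
        (1 - dot σ η) * (derivative (zon a)).eval (dot σ η) - (zon a).eval (dot σ η) := by
      simp [derivative_mul]; ring
    rw [e]
    have ht1 : 0 ≤ 1 - dot σ η ^ 2 := sub_nonneg.2 (dot_sq_le_one σ η)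
    have ht2 : 0 ≤ 1 - dot σ η := sub_nonneg.2 (dot_le_one σ η)
    have ht3 : 1 - dot σ η ^ 2 ≤ 2 * (1 - dot σ η) := by nlinarith [sq_nonneg (1 - dot σ η)]
    set K := (zon a).eval (dot σ η)
    set G := (derivative (zon a)).eval (dot σ η)
    set t := dot σ η
    set s := 1 + ((N : ℝ) ^ 2)⁻¹ - t with hs
    have hs0 : 0 < s := h.weight_pos σ η
    set w := 1 - t ^ 2
    set n : ℝ := (N : ℝ)
    -- The same weight as in `integral_abs_le`, with the factor `N` that the derivative costs.
    have h1 : 2 * (|G| * √w) ≤ n * (w * G ^ 2 * s ^ 2) + n⁻¹ * (s ^ 2)⁻¹ := by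
      have h2 := sq_nonneg (n * (|G| * √w * s) - s⁻¹)
      have h3 : 0 ≤ n⁻¹ * (n * (|G| * √w * s) - s⁻¹) ^ 2 := by positivity
      have h4 : n⁻¹ * (n * (|G| * √w * s) - s⁻¹) ^ 2 =
          n * (√w ^ 2 * |G| ^ 2 * s ^ 2) - 2 * (|G| * √w) + n⁻¹ * (s ^ 2)⁻¹ := by
        field_simp
        ring
      rw [Real.sq_sqrt ht1, sq_abs] at h4
      linarith
    have h3 : s ^ 2 ≤ 2 * (1 - t) ^ 2 + 2 * ((n ^ 2)⁻¹) ^ 2 := by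
      have : s = (1 - t) + (n ^ 2)⁻¹ := by rw [hs]; ring
      rw [this]
      nlinarith [sq_nonneg ((1 - t) - (n ^ 2)⁻¹)]
    have h4 : n * (w * G ^ 2 * s ^ 2) ≤
        2 * ((n ^ 3)⁻¹ * (w * G ^ 2)) + 2 * n * (w * ((1 - t) * G) ^ 2) := by
      calc n * (w * G ^ 2 * s ^ 2) ≤
          n * (w * G ^ 2 * (2 * (1 - t) ^ 2 + 2 * ((n ^ 2)⁻¹) ^ 2)) := by gcongr
        _ = _ := by field_simp; ring
    -- `(1 - t) G - K` is the derivative of `(1 - X) * zon a`, for which `i5` is available.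
    have h5 : w * ((1 - t) * G) ^ 2 ≤ 2 * (w * ((1 - t) * G - K) ^ 2) + 2 * (w * K ^ 2) := by
      have h51 : ((1 - t) * G) ^ 2 ≤ 2 * ((1 - t) * G - K) ^ 2 + 2 * K ^ 2 := by
        nlinarith [sq_nonneg ((1 - t) * G - K - K)]
      calc w * ((1 - t) * G) ^ 2 ≤ w * (2 * ((1 - t) * G - K) ^ 2 + 2 * K ^ 2) := by gcongr
        _ = _ := by ring
    have h6 : w * K ^ 2 ≤ n ^ 2 * ((1 - t) * K) ^ 2 + (n ^ 2)⁻¹ * K ^ 2 := by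
      have h7 : w ≤ n ^ 2 * (1 - t) ^ 2 + (n ^ 2)⁻¹ := by
        have h8 : 0 ≤ (n * (1 - t) - n⁻¹) ^ 2 := sq_nonneg _
        have h9 : (n * (1 - t) - n⁻¹) ^ 2 = n ^ 2 * (1 - t) ^ 2 - 2 * (1 - t) + (n ^ 2)⁻¹ := by
          field_simp
          ring
        linarith
      calc w * K ^ 2 ≤ (n ^ 2 * (1 - t) ^ 2 + (n ^ 2)⁻¹) * K ^ 2 := by gcongr
        _ = _ := by ring
    have h10 : 2 * n * (w * ((1 - t) * G) ^ 2) ≤ 2 * n * (2 * (w * ((1 - t) * G - K) ^ 2) +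
        2 * (n ^ 2 * ((1 - t) * K) ^ 2 + (n ^ 2)⁻¹ * K ^ 2)) := by
      have : 0 < n := hN
      gcongr
      linarith
    have h11 : 2 * n * (2 * (w * ((1 - t) * G - K) ^ 2) +
        2 * (n ^ 2 * ((1 - t) * K) ^ 2 + (n ^ 2)⁻¹ * K ^ 2)) =
        4 * n * (w * ((1 - t) * G - K) ^ 2) + 4 * n ^ 3 * ((1 - t) * K) ^ 2 +
          4 * n⁻¹ * K ^ 2 := by
      have : n ≠ 0 := hN.ne'
      field_simp
      ring
    linarith
  have hmono := integral_mono (μ := sphereMeasure) (integrable_sphere (by fun_prop))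
    (integrable_sphere (by fun_prop)) hpt
  refine hmono.trans ?_
  rw [integral_add (integrable_sphere (by fun_prop)) (integrable_sphere (by fun_prop)),
    integral_add (integrable_sphere (by fun_prop)) (integrable_sphere (by fun_prop)),
    integral_add (integrable_sphere (by fun_prop)) (integrable_sphere (by fun_prop)),
    integral_add (integrable_sphere (by fun_prop)) (integrable_sphere (by fun_prop)),
    integral_const_mul, integral_const_mul, integral_const_mul, integral_const_mul,
    integral_const_mul, integral_const_mul]
  have j1 : ((N : ℝ) ^ 3)⁻¹ * ∫ σ : S2, (1 - dot σ η ^ 2) *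
      (derivative (zon a)).eval (dot σ η) ^ 2 ∂sphereMeasure ≤ A ^ 2 * (B + 2) ^ 4 * N := by
    rw [inv_mul_le_iff₀ (by positivity)]
    linarith
  have j2 : 2 * (N : ℝ) * ∫ σ : S2, (1 - dot σ η ^ 2) *
      ((derivative ((1 - X) * zon a)).eval (dot σ η)) ^ 2 ∂sphereMeasure ≤
      2 * N * (A ^ 2 * (B + 2) ^ 4) := by gcongr
  have j3 : 2 * (N : ℝ) ^ 3 * ∫ σ : S2, ((1 - dot σ η) * (zon a).eval (dot σ η)) ^ 2
      ∂sphereMeasure ≤ 2 * N * (A ^ 2 * (B + 2) ^ 2) := by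
    rw [le_div_iff₀ (by positivity)] at i2
    have := mul_le_mul_of_nonneg_left i2 (by positivity : 0 ≤ 2 * (N : ℝ))
    linarith
  have j4 : 2 * (N : ℝ)⁻¹ * ∫ σ : S2, (zon a).eval (dot σ η) ^ 2 ∂sphereMeasure ≤
      2 * N * (A ^ 2 * (B + 2) ^ 2) := by
    rw [mul_assoc, mul_assoc]
    refine mul_le_mul_of_nonneg_left ?_ zero_le_two
    rw [inv_mul_le_iff₀ (by positivity)]
    linarith
  have j5 : (N : ℝ)⁻¹ * ∫ σ : S2, ((1 + ((N : ℝ) ^ 2)⁻¹ - dot σ η) ^ 2)⁻¹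
      ∂sphereMeasure ≤ 7 * N := by
    rw [inv_mul_le_iff₀ (by positivity)]
    linarith
  have j6 : 4 * (A ^ 2 * ((B : ℝ) + 2) ^ 2) ≤ 4 * (A ^ 2 * (B + 2) ^ 4) := by
    gcongr
    · linarith [Nat.cast_nonneg (α := ℝ) B]
    · norm_num
  have j7 := mul_le_mul_of_nonneg_left j6 hN.le
  linarith

end Kernel

/-! ### Sampled multipliers and approximate identities -/

section Sampling

open Polynomial

/-- The sequence `n ↦ χ(2^{-l} n)`, for `χ` vanishing near `+∞` (and `0` if it has infinite
support). -/
def mult (χ : ℝ → ℝ) (l : ℤ) : ℕ →₀ ℝ :=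
  open Classical in
  if h : (Function.support fun n : ℕ => χ ((2 : ℝ) ^ (-l) * n)).Finite then
    Finsupp.ofSupportFinite _ h else 0

theorem mult_apply {χ : ℝ → ℝ} {B : ℝ} (hB : ∀ x, B < x → χ x = 0) (l : ℤ) (n : ℕ) :
    mult χ l n = χ ((2 : ℝ) ^ (-l) * n) := by
  have h : (Function.support fun n : ℕ => χ ((2 : ℝ) ^ (-l) * n)).Finite := by
    refine (Set.finite_Iic ⌊B / (2 : ℝ) ^ (-l)⌋₊).subset fun n hn => ?_
    have h1 : (2 : ℝ) ^ (-l) * n ≤ B := not_lt.1 fun hc => hn (hB _ hc)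
    exact Nat.le_floor (by rw [le_div_iff₀ (by positivity)]; linarith)
  rw [mult, dif_pos h]
  rfl

theorem mult_natCast_apply {χ : ℝ → ℝ} {B : ℝ} (hB : ∀ x, B < x → χ x = 0) (l n : ℕ) :
    mult χ l n = χ ((n : ℝ) / ((2 ^ l : ℕ) : ℝ)) := by
  rw [mult_apply hB]
  congr 1
  rw [zpow_neg, zpow_natCast]
  push_cast
  rw [inv_mul_eq_div]

theorem exists_bound_of_compact {χ : ℝ → ℝ} (hχ : ContDiff ℝ 2 χ) {B : ℝ}
    (hB : ∀ x, B < |x| → χ x = 0) :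
    ∃ A, ∀ x, |χ x| ≤ A ∧ |deriv χ x| ≤ A ∧ |deriv (deriv χ) x| ≤ A := by
  have hs : HasCompactSupport χ := HasCompactSupport.of_support_subset_isCompact
    (isCompact_Icc (a := -B) (b := B)) fun x hx => by
      by_contra hc
      refine hx (hB x ?_)
      by_contra h
      exact hc (Set.mem_Icc.2 (abs_le.1 (not_lt.1 h)))
  have h1 : ContDiff ℝ 1 (deriv χ) := by
    have h : ContDiff ℝ (1 + 1) χ := by rw [one_add_one_eq_two]; exact hχ
    exact (contDiff_succ_iff_deriv.1 h).2.2
  obtain ⟨A0, h0⟩ := hs.exists_bound_of_continuous hχ.continuous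
  obtain ⟨A1, h1'⟩ := hs.deriv.exists_bound_of_continuous h1.continuous
  obtain ⟨A2, h2⟩ := hs.deriv.deriv.exists_bound_of_continuous (h1.continuous_deriv le_rfl)
  exact ⟨max A0 (max A1 A2), fun x => ⟨(h0 x).trans (le_max_left _ _),
    (h1' x).trans ((le_max_left _ _).trans (le_max_right _ _)),
    (h2 x).trans ((le_max_right _ _).trans (le_max_right _ _))⟩⟩

/-- The sequences sampled from a smooth function of compact support are smooth multipliers,
uniformly in the scale. -/
theorem exists_symBound_mult {χ : ℝ → ℝ} (hχ : ContDiff ℝ 2 χ) {B : ℕ}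
    (hB : ∀ x, (B : ℝ) < |x| → χ x = 0) (h0 : deriv χ 0 = 0) :
    ∃ A, ∀ l : ℕ, SymBound (mult χ l) A B (2 ^ l) := by
  obtain ⟨A, hA⟩ := exists_bound_of_compact hχ hB
  have hB' : ∀ x, (B : ℝ) < x → χ x = 0 := fun x hx => hB x (hx.trans_le (le_abs_self x))
  refine ⟨A, fun l => ?_⟩
  have h := symBound_of_fun (N := 2 ^ l) Nat.one_le_two_pow hχ (fun x => (hA x).1)
    (fun x => (hA x).2.2) h0 hB'
  convert h using 1
  funext n
  exact mult_natCast_apply hB' l n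

variable (ψ : Bump)

theorem Bump.eq_zero {x : ℝ} (hx : 8 / 5 < |x|) : ψ.toFun x = 0 := by
  by_contra h
  have := ψ.support_subset h
  exact absurd (abs_le.2 this) (not_le.2 hx)

theorem Bump.eq_one' {x : ℝ} (hx : |x| ≤ 4 / 5) : ψ.toFun x = 1 := ψ.eq_one x (abs_le.1 hx)

theorem Bump.eq_zero_of_two_lt {x : ℝ} (hx : (2 : ℝ) < x) : ψ.toFun x = 0 :=
  ψ.eq_zero (by rw [abs_of_pos (by linarith)]; linarith)

theorem Bump.phi_eq_zero {x : ℝ} (hx : 8 / 5 < |x|) : ψ.phi x = 0 := by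
  rw [Bump.phi, ψ.eq_zero hx, ψ.eq_zero, sub_zero]
  rw [abs_mul, abs_two]
  linarith [abs_nonneg x]

theorem Bump.phi_eq_zero_of_le {x : ℝ} (hx : |x| ≤ 2 / 5) : ψ.phi x = 0 := by
  rw [Bump.phi, ψ.eq_one', ψ.eq_one', sub_self]
  · rw [abs_mul, abs_two]; linarith
  · linarith

theorem Bump.phi_eq_zero_of_two_lt {x : ℝ} (hx : (2 : ℝ) < x) : ψ.phi x = 0 :=
  ψ.phi_eq_zero (by rw [abs_of_pos (by linarith)]; linarith)

theorem Bump.phi_nonneg {x : ℝ} (hx : 0 ≤ x) : 0 ≤ ψ.phi x := by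
  rw [Bump.phi, sub_nonneg]
  exact ψ.antitoneOn hx (by simpa using hx) (by linarith)

theorem Bump.smooth_phi : ContDiff ℝ ∞ ψ.phi := by
  have h := ψ.smooth
  unfold Bump.phi
  fun_prop

theorem Bump.deriv_zero : deriv ψ.toFun 0 = 0 := by
  have h : ψ.toFun =ᶠ[𝓝 0] fun _ => 1 := by
    filter_upwards [Icc_mem_nhds (by norm_num : -(4 / 5 : ℝ) < 0) (by norm_num : (0 : ℝ) < 4 / 5)]
      with x hx using ψ.eq_one x hx
  rw [h.deriv_eq, deriv_const]

theorem Bump.deriv_phi_zero : deriv ψ.phi 0 = 0 := by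
  have h : ψ.phi =ᶠ[𝓝 0] fun _ => 0 := by
    filter_upwards [Icc_mem_nhds (by norm_num : -(2 / 5 : ℝ) < 0) (by norm_num : (0 : ℝ) < 2 / 5)]
      with x hx using ψ.phi_eq_zero_of_le (abs_le.2 hx)
  rw [h.deriv_eq, deriv_const]

theorem Bump.exists_symBound : ∃ A, ∀ l : ℕ, SymBound (mult ψ.toFun l) A 2 (2 ^ l) :=
  exists_symBound_mult (by exact_mod_cast contDiff_infty.1 ψ.smooth 2)
    (fun x hx => ψ.eq_zero (by push_cast at hx; linarith)) ψ.deriv_zero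

theorem Bump.exists_symBound_phi : ∃ A, ∀ l : ℕ, SymBound (mult ψ.phi l) A 2 (2 ^ l) :=
  exists_symBound_mult (by exact_mod_cast contDiff_infty.1 ψ.smooth_phi 2)
    (fun x hx => ψ.phi_eq_zero (by push_cast at hx; linarith)) ψ.deriv_phi_zero

theorem zonal_eq (n : ℕ) (z : ℝ) :
    zonal n z = (2 * (n : ℝ) + 1) / (4 * Real.pi) * (leg n).eval z := by
  rw [zonal, legendre_eq]

theorem eval_zon (a : ℕ →₀ ℝ) (z : ℝ) : (zon a).eval z = a.sum fun n c => c * zonal n z := by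
  rw [zon, Finsupp.linearCombination_apply, Finsupp.sum, eval_finsetSum]
  refine Finset.sum_congr rfl fun n _ => ?_
  simp only [eval_smul, zonal_eq, smul_eq_mul]

theorem zon_single (n : ℕ) (c z : ℝ) : (zon (Finsupp.single n c)).eval z = c * zonal n z := by
  rw [eval_zon, Finsupp.sum_single_index (by simp)]

theorem continuous_zonal (n : ℕ) : Continuous (zonal n) := by
  have : zonal n = fun z => (2 * (n : ℝ) + 1) / (4 * Real.pi) * (leg n).eval z :=
    funext (zonal_eq n)
  rw [this]
  fun_prop

/-- The zonal kernel `p(⟨θ, η⟩)` of a polynomial `p`. -/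
def polyKer (p : ℝ[X]) (θ η : S2) : ℂ := ((p.eval (dot θ η) : ℝ) : ℂ)

theorem norm_polyKer (p : ℝ[X]) (θ η : S2) : ‖polyKer p θ η‖ = |p.eval (dot θ η)| := by
  rw [polyKer, Complex.norm_real, Real.norm_eq_abs]

theorem polyKer_comm (p : ℝ[X]) (θ η : S2) : polyKer p θ η = polyKer p η θ := by
  rw [polyKer, dot_comm, polyKer]

@[fun_prop]
theorem continuous_polyKer {α : Type*} [TopologicalSpace α] (p : ℝ[X]) {f g : α → S2}
    (hf : Continuous f) (hg : Continuous g) : Continuous fun x => polyKer p (f x) (g x) :=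
  Complex.continuous_ofReal.comp (p.continuous.comp (continuous_dot hf hg))

/-- The product of an integrable function on the sphere and a continuous one is integrable. -/
theorem integrable_mul_sphere {w : S2 → ℂ} (hw : Integrable w sphereMeasure) {g : S2 → ℂ}
    (hg : Continuous g) : Integrable (fun σ => w σ * g σ) sphereMeasure := by
  obtain ⟨M, hM⟩ := (isCompact_range hg.norm).bddAbove
  exact hw.mul_bdd (c := M) hg.aestronglyMeasurable (Eventually.of_forall fun σ => hM ⟨σ, rfl⟩)

theorem integral_mul_zon {w : S2 → ℂ} (hw : Integrable w sphereMeasure) (a : ℕ →₀ ℝ) (η : S2) :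
    ∫ σ, w σ * polyKer (zon a) σ η ∂sphereMeasure =
      ∑ n ∈ a.support, (a n : ℂ) * ∫ σ, w σ * (zonal n (dot σ η) : ℂ) ∂sphereMeasure := by
  have hi : ∀ n : ℕ, Integrable (fun σ => w σ * (zonal n (dot σ η) : ℂ)) sphereMeasure := fun n =>
    integrable_mul_sphere hw (Complex.continuous_ofReal.comp ((continuous_zonal n).comp
      (by fun_prop)))
  simp_rw [← integral_const_mul]
  rw [← integral_finsetSum _ fun n _ => (hi n).const_mul _]
  congr 1
  funext σ
  rw [polyKer, eval_zon, Finsupp.sum]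
  push_cast
  rw [Finset.mul_sum]
  exact Finset.sum_congr rfl fun n _ => by ring

theorem integral_zonal_of_ne {n m : ℕ} (hnm : n ≠ m) (θ η : S2) :
    ∫ σ : S2, zonal n (dot θ σ) * zonal m (dot σ η) ∂sphereMeasure = 0 := by
  simp_rw [zonal_eq, mul_mul_mul_comm, dot_comm θ]
  rw [integral_const_mul, integral_leg_mul_leg_of_ne hnm, mul_zero]

theorem zonal_zero (z : ℝ) : zonal 0 z = 1 / (4 * Real.pi) := by
  rw [zonal_eq, leg_zero]; simp

theorem integral_zonal_eq (n : ℕ) (η : S2) :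
    ∫ σ : S2, zonal n (dot σ η) ∂sphereMeasure = if n = 0 then 1 else 0 := by
  split_ifs with h
  · subst h
    simp_rw [zonal_zero]
    rw [integral_const, sphereMeasure_univ, smul_eq_mul]
    field_simp
  · have h1 := integral_zonal_of_ne (Ne.symm h) η η
    simp_rw [zonal_zero] at h1
    rw [integral_const_mul] at h1
    exact (mul_eq_zero.1 h1).resolve_left (by positivity)

theorem integral_zon (a : ℕ →₀ ℝ) (η : S2) :
    ∫ σ : S2, (zon a).eval (dot σ η) ∂sphereMeasure = a 0 := by
  simp_rw [eval_zon, Finsupp.sum]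
  have hi : ∀ n : ℕ, Integrable (fun σ => a n * zonal n (dot σ η)) sphereMeasure := fun n =>
    integrable_sphere (continuous_const.mul ((continuous_zonal n).comp (by fun_prop)))
  rw [integral_finsetSum _ fun n _ => hi n]
  simp_rw [integral_const_mul, integral_zonal_eq]
  simp only [mul_ite, mul_one, mul_zero, Finset.sum_ite_eq', Finsupp.mem_support_iff, ne_eq,
    ite_not, ite_eq_right_iff]
  exact fun h => h.symm

/-- The bound on the increment of `f` splits into a constant, paired with the `L¹` norm of the
kernel, and a multiple of `1 - ⟨σ, η⟩`, paired with its first moment. -/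
theorem SymBound.norm_integral_sub_le {a : ℕ →₀ ℝ} {A : ℝ} {B N : ℕ} (h : SymBound a A B N)
    (h1 : a 0 = 1) {f : S2 → ℂ} (hf : Continuous f) (η : S2) {ε M : ℝ} (hε : 0 ≤ ε) (hM : 0 ≤ M)
    (hfM : ∀ σ, ‖f σ - f η‖ ≤ ε + M * (1 - dot σ η)) :
    ‖(∫ σ, f σ * polyKer (zon a) σ η ∂sphereMeasure) - f η‖ ≤
      ε * (2 * A ^ 2 * (B + 2) ^ 2 + 4) + M * ((A ^ 2 * (B + 2) ^ 2 + 7) / N) := by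
  have hK := continuous_eval_dot (zon a) η
  have hKc : Continuous fun σ : S2 => polyKer (zon a) σ η := by fun_prop
  have e1 : f η = ∫ σ : S2, f η * polyKer (zon a) σ η ∂sphereMeasure := by
    simp_rw [polyKer]
    rw [integral_const_mul, integral_complex_ofReal, integral_zon, h1, Complex.ofReal_one, mul_one]
  calc _ = ‖∫ σ, (f σ - f η) * polyKer (zon a) σ η ∂sphereMeasure‖ := by
        conv_lhs => rw [e1]
        rw [← integral_sub (integrable_sphere (by fun_prop)) (integrable_sphere (by fun_prop))]
        simp_rw [sub_mul]
    _ ≤ ∫ σ, ‖(f σ - f η) * polyKer (zon a) σ η‖ ∂sphereMeasure :=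
        norm_integral_le_integral_norm _
    _ ≤ ∫ σ, (ε * |(zon a).eval (dot σ η)| +
          M * ((1 - dot σ η) * |(zon a).eval (dot σ η)|)) ∂sphereMeasure := by
        refine integral_mono (integrable_sphere (by fun_prop)) (integrable_sphere (by fun_prop))
          fun σ => ?_
        simp only [norm_mul, norm_polyKer]
        calc _ ≤ (ε + M * (1 - dot σ η)) * |(zon a).eval (dot σ η)| :=
              mul_le_mul_of_nonneg_right (hfM σ) (abs_nonneg _)
          _ = _ := by ring
    _ ≤ _ := by
        rw [integral_add (integrable_sphere (by fun_prop)) (integrable_sphere (by fun_prop)),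
          integral_const_mul, integral_const_mul]
        gcongr
        · exact h.integral_abs_le η
        · exact h.integral_tent_abs_le η

/-- The kernels `∑_n ψ(2^{-l} n) 𝔷_n` form an approximate identity on the sphere as `l → ∞`. -/
theorem Bump.tendsto_integral_zon {f : S2 → ℂ} (hf : Continuous f) (η : S2) :
    Tendsto (fun l : ℕ => ∫ σ, f σ * polyKer (zon (mult ψ.toFun l)) σ η ∂sphereMeasure)
      atTop (𝓝 (f η)) := by
  obtain ⟨A, hA⟩ := ψ.exists_symBound
  have h0 : ∀ l : ℕ, mult ψ.toFun l 0 = 1 := fun l => by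
    rw [mult_apply (fun x hx => ψ.eq_zero_of_two_lt hx)]
    exact ψ.eq_one' (by norm_num)
  obtain ⟨S, hS⟩ := (isCompact_range hf.norm).bddAbove
  have hS' : ∀ σ, ‖f σ‖ ≤ S := fun σ => hS ⟨σ, rfl⟩
  have hS0 : 0 ≤ S := (norm_nonneg _).trans (hS' η)
  rw [Metric.tendsto_atTop]
  intro ε hε
  set C1 : ℝ := 2 * A ^ 2 * ((2 : ℕ) + 2) ^ 2 + 4
  set C2 : ℝ := A ^ 2 * ((2 : ℕ) + 2) ^ 2 + 7
  have hC1 : 0 < C1 := by positivity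
  have hC2 : 0 < C2 := by positivity
  obtain ⟨δ, hδ, hδf⟩ := Metric.continuous_iff.1 hf η (ε / 2 / C1) (by positivity)
  -- Outside the ball of radius `δ` one has `1 - ⟨σ, η⟩ ≥ δ² / 2`.
  set M := 4 * S / δ ^ 2
  have hM : 0 ≤ M := by positivity
  have hb : ∀ σ, ‖f σ - f η‖ ≤ ε / 2 / C1 + M * (1 - dot σ η) := fun σ => by
    have h1 := sub_nonneg.2 (dot_le_one σ η)
    by_cases h : dist σ η < δ
    · have h2 := hδf σ h
      rw [dist_eq_norm] at h2
      have : 0 ≤ M * (1 - dot σ η) := by positivity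
      linarith
    · have h2 : ‖f σ - f η‖ ≤ 2 * S := (norm_sub_le _ _).trans (by linarith [hS' σ, hS' η])
      have h3 : δ ^ 2 / 2 ≤ 1 - dot σ η := by
        rw [one_sub_dot]
        have h4 : δ ≤ ‖(σ : E3) - η‖ := by
          rw [← dist_eq_norm]; exact not_lt.1 h
        gcongr
      have h4 : 2 * S = M * (δ ^ 2 / 2) := by simp only [M]; field_simp; ring
      have h5 : 0 < ε / 2 / C1 := by positivity
      have h6 : M * (δ ^ 2 / 2) ≤ M * (1 - dot σ η) := by gcongr
      linarith
  have hlim : Tendsto (fun l : ℕ => M * (C2 / ((2 ^ l : ℕ) : ℝ))) atTop (𝓝 (M * 0)) := by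
    refine Tendsto.const_mul _ (Tendsto.div_atTop tendsto_const_nhds ?_)
    push_cast
    exact tendsto_pow_atTop_atTop_of_one_lt one_lt_two
  rw [mul_zero] at hlim
  obtain ⟨L, hL⟩ := Metric.tendsto_atTop.1 hlim (ε / 2) (by positivity)
  refine ⟨L, fun l hl => ?_⟩
  rw [dist_eq_norm]
  have h1 := (hA l).norm_integral_sub_le (h0 l) hf η (by positivity) hM hb
  have h2 := hL l hl
  rw [Real.dist_0_eq_abs] at h2
  have h3 := (abs_lt.1 h2).2
  have h4 : ε / 2 / C1 * C1 = ε / 2 := by field_simp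
  calc _ ≤ ε / 2 / C1 * C1 + M * (C2 / ((2 ^ l : ℕ) : ℝ)) := h1
    _ < ε := by rw [h4]; linarith

theorem Bump.mult_eventually_eq_one (n : ℕ) : ∀ᶠ l : ℕ in atTop, mult ψ.toFun l n = 1 := by
  have h : Tendsto (fun l : ℕ => (n : ℝ) / ((2 ^ l : ℕ) : ℝ)) atTop (𝓝 0) := by
    refine Tendsto.div_atTop tendsto_const_nhds ?_
    push_cast
    exact tendsto_pow_atTop_atTop_of_one_lt one_lt_two
  filter_upwards [h.eventually (Icc_mem_nhds (by norm_num : -(4 / 5 : ℝ) < 0)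
    (by norm_num : (0 : ℝ) < 4 / 5))] with l hl
  rw [mult_natCast_apply (fun x hx => ψ.eq_zero_of_two_lt hx)]
  exact ψ.eq_one _ hl

/-- The zonal function `𝔷_n` reproduces itself under convolution: the approximate identity applied
to it returns it in the limit, while by orthogonality only its `n`-th term contributes. The bump is
only auxiliary. -/
theorem Bump.integral_zonal_mul_zonal (ψ : Bump) (n : ℕ) (θ η : S2) :
    ∫ σ : S2, zonal n (dot θ σ) * zonal n (dot σ η) ∂sphereMeasure = zonal n (dot θ η) := by
  have hc : Continuous fun σ : S2 => ((zonal n (dot θ σ) : ℝ) : ℂ) :=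
    Complex.continuous_ofReal.comp ((continuous_zonal n).comp (by fun_prop))
  have h1 := ψ.tendsto_integral_zon hc η
  have h2 : ∀ᶠ l : ℕ in atTop, ∫ σ : S2, ((zonal n (dot θ σ) : ℝ) : ℂ) *
      polyKer (zon (mult ψ.toFun l)) σ η ∂sphereMeasure =
      ((∫ σ : S2, zonal n (dot θ σ) * zonal n (dot σ η) ∂sphereMeasure : ℝ) : ℂ) := by
    filter_upwards [ψ.mult_eventually_eq_one n] with l hl
    rw [integral_mul_zon (integrable_sphere hc), Finset.sum_eq_single n]
    · rw [hl, Complex.ofReal_one, one_mul, ← integral_complex_ofReal]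
      simp
    · intro m _ hm
      have := integral_zonal_of_ne hm.symm θ η
      have h3 : ∫ σ : S2, ((zonal n (dot θ σ) : ℝ) : ℂ) * ((zonal m (dot σ η) : ℝ) : ℂ)
          ∂sphereMeasure = 0 := by
        rw [← Complex.ofReal_zero, ← this, ← integral_complex_ofReal]
        simp
      rw [h3, mul_zero]
    · intro h
      rw [Finsupp.notMem_support_iff, hl] at h
      exact absurd h one_ne_zero
  have h3 := tendsto_nhds_unique (h1.congr' h2) tendsto_const_nhds
  exact_mod_cast h3.symm

/-- Zonal multipliers compose by multiplication of their coefficients. -/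
theorem Bump.integral_zon_mul_zon (ψ : Bump) (a b : ℕ →₀ ℝ) (θ η : S2) :
    ∫ σ : S2, (zon a).eval (dot θ σ) * (zon b).eval (dot σ η) ∂sphereMeasure =
      (zon (a * b)).eval (dot θ η) := by
  have hc1 : ∀ p : ℝ[X], Continuous fun σ : S2 => p.eval (dot θ σ) := fun p => by
    simp_rw [dot_comm θ]; exact continuous_eval_dot p θ
  have hc2 : ∀ p : ℝ[X], Continuous fun σ : S2 => p.eval (dot σ η) := fun p =>
    continuous_eval_dot p η
  induction a using Finsupp.induction_linear with
  | zero => simp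
  | add a a' ha ha' =>
    rw [add_mul, map_add, map_add, eval_add, ← ha, ← ha']
    have hi : ∀ p q : ℝ[X], Integrable (fun σ : S2 => p.eval (dot θ σ) * q.eval (dot σ η))
      sphereMeasure := fun p q => integrable_sphere ((hc1 p).mul (hc2 q))
    rw [← integral_add (hi _ _) (hi _ _)]
    simp_rw [eval_add, add_mul]
  | single n c =>
    induction b using Finsupp.induction_linear with
    | zero => simp
    | add b b' hb hb' =>
      rw [mul_add, map_add, map_add, eval_add, ← hb, ← hb']
      have hi : ∀ p q : ℝ[X], Integrable (fun σ : S2 => p.eval (dot θ σ) * q.eval (dot σ η))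
        sphereMeasure := fun p q => integrable_sphere ((hc1 p).mul (hc2 q))
      rw [← integral_add (hi _ _) (hi _ _)]
      simp_rw [eval_add, mul_add]
    | single m d =>
      simp_rw [zon_single]
      have e : ∀ σ, c * zonal n (dot θ σ) * (d * zonal m (dot σ η)) =
          c * d * (zonal n (dot θ σ) * zonal m (dot σ η)) := fun σ => by ring
      simp_rw [e]
      rw [integral_const_mul]
      by_cases h : n = m
      · subst h
        rw [ψ.integral_zonal_mul_zonal, ← Finsupp.single_mul, zon_single]
      · rw [integral_zonal_of_ne h, mul_zero]
        have h0 : Finsupp.single n c * Finsupp.single m d = 0 := by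
          ext k
          rw [Finsupp.mul_apply, Finsupp.single_apply, Finsupp.single_apply]
          split_ifs <;> simp_all
        rw [h0, map_zero, eval_zero]

end Sampling

/-! ### Products of spherical harmonics -/

section Product

open Polynomial

theorem natDegree_leg_le (n : ℕ) : (leg n).natDegree ≤ n := by
  refine (natDegree_C_mul_le _ _).trans ((natDegree_iterate_derivative _ _).trans ?_)
  have h : ((X ^ 2 - 1 : ℝ[X]) ^ n).natDegree ≤ n * 2 := by
    refine natDegree_pow_le.trans (Nat.mul_le_mul_left n ?_)
    compute_degree
  omega

theorem natDegree_zon_le {a : ℕ →₀ ℝ} {D : ℕ} (h : ∀ n, a n ≠ 0 → n ≤ D) :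
    (zon a).natDegree ≤ D := by
  rw [zon, Finsupp.linearCombination_apply]
  refine natDegree_sum_le_of_forall_le _ _ fun n hn => ?_
  refine (natDegree_smul_le _ _).trans ((natDegree_smul_le _ _).trans ?_)
  exact (natDegree_leg_le n).trans (h n (Finsupp.mem_support_iff.1 hn))

/-- A power of degree `d` of a linear form restricts to a zonal function, which is a combination of
Legendre polynomials of degree at most `d` about another axis. -/
theorem integral_pow_inner_mul_leg {d m : ℕ} (hdm : d < m) (v : E3) (η : S2) :
    ∫ σ : S2, inner ℝ (σ : E3) v ^ d * (leg m).eval (dot σ η) ∂sphereMeasure = 0 := by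
  have h1 : ∀ p ∈ Submodule.span ℝ (leg '' Set.Iic d),
      ∫ σ : S2, p.eval (dot σ (dirS v)) * (leg m).eval (dot σ η) ∂sphereMeasure = 0 := by
    intro p hp
    have hc := continuous_eval_dot
    induction hp using Submodule.span_induction with
    | zero => simp
    | add p q _ _ hp hq =>
      simp_rw [eval_add, add_mul]
      have c1 := hc p (dirS v)
      have c2 := hc q (dirS v)
      have c3 := hc (leg m) η
      rw [integral_add (integrable_sphere (by fun_prop)) (integrable_sphere (by fun_prop)), hp, hq,
        add_zero]
    | smul c p _ hp =>
      simp_rw [eval_smul, smul_eq_mul, mul_assoc]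
      rw [integral_const_mul, hp, mul_zero]
    | mem p hp =>
      obtain ⟨r, hr, rfl⟩ := hp
      have hr' : r ≤ d := hr
      exact integral_leg_mul_leg_of_ne (by omega) η (dirS v)
  have h2 := h1 _ (X_pow_mem_span_leg d)
  have h3 : ∀ σ : S2, inner ℝ (σ : E3) v = ‖v‖ * dot σ (dirS v) := fun σ => by
    rw [dot, coe_dirS, ← real_inner_smul_right, norm_smul_direction]
  simp_rw [h3, mul_pow, mul_assoc]
  rw [integral_const_mul]
  simp only [eval_pow, eval_X] at h2
  rw [h2, mul_zero]

/-- Polarization: the integrals of `⟨σ, x + s y⟩^{i + j} P_m(⟨σ, η⟩)` vanish for all real `s`, hence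
so does each coefficient of this polynomial in `s`. -/
theorem integral_pow_mul_pow_mul_leg {i j m : ℕ} (h : i + j < m) (θ θ' η : S2) :
    ∫ σ : S2, dot σ θ ^ i * dot σ θ' ^ j * (leg m).eval (dot σ η) ∂sphereMeasure = 0 := by
  set I : ℕ → ℝ := fun k =>
    ∫ σ : S2, dot σ θ' ^ k * dot σ θ ^ (i + j - k) * (leg m).eval (dot σ η) ∂sphereMeasure with hI
  set q : ℝ[X] := ∑ k ∈ Finset.range (i + j + 1), C (((i + j).choose k : ℝ) * I k) * X ^ k with hq
  have hL := continuous_eval_dot (leg m) η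
  have hq0 : q = 0 := by
    refine Polynomial.funext fun s => ?_
    rw [eval_zero, ← integral_pow_inner_mul_leg h ((θ : E3) + s • (θ' : E3)) η, hq, eval_finsetSum]
    have e : ∀ σ : S2, inner ℝ (σ : E3) ((θ : E3) + s • (θ' : E3)) ^ (i + j) *
        (leg m).eval (dot σ η) = ∑ k ∈ Finset.range (i + j + 1), ((i + j).choose k : ℝ) * s ^ k *
          (dot σ θ' ^ k * dot σ θ ^ (i + j - k) * (leg m).eval (dot σ η)) := fun σ => by
      have e1 : inner ℝ (σ : E3) ((θ : E3) + s • (θ' : E3)) = s * dot σ θ' + dot σ θ := by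
        rw [inner_add_right, real_inner_smul_right, dot, dot, add_comm]
      rw [e1, add_pow, Finset.sum_mul]
      exact Finset.sum_congr rfl fun k _ => by rw [mul_pow]; ring
    simp_rw [e]
    rw [integral_finsetSum _ fun k _ => integrable_sphere (by fun_prop)]
    refine Finset.sum_congr rfl fun k _ => ?_
    rw [integral_const_mul]
    simp only [hI, eval_mul, eval_C, eval_pow, eval_X]
    ring
  have h1 : q.coeff j = ((i + j).choose j : ℝ) * I j := by
    rw [hq, finsetSum_coeff]
    simp_rw [coeff_C_mul_X_pow]
    rw [Finset.sum_ite_eq, if_pos (Finset.mem_range.2 (by omega))]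
  rw [hq0, coeff_zero] at h1
  have h2 : ((i + j).choose j : ℝ) ≠ 0 :=
    Nat.cast_ne_zero.2 (Nat.choose_pos (Nat.le_add_left j i)).ne'
  have h3 : I j = 0 := (mul_eq_zero.1 h1.symm).resolve_left h2
  simp only [hI, Nat.add_sub_cancel] at h3
  rw [← h3]
  congr 1
  funext σ
  ring

theorem integral_eval_mul_eval_mul_leg {p q : ℝ[X]} {m : ℕ} (h : p.natDegree + q.natDegree < m)
    (θ θ' η : S2) : ∫ σ : S2, p.eval (dot σ θ) * q.eval (dot σ θ') * (leg m).eval (dot σ η)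
      ∂sphereMeasure = 0 := by
  have hL := continuous_eval_dot (leg m) η
  have e : ∀ σ : S2, p.eval (dot σ θ) * q.eval (dot σ θ') * (leg m).eval (dot σ η) =
      ∑ i ∈ Finset.range (p.natDegree + 1), ∑ j ∈ Finset.range (q.natDegree + 1),
        p.coeff i * q.coeff j * (dot σ θ ^ i * dot σ θ' ^ j * (leg m).eval (dot σ η)) :=
    fun σ => by
      rw [eval_eq_sum_range, eval_eq_sum_range, Finset.sum_mul_sum, Finset.sum_mul]
      refine Finset.sum_congr rfl fun i _ => ?_
      rw [Finset.sum_mul]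
      exact Finset.sum_congr rfl fun j _ => by ring
  simp_rw [e]
  have hi : ∀ i j, Integrable (fun σ : S2 => p.coeff i * q.coeff j *
      (dot σ θ ^ i * dot σ θ' ^ j * (leg m).eval (dot σ η))) sphereMeasure :=
    fun i j => integrable_sphere (by fun_prop)
  rw [integral_finsetSum _ fun i _ => integrable_finsetSum _ fun j _ => hi i j]
  refine Finset.sum_eq_zero fun i hi' => ?_
  rw [integral_finsetSum _ fun j _ => hi i j]
  refine Finset.sum_eq_zero fun j hj' => ?_
  rw [integral_const_mul, integral_pow_mul_pow_mul_leg, mul_zero]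
  rw [Finset.mem_range] at hi' hj'
  omega

/-- The product of spherical harmonics of degrees at most `D` and `D'` has no component of degree
above `D + D'`. -/
theorem integral_zon_mul_zon_mul_zon {a b c : ℕ →₀ ℝ} {D D' : ℕ} (ha : ∀ n, a n ≠ 0 → n ≤ D)
    (hb : ∀ n, b n ≠ 0 → n ≤ D') (hc : ∀ n, c n ≠ 0 → D + D' < n) (θ θ' η : S2) :
    ∫ σ : S2, (zon a).eval (dot σ θ) * (zon b).eval (dot σ θ') * (zon c).eval (dot σ η)
      ∂sphereMeasure = 0 := by
  have h1 := continuous_eval_dot (zon a) θ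
  have h2 := continuous_eval_dot (zon b) θ'
  have e : ∀ σ : S2, (zon a).eval (dot σ θ) * (zon b).eval (dot σ θ') * (zon c).eval (dot σ η) =
      ∑ n ∈ c.support, c n * ((2 * (n : ℝ) + 1) / (4 * Real.pi)) *
        ((zon a).eval (dot σ θ) * (zon b).eval (dot σ θ') * (leg n).eval (dot σ η)) := fun σ => by
    rw [eval_zon c, Finsupp.sum, Finset.mul_sum]
    exact Finset.sum_congr rfl fun n _ => by rw [zonal_eq]; ring
  simp_rw [e]
  rw [integral_finsetSum _ fun n _ => by
    have h3 := continuous_eval_dot (leg n) η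
    exact integrable_sphere (by fun_prop)]
  refine Finset.sum_eq_zero fun n hn => ?_
  rw [integral_const_mul, integral_eval_mul_eval_mul_leg, mul_zero]
  have := hc n (Finsupp.mem_support_iff.1 hn)
  have := natDegree_zon_le ha
  have := natDegree_zon_le hb
  omega

end Product

/-! ### Operators acting on the directions of a function -/

section Operator

open Polynomial

/-- The integral operator with kernel `k` on functions on the sphere. -/
def sphConv (k : S2 → S2 → ℂ) (F : S2 → ℂ) (η : S2) : ℂ :=
  ∫ θ, F θ * k θ η ∂sphereMeasure

/-- The operator that applies `sphConv k` on every sphere centred at the origin. -/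
def sphOp (k : S2 → S2 → ℂ) (f : E3 → ℂ) (x : E3) : ℂ :=
  ∫ θ : S2, f (‖x‖ • (θ : E3)) * k θ (dirS x) ∂sphereMeasure

theorem sphOp_eq (k : S2 → S2 → ℂ) (f : E3 → ℂ) (x : E3) :
    sphOp k f x = sphConv k (fun θ : S2 => f (‖x‖ • (θ : E3))) (dirS x) := rfl

theorem sphOp_smul (k : S2 → S2 → ℂ) (f : E3 → ℂ) {r : ℝ} (hr : 0 < r) (η : S2) :
    sphOp k f (r • (η : E3)) = sphConv k (fun θ : S2 => f (r • (θ : E3))) η := by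
  rw [sphOp_eq, norm_smul_S2 hr.le, dirS_smul hr]

/-- The function `f` is integrable over the sphere through `x` centred at the origin. -/
def SphereIntegrable (f : E3 → ℂ) (x : E3) : Prop :=
  Integrable (fun θ : S2 => f (‖x‖ • (θ : E3))) sphereMeasure

theorem ae_ne_zero : ∀ᵐ x : E3, x ≠ 0 := by
  have : (volume : Measure E3) {0} = 0 := measure_singleton 0
  exact compl_mem_ae_iff.2 this

/-- A null set of `ℝ³` meets almost every sphere in a null set. -/
theorem ae_sphere_of_ae {P : E3 → Prop} (h : ∀ᵐ x : E3, P x) :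
    ∀ᵐ x : E3, ∀ᵐ θ : S2 ∂sphereMeasure, P (‖x‖ • (θ : E3)) := by
  have h1 : ∀ᵐ p ∂((volume : Measure E3).prod sphereMeasure), P p.1 :=
    Measure.quasiMeasurePreserving_fst.ae h
  exact Measure.ae_ae_of_ae_prod (measurePreserving_dirSwap.quasiMeasurePreserving.ae h1)

theorem sphereIntegrable_of_integrable {f : E3 → ℂ} (hf : Integrable f volume) :
    ∀ᵐ x : E3, SphereIntegrable f x := by
  have h1 : Integrable (fun p : E3 × S2 => f p.1) ((volume : Measure E3).prod sphereMeasure) :=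
    hf.comp_fst sphereMeasure
  have h2 := measurePreserving_dirSwap.integrable_comp_of_integrable h1
  exact h2.prod_right_ae

theorem sphereIntegrable_of_locallyIntegrable {f : E3 → ℂ} (hf : LocallyIntegrable f volume) :
    ∀ᵐ x : E3, SphereIntegrable f x := by
  have h1 : ∀ n : ℕ, ∀ᵐ x : E3,
      SphereIntegrable ((Metric.closedBall (0 : E3) n).indicator f) x := fun n =>
    sphereIntegrable_of_integrable ((integrable_indicator_iff
      Metric.isClosed_closedBall.measurableSet).2
      (hf.integrableOn_isCompact (isCompact_closedBall _ _)))
  filter_upwards [ae_all_iff.2 h1] with x hx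
  obtain ⟨n, hn⟩ := exists_nat_ge ‖x‖
  refine (hx n).congr (Eventually.of_forall fun θ => ?_)
  refine Set.indicator_of_mem ?_ f
  rw [mem_closedBall_zero_iff, norm_smul_S2 (norm_nonneg x)]
  exact hn

theorem sphereIntegrable_of_continuous {f : E3 → ℂ} (hf : Continuous f) (x : E3) :
    SphereIntegrable f x :=
  integrable_sphere (hf.comp (by fun_prop))

theorem MemLp.ae_sphereIntegrable {f : E3 → ℂ} {r : ℝ≥0∞} (hr : 1 ≤ r) (hf : MemLp f r volume) :
    ∀ᵐ x : E3, SphereIntegrable f x :=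
  sphereIntegrable_of_locallyIntegrable (hf.locallyIntegrable hr)

theorem sphConv_congr_ae (k : S2 → S2 → ℂ) {F G : S2 → ℂ} (h : F =ᵐ[sphereMeasure] G) (η : S2) :
    sphConv k F η = sphConv k G η :=
  integral_congr_ae (h.mono fun θ hθ => by simp only [hθ])

theorem sphOp_congr_ae (k : S2 → S2 → ℂ) {f g : E3 → ℂ} (h : f =ᵐ[volume] g) :
    sphOp k f =ᵐ[volume] sphOp k g := by
  filter_upwards [ae_sphere_of_ae h] with x hx
  exact sphConv_congr_ae k hx _

theorem integrable_mul_ker {F : S2 → ℂ} (hF : Integrable F sphereMeasure) {k : S2 → S2 → ℂ}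
    (hk : Continuous (Function.uncurry k)) (η : S2) :
    Integrable (fun θ => F θ * k θ η) sphereMeasure :=
  integrable_mul_sphere hF (hk.comp (by fun_prop : Continuous fun θ : S2 => (θ, η)))

theorem exists_bound_ker {k : S2 → S2 → ℂ} (hk : Continuous (Function.uncurry k)) :
    ∃ M, 0 ≤ M ∧ ∀ θ η, ‖k θ η‖ ≤ M := by
  obtain ⟨M, hM⟩ := (isCompact_range hk.norm).bddAbove
  exact ⟨max M 0, le_max_right _ _, fun θ η => (hM ⟨(θ, η), rfl⟩).trans (le_max_left _ _)⟩

theorem continuous_sphConv {F : S2 → ℂ} (hF : Integrable F sphereMeasure) {k : S2 → S2 → ℂ}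
    (hk : Continuous (Function.uncurry k)) : Continuous (sphConv k F) := by
  obtain ⟨M, hM0, hM⟩ := exists_bound_ker hk
  refine continuous_of_dominated (bound := fun θ => ‖F θ‖ * M)
    (fun η => (integrable_mul_ker hF hk η).aestronglyMeasurable)
    (fun η => Eventually.of_forall fun θ => ?_) (hF.norm.mul_const M)
    (Eventually.of_forall fun θ => ?_)
  · rw [norm_mul]
    gcongr
    exact hM θ η
  · exact continuous_const.mul (hk.comp (by fun_prop : Continuous fun η : S2 => (θ, η)))

theorem sphereIntegrable_sphOp {f : E3 → ℂ} {x : E3} (hx : x ≠ 0) (hf : SphereIntegrable f x)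
    {k : S2 → S2 → ℂ} (hk : Continuous (Function.uncurry k)) :
    SphereIntegrable (sphOp k f) x := by
  have e : (fun θ : S2 => sphOp k f (‖x‖ • (θ : E3))) =
      sphConv k (fun θ : S2 => f (‖x‖ • (θ : E3))) :=
    funext fun θ => sphOp_smul k f (norm_pos_iff.2 hx) θ
  rw [SphereIntegrable, e]
  exact integrable_sphere (continuous_sphConv hf hk)

/-- Fubini for an integrable weight and a continuous kernel over compact spaces. -/
theorem integral_mul_ker_swap {Y : Type*} [TopologicalSpace Y] [CompactSpace Y]
    [MeasurableSpace Y] [BorelSpace Y] [SecondCountableTopology Y] {μ : Measure Y} [SFinite μ]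
    {w : Y → ℂ} (hw : Integrable w μ) {k : Y → S2 → ℂ} (hk : Continuous (Function.uncurry k))
    {m : S2 → ℂ} (hm : Continuous m) :
    ∫ σ, (∫ y, w y * k y σ ∂μ) * m σ ∂sphereMeasure =
      ∫ y, w y * ∫ σ, k y σ * m σ ∂sphereMeasure ∂μ := by
  obtain ⟨M, hM⟩ := (isCompact_range (hk.mul (hm.comp continuous_snd)).norm).bddAbove
  have hint : Integrable (Function.uncurry fun (y : Y) (σ : S2) => w y * (k y σ * m σ))
      (μ.prod sphereMeasure) := by
    refine (hw.comp_fst sphereMeasure).mul_bdd (c := M)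
      (hk.mul (hm.comp continuous_snd)).aestronglyMeasurable (Eventually.of_forall fun p => ?_)
    exact hM ⟨p, rfl⟩
  have h := integral_integral_swap hint
  simp_rw [integral_const_mul] at h
  rw [h]
  congr 1
  funext σ
  rw [← integral_mul_const]
  congr 1
  funext y
  ring

/-- The kernel of the composition `sphConv k' ∘ sphConv k`. -/
def kerComp (k k' : S2 → S2 → ℂ) (θ η : S2) : ℂ := ∫ σ, k θ σ * k' σ η ∂sphereMeasure

theorem sphConv_sphConv {F : S2 → ℂ} (hF : Integrable F sphereMeasure) {k k' : S2 → S2 → ℂ}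
    (hk : Continuous (Function.uncurry k)) (hk' : Continuous (Function.uncurry k')) (η : S2) :
    sphConv k' (sphConv k F) η = sphConv (kerComp k k') F η :=
  integral_mul_ker_swap hF hk (hk'.comp (by fun_prop : Continuous fun σ : S2 => (σ, η)))

theorem sphOp_sphOp {f : E3 → ℂ} {x : E3} (hx : x ≠ 0) (hf : SphereIntegrable f x)
    {k k' : S2 → S2 → ℂ} (hk : Continuous (Function.uncurry k))
    (hk' : Continuous (Function.uncurry k')) :
    sphOp k' (sphOp k f) x = sphOp (kerComp k k') f x := by
  rw [sphOp_eq, sphOp_eq, ← sphConv_sphConv hf hk hk']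
  congr 1
  exact funext fun θ => sphOp_smul k f (norm_pos_iff.2 hx) θ

theorem Bump.kerComp_zon (ψ : Bump) (a b : ℕ →₀ ℝ) :
    kerComp (polyKer (zon a)) (polyKer (zon b)) = polyKer (zon (a * b)) := by
  funext θ η
  rw [kerComp, polyKer, ← ψ.integral_zon_mul_zon, ← integral_complex_ofReal]
  simp [polyKer]

theorem continuous_uncurry_polyKer (p : ℝ[X]) : Continuous (Function.uncurry (polyKer p)) := by
  unfold Function.uncurry
  fun_prop

theorem angMult_eq {χ : ℝ → ℝ} {B : ℝ} (hB : ∀ x, B < x → χ x = 0) (l : ℤ) {f : E3 → ℂ} {x : E3}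
    (hf : SphereIntegrable f x) : angMult χ l f x = sphOp (polyKer (zon (mult χ l))) f x := by
  rw [angMult, sphOp, integral_mul_zon hf, tsum_eq_sum (s := (mult χ l).support)]
  · refine Finset.sum_congr rfl fun n _ => ?_
    rw [mult_apply hB]
    rfl
  · intro n hn
    rw [Finsupp.notMem_support_iff, mult_apply hB] at hn
    rw [hn, Complex.ofReal_zero, zero_mul]

/-! ### Bounds on Lebesgue spaces -/

/-- The hypothesis of Schur's test for a continuous kernel on the sphere. -/
structure SchurKernel (k : S2 → S2 → ℂ) (M : ℝ≥0) : Prop where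
  cont : Continuous (Function.uncurry k)
  left : ∀ η, ∫⁻ θ, ‖k θ η‖ₑ ∂sphereMeasure ≤ M
  right : ∀ θ, ∫⁻ η, ‖k θ η‖ₑ ∂sphereMeasure ≤ M

theorem SchurKernel.of_integral {k : S2 → S2 → ℂ} (hk : Continuous (Function.uncurry k)) {M : ℝ}
    (h1 : ∀ η, ∫ θ, ‖k θ η‖ ∂sphereMeasure ≤ M) (h2 : ∀ θ, ∫ η, ‖k θ η‖ ∂sphereMeasure ≤ M) :
    SchurKernel k M.toNNReal := by
  refine ⟨hk, fun η => ?_, fun θ => ?_⟩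
  · have hc : Continuous fun θ => k θ η := hk.comp (by fun_prop : Continuous fun θ : S2 => (θ, η))
    rw [← ofReal_integral_norm_eq_lintegral_enorm (integrable_sphere hc)]
    exact ENNReal.ofReal_le_ofReal (h1 η)
  · have hc : Continuous fun η => k θ η := hk.comp (by fun_prop : Continuous fun η : S2 => (θ, η))
    rw [← ofReal_integral_norm_eq_lintegral_enorm (integrable_sphere hc)]
    exact ENNReal.ofReal_le_ofReal (h2 θ)

theorem exists_schurKernel {k : S2 → S2 → ℂ} (hk : Continuous (Function.uncurry k)) :
    ∃ M, SchurKernel k M := by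
  obtain ⟨M, hM0, hM⟩ := exists_bound_ker hk
  have key : ∀ g : S2 → ℂ, (∀ θ, ‖g θ‖ ≤ M) → ∫ θ, ‖g θ‖ ∂sphereMeasure ≤ M * (4 * Real.pi) := by
    intro g hg
    rw [← sphereMeasure_univ]
    exact (le_abs_self _).trans (norm_integral_le_of_norm_le_const
      (μ := sphereMeasure)
      (f := fun θ => ‖g θ‖) (Eventually.of_forall fun θ => (norm_norm (g θ)).trans_le (hg θ)))
  exact ⟨_, SchurKernel.of_integral (M := M * (4 * Real.pi)) hk (fun η => key _ fun θ => hM θ η)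
    fun θ => key _ fun η => hM θ η⟩

/-- Jensen's inequality for the power `p` and a finite measure. -/
theorem lintegral_rpow_le {α : Type*} [MeasurableSpace α] {μ : Measure α} {p : ℝ} (hp : 1 ≤ p)
    {g : α → ℝ≥0∞} (hg : AEMeasurable g μ) :
    (∫⁻ x, g x ∂μ) ^ p ≤ μ Set.univ ^ (p - 1) * ∫⁻ x, g x ^ p ∂μ := by
  have hp0 : 0 < p := by linarith
  have h := eLpNorm'_le_eLpNorm'_mul_rpow_measure_univ (μ := μ) (f := g) one_pos hp
    hg.aestronglyMeasurable
  simp only [eLpNorm', enorm_eq_self, ENNReal.rpow_one, one_div_one] at h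
  refine (ENNReal.rpow_le_rpow h hp0.le).trans (le_of_eq ?_)
  rw [ENNReal.mul_rpow_of_nonneg _ _ hp0.le, ← ENNReal.rpow_mul, ← ENNReal.rpow_mul, one_div,
    inv_mul_cancel₀ hp0.ne', ENNReal.rpow_one, mul_comm]
  congr 2
  field_simp

variable {k : S2 → S2 → ℂ} {M : ℝ≥0} {f g : E3 → ℂ}

theorem aestronglyMeasurable_comp_dirSwap (hf : AEStronglyMeasurable f volume) :
    AEStronglyMeasurable (fun p : E3 × S2 => f (‖p.1‖ • (p.2 : E3)))
      ((volume : Measure E3).prod sphereMeasure) := by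
  have h1 : AEStronglyMeasurable (fun p : E3 × S2 => f p.1)
      ((volume : Measure E3).prod sphereMeasure) := hf.comp_fst
  exact h1.comp_measurePreserving measurePreserving_dirSwap

theorem aestronglyMeasurable_ker (hk : Continuous (Function.uncurry k)) :
    AEStronglyMeasurable (fun p : E3 × S2 => k p.2 (dirS p.1))
      ((volume : Measure E3).prod sphereMeasure) := by
  have h : Measurable fun p : E3 × S2 => (p.2, dirS p.1) := by
    have := measurable_dirS
    fun_prop
  exact (hk.measurable.comp h).aestronglyMeasurable

theorem aestronglyMeasurable_sphOp (hk : Continuous (Function.uncurry k))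
    (hf : AEStronglyMeasurable f volume) : AEStronglyMeasurable (sphOp k f) volume :=
  ((aestronglyMeasurable_comp_dirSwap hf).mul (aestronglyMeasurable_ker hk)).integral_prod_right'

theorem enorm_sphOp_le (x : E3) : ‖sphOp k f x‖ₑ ≤
    ∫⁻ θ : S2, ‖f (‖x‖ • (θ : E3))‖ₑ * ‖k θ (dirS x)‖ₑ ∂sphereMeasure :=
  (enorm_integral_le_lintegral_enorm _).trans (le_of_eq (by simp_rw [enorm_mul]))

theorem lintegral_dirSwap {F : E3 × S2 → ℝ≥0∞}
    (hF : AEMeasurable F ((volume : Measure E3).prod sphereMeasure)) :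
    ∫⁻ x : E3, ∫⁻ θ : S2, F (‖x‖ • (θ : E3), dirS x) ∂sphereMeasure =
      ∫⁻ x : E3, ∫⁻ θ : S2, F (x, θ) ∂sphereMeasure := by
  have h1 : AEMeasurable (fun p => F (dirSwap p)) ((volume : Measure E3).prod sphereMeasure) :=
    hF.comp_quasiMeasurePreserving measurePreserving_dirSwap.quasiMeasurePreserving
  rw [← lintegral_prod _ hF]
  conv_rhs => rw [← measurePreserving_dirSwap.map_eq]
  rw [lintegral_map' (by rwa [measurePreserving_dirSwap.map_eq])
    measurePreserving_dirSwap.measurable.aemeasurable, lintegral_prod _ h1]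
  rfl

/-- Schur's test: the bound of `sphOp k` on every `L^r` is the same as on `L¹` and `L^∞`. -/
theorem SchurKernel.eLpNorm_le (h : SchurKernel k M) {r : ℝ≥0∞} (hr : 1 ≤ r)
    (hf : AEStronglyMeasurable f volume) :
    eLpNorm (sphOp k f) r volume ≤ M * eLpNorm f r volume := by
  have hkm : ∀ x : E3, Measurable fun θ : S2 => ‖k θ (dirS x)‖ₑ := fun x =>
    (h.cont.comp (by fun_prop : Continuous fun θ : S2 => (θ, dirS x))).measurable.enorm
  by_cases hr' : r = ⊤
  · subst hr'
    rw [eLpNorm_exponent_top, eLpNorm_exponent_top]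
    refine eLpNormEssSup_le_of_ae_enorm_bound ?_
    filter_upwards [ae_sphere_of_ae (ae_le_eLpNormEssSup (f := f) (μ := volume))] with x hx
    calc ‖sphOp k f x‖ₑ ≤ ∫⁻ θ : S2, ‖f (‖x‖ • (θ : E3))‖ₑ * ‖k θ (dirS x)‖ₑ ∂sphereMeasure :=
          enorm_sphOp_le x
      _ ≤ ∫⁻ θ : S2, eLpNormEssSup f volume * ‖k θ (dirS x)‖ₑ ∂sphereMeasure :=
          lintegral_mono_ae (hx.mono fun θ hθ => by gcongr)
      _ = eLpNormEssSup f volume * ∫⁻ θ : S2, ‖k θ (dirS x)‖ₑ ∂sphereMeasure :=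
          lintegral_const_mul _ (hkm x)
      _ ≤ eLpNormEssSup f volume * M := by gcongr; exact h.left _
      _ = _ := mul_comm _ _
  · have hp : 1 ≤ r.toReal := by
      rw [← ENNReal.toReal_one]
      exact ENNReal.toReal_mono hr' hr
    set p := r.toReal
    have hp0 : 0 < p := by linarith
    have hr0 : r ≠ 0 := (one_pos.trans_le hr).ne'
    rw [eLpNorm_eq_eLpNorm' hr0 hr', eLpNorm_eq_eLpNorm' hr0 hr', eLpNorm', eLpNorm']
    have hM : (M : ℝ≥0∞) = ((M : ℝ≥0∞) ^ p) ^ (1 / p) := by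
      rw [← ENNReal.rpow_mul, mul_one_div_cancel hp0.ne', ENNReal.rpow_one]
    rw [hM, ← ENNReal.mul_rpow_of_nonneg _ _ (by positivity : 0 ≤ 1 / p)]
    refine ENNReal.rpow_le_rpow ?_ (by positivity)
    have h1 : ∀ᵐ x : E3, ‖sphOp k f x‖ₑ ^ p ≤ (M : ℝ≥0∞) ^ (p - 1) *
        ∫⁻ θ : S2, ‖f (‖x‖ • (θ : E3))‖ₑ ^ p * ‖k θ (dirS x)‖ₑ ∂sphereMeasure := by
      filter_upwards [(aestronglyMeasurable_comp_dirSwap hf).prodMk_left] with x hx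
      -- Jensen's inequality for the measure with density `|k|`, of total mass at most `M`.
      set m : Measure S2 := sphereMeasure.withDensity fun θ => ‖k θ (dirS x)‖ₑ
      have hxm : AEMeasurable (fun θ : S2 => ‖f (‖x‖ • (θ : E3))‖ₑ) sphereMeasure := hx.enorm
      have e1 : ∫⁻ θ : S2, ‖f (‖x‖ • (θ : E3))‖ₑ * ‖k θ (dirS x)‖ₑ ∂sphereMeasure =
          ∫⁻ θ : S2, ‖f (‖x‖ • (θ : E3))‖ₑ ∂m := by
        rw [lintegral_withDensity_eq_lintegral_mul₀ (hkm x).aemeasurable hxm]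
        exact lintegral_congr fun θ => mul_comm _ _
      have e2 : ∫⁻ θ : S2, ‖f (‖x‖ • (θ : E3))‖ₑ ^ p * ‖k θ (dirS x)‖ₑ ∂sphereMeasure =
          ∫⁻ θ : S2, ‖f (‖x‖ • (θ : E3))‖ₑ ^ p ∂m := by
        rw [lintegral_withDensity_eq_lintegral_mul₀ (hkm x).aemeasurable (hxm.pow_const p)]
        exact lintegral_congr fun θ => mul_comm _ _
      have e3 : m Set.univ ≤ (M : ℝ≥0∞) := by
        rw [withDensity_apply _ MeasurableSet.univ, Measure.restrict_univ]
        exact h.left _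
      calc ‖sphOp k f x‖ₑ ^ p ≤ (∫⁻ θ : S2, ‖f (‖x‖ • (θ : E3))‖ₑ ∂m) ^ p :=
            ENNReal.rpow_le_rpow ((enorm_sphOp_le x).trans e1.le) hp0.le
        _ ≤ m Set.univ ^ (p - 1) * ∫⁻ θ : S2, ‖f (‖x‖ • (θ : E3))‖ₑ ^ p ∂m :=
            lintegral_rpow_le hp (hxm.mono_ac (withDensity_absolutelyContinuous _ _))
        _ ≤ _ := by
            rw [e2]
            gcongr
    have hk2 : Continuous fun q : S2 × S2 => k q.1 q.2 := h.cont
    have hF : AEMeasurable (fun q : E3 × S2 => ‖f q.1‖ₑ ^ p * ‖k (dirS q.1) q.2‖ₑ)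
        ((volume : Measure E3).prod sphereMeasure) := by
      have hm : Measurable fun q : E3 × S2 => (dirS q.1, q.2) := by
        have := measurable_dirS
        fun_prop
      exact ((hf.comp_fst (ν := sphereMeasure)).enorm.pow_const p).mul
        (hk2.measurable.comp hm).enorm.aemeasurable
    -- The change of variables `dirSwap` exchanges the roles of the two variables of the kernel.
    have hsw := lintegral_dirSwap hF
    calc ∫⁻ x, ‖sphOp k f x‖ₑ ^ p ≤ ∫⁻ x : E3, (M : ℝ≥0∞) ^ (p - 1) *
          ∫⁻ θ : S2, ‖f (‖x‖ • (θ : E3))‖ₑ ^ p * ‖k θ (dirS x)‖ₑ ∂sphereMeasure :=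
          lintegral_mono_ae h1
      _ = ∫⁻ x : E3, (M : ℝ≥0∞) ^ (p - 1) * ∫⁻ θ : S2, ‖f (‖x‖ • (θ : E3))‖ₑ ^ p *
          ‖k (dirS (‖x‖ • (θ : E3))) (dirS x)‖ₑ ∂sphereMeasure := by
          refine lintegral_congr_ae (ae_ne_zero.mono fun x hx => ?_)
          simp only [dirS_smul (norm_pos_iff.2 hx)]
      _ ≤ (M : ℝ≥0∞) ^ (p - 1) * ∫⁻ x : E3, ∫⁻ θ : S2, ‖f (‖x‖ • (θ : E3))‖ₑ ^ p *
          ‖k (dirS (‖x‖ • (θ : E3))) (dirS x)‖ₑ ∂sphereMeasure := by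
          rw [lintegral_const_mul' _ _ (ENNReal.rpow_ne_top_of_nonneg (by linarith)
            ENNReal.coe_ne_top)]
      _ = (M : ℝ≥0∞) ^ (p - 1) *
          ∫⁻ x : E3, ∫⁻ θ : S2, ‖f x‖ₑ ^ p * ‖k (dirS x) θ‖ₑ ∂sphereMeasure := by
          rw [hsw]
      _ ≤ (M : ℝ≥0∞) ^ (p - 1) * ∫⁻ x : E3, ‖f x‖ₑ ^ p * M := by
          gcongr with x
          have hc : Measurable fun θ : S2 => ‖k (dirS x) θ‖ₑ :=
            (hk2.comp (by fun_prop : Continuous fun θ : S2 => (dirS x, θ))).measurable.enorm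
          rw [lintegral_const_mul _ hc]
          gcongr
          exact h.right _
      _ = (M : ℝ≥0∞) ^ (p - 1) * ((∫⁻ x : E3, ‖f x‖ₑ ^ p) * M) := by
          rw [lintegral_mul_const'' _ (hf.enorm.pow_const p)]
      _ = (M : ℝ≥0∞) ^ p * ∫⁻ x : E3, ‖f x‖ₑ ^ p := by
          have : (M : ℝ≥0∞) ^ p = (M : ℝ≥0∞) ^ (p - 1) * M := by
            conv_lhs => rw [show p = (p - 1) + 1 by ring]
            rw [ENNReal.rpow_add_of_nonneg _ _ (by linarith) zero_le_one, ENNReal.rpow_one]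
          rw [this]
          ring

end Operator

/-! ### Operators with zonal kernels on the space of square integrable functions -/

section Hilbert

open Polynomial
open scoped ComplexConjugate

variable {f g : E3 → ℂ}

theorem MeasurePreserving.integral_comp_ae {α β : Type*} [MeasurableSpace α] [MeasurableSpace β]
    {μ : Measure α} {μ' : Measure β} {T : α → β} (hT : MeasurePreserving T μ μ') {F : β → ℂ}
    (hF : AEStronglyMeasurable F μ') : ∫ x, F (T x) ∂μ = ∫ y, F y ∂μ' := by
  rw [← hT.map_eq] at hF ⊢
  exact (integral_map hT.aemeasurable hF).symm

/-- The transpose of `sphOp k` has the kernel with exchanged variables. -/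
theorem integral_sphOp_mul {k : S2 → S2 → ℂ} (hk : Continuous (Function.uncurry k)) {p q : ℝ≥0∞}
    [ENNReal.HolderConjugate p q] (hf : MemLp f p volume) (hg : MemLp g q volume) :
    ∫ x, sphOp k f x * g x = ∫ x, f x * sphOp (fun θ η => k η θ) g x := by
  obtain ⟨M, hM0, hM⟩ := exists_bound_ker hk
  have hg' : MemLp (fun y : E3 × S2 => g (‖y.1‖ • (y.2 : E3))) q
      ((volume : Measure E3).prod sphereMeasure) :=
    (hg.comp_fst sphereMeasure).comp_measurePreserving measurePreserving_dirSwap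
  have hfg : Integrable (fun y : E3 × S2 => f y.1 * g (‖y.1‖ • (y.2 : E3)))
      ((volume : Measure E3).prod sphereMeasure) :=
    (hf.comp_fst sphereMeasure).integrable_mul hg'
  have hkm : Measurable fun y : E3 × S2 => k (dirS y.1) y.2 := by
    have h : Measurable fun p : E3 × S2 => (dirS p.1, p.2) := by
      have := measurable_dirS
      fun_prop
    exact hk.measurable.comp h
  have hG : Integrable (fun y : E3 × S2 =>
      f y.1 * g (‖y.1‖ • (y.2 : E3)) * k (dirS y.1) y.2)
      ((volume : Measure E3).prod sphereMeasure) :=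
    hfg.mul_bdd hkm.aestronglyMeasurable (Eventually.of_forall fun y => hM _ _)
  have hH := measurePreserving_dirSwap.integrable_comp_of_integrable hG
  calc ∫ x, sphOp k f x * g x = ∫ x : E3, ∫ θ : S2, f (‖x‖ • (θ : E3)) *
        g (‖‖x‖ • (θ : E3)‖ • (dirS x : E3)) * k (dirS (‖x‖ • (θ : E3))) (dirS x)
          ∂sphereMeasure := by
        refine integral_congr_ae (ae_ne_zero.mono fun x hx => ?_)
        have hx' := norm_pos_iff.2 hx
        simp only [sphOp, dirS_smul hx', norm_smul_S2 hx'.le, coe_dirS, norm_smul_direction]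
        rw [← integral_mul_const]
        congr 1
        funext θ
        ring
    _ = ∫ y : E3 × S2, f (dirSwap y).1 * g (‖(dirSwap y).1‖ • ((dirSwap y).2 : E3)) *
          k (dirS (dirSwap y).1) (dirSwap y).2 ∂((volume : Measure E3).prod sphereMeasure) := by
        exact (integral_prod _ hH).symm
    _ = ∫ y : E3 × S2, f y.1 * g (‖y.1‖ • (y.2 : E3)) * k (dirS y.1) y.2
          ∂((volume : Measure E3).prod sphereMeasure) :=
        MeasurePreserving.integral_comp_ae measurePreserving_dirSwap hG.aestronglyMeasurable
    _ = _ := by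
        rw [integral_prod _ hG]
        congr 1
        funext x
        rw [sphOp, ← integral_const_mul]
        congr 1
        funext θ
        ring

theorem memLp_sphOp {k : S2 → S2 → ℂ} (hk : Continuous (Function.uncurry k)) {r : ℝ≥0∞}
    (hr : 1 ≤ r) (hf : MemLp f r volume) : MemLp (sphOp k f) r volume := by
  obtain ⟨M, hM⟩ := exists_schurKernel hk
  exact ⟨aestronglyMeasurable_sphOp hk hf.1, (hM.eLpNorm_le hr hf.1).trans_lt
    (ENNReal.mul_lt_top ENNReal.coe_lt_top hf.2)⟩

/-- The Fourier multiplier on the sphere with symbol `a`. -/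
abbrev zonOp (a : ℕ →₀ ℝ) (f : E3 → ℂ) : E3 → ℂ := sphOp (polyKer (zon a)) f

theorem memLp_zonOp (a : ℕ →₀ ℝ) {r : ℝ≥0∞} (hr : 1 ≤ r) (hf : MemLp f r volume) :
    MemLp (zonOp a f) r volume := memLp_sphOp (continuous_uncurry_polyKer _) hr hf

theorem zonOp_conj (a : ℕ →₀ ℝ) (f : E3 → ℂ) (x : E3) :
    zonOp a (fun y => conj (f y)) x = conj (zonOp a f x) := by
  unfold zonOp sphOp
  rw [← integral_conj]
  simp [polyKer]

theorem integral_zonOp_mul (a : ℕ →₀ ℝ) {p q : ℝ≥0∞} [ENNReal.HolderConjugate p q]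
    (hf : MemLp f p volume) (hg : MemLp g q volume) :
    ∫ x, zonOp a f x * g x = ∫ x, f x * zonOp a g x := by
  rw [integral_sphOp_mul (continuous_uncurry_polyKer _) hf hg]
  congr 1
  funext x
  congr 2
  funext θ η
  exact polyKer_comm _ _ _

theorem Bump.zonOp_zonOp_apply (ψ : Bump) (a b : ℕ →₀ ℝ) {x : E3} (hx : x ≠ 0)
    (hf : SphereIntegrable f x) : zonOp b (zonOp a f) x = zonOp (a * b) f x := by
  rw [zonOp, sphOp_sphOp hx hf (continuous_uncurry_polyKer _) (continuous_uncurry_polyKer _),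
    ψ.kerComp_zon]

theorem zonOp_add_apply (a b : ℕ →₀ ℝ) {x : E3} (hf : SphereIntegrable f x) :
    zonOp (a + b) f x = zonOp a f x + zonOp b f x := by
  rw [zonOp, zonOp, zonOp, sphOp, sphOp, sphOp, ← integral_add
    (integrable_mul_ker hf (continuous_uncurry_polyKer _) _)
    (integrable_mul_ker hf (continuous_uncurry_polyKer _) _)]
  congr 1
  funext θ
  simp only [polyKer, map_add, eval_add, Complex.ofReal_add]
  ring

theorem zonOp_sub_apply (a b : ℕ →₀ ℝ) {x : E3} (hf : SphereIntegrable f x) :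
    zonOp (a - b) f x = zonOp a f x - zonOp b f x := by
  rw [eq_sub_iff_add_eq, ← zonOp_add_apply _ _ hf, sub_add_cancel]

theorem zonOp_zero (f : E3 → ℂ) (x : E3) : zonOp 0 f x = 0 := by
  simp [zonOp, sphOp, polyKer]

theorem zonOp_sum_apply {ι : Type*} (s : Finset ι) (a : ι → ℕ →₀ ℝ) {x : E3}
    (hf : SphereIntegrable f x) : zonOp (∑ i ∈ s, a i) f x = ∑ i ∈ s, zonOp (a i) f x := by
  classical
  induction s using Finset.induction_on with
  | empty => simp [zonOp_zero]
  | insert i s hi ih => rw [Finset.sum_insert hi, Finset.sum_insert hi, zonOp_add_apply _ _ hf, ih]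

/-- The quadratic form of `zonOp a`. -/
def zonForm (f : E3 → ℂ) (a : ℕ →₀ ℝ) : ℝ := (∫ x, zonOp a f x * conj (f x)).re

theorem MemLp.conj {r : ℝ≥0∞} (hf : MemLp f r volume) : MemLp (fun x => conj (f x)) r volume :=
  hf.star

theorem integrable_zonOp_mul_conj (a : ℕ →₀ ℝ) (hf : MemLp f 2 volume) :
    Integrable (fun x => zonOp a f x * conj (f x)) volume :=
  (memLp_zonOp a one_le_two hf).integrable_mul (MemLp.conj hf)

theorem zonForm_add (a b : ℕ →₀ ℝ) (hf : MemLp f 2 volume) :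
    zonForm f (a + b) = zonForm f a + zonForm f b := by
  rw [zonForm, zonForm, zonForm, ← Complex.add_re, ← integral_add
    (integrable_zonOp_mul_conj a hf) (integrable_zonOp_mul_conj b hf)]
  congr 1
  refine integral_congr_ae ?_
  filter_upwards [MemLp.ae_sphereIntegrable one_le_two hf] with x hx
  rw [zonOp_add_apply _ _ hx, add_mul]

theorem zonForm_zero : zonForm f 0 = 0 := by simp [zonForm, zonOp_zero]

theorem zonForm_sum {ι : Type*} (s : Finset ι) (a : ι → ℕ →₀ ℝ) (hf : MemLp f 2 volume) :
    zonForm f (∑ i ∈ s, a i) = ∑ i ∈ s, zonForm f (a i) := by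
  classical
  induction s using Finset.induction_on with
  | empty => simp [zonForm_zero]
  | insert i s hi ih => rw [Finset.sum_insert hi, Finset.sum_insert hi, zonForm_add _ _ hf, ih]

theorem Bump.integral_norm_sq_zonOp (ψ : Bump) (a : ℕ →₀ ℝ) (hf : MemLp f 2 volume) :
    ∫ x, ‖zonOp a f x‖ ^ 2 = zonForm f (a * a) := by
  have h := integral_zonOp_mul a (memLp_zonOp a one_le_two hf) (MemLp.conj hf)
  have e1 : ∫ x, zonOp a (zonOp a f) x * conj (f x) = ∫ x, zonOp (a * a) f x * conj (f x) := by
    refine integral_congr_ae ?_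
    filter_upwards [MemLp.ae_sphereIntegrable one_le_two hf, ae_ne_zero] with x hx h0
    rw [ψ.zonOp_zonOp_apply a a h0 hx]
  have e2 : ∫ x, zonOp a f x * zonOp a (fun y => conj (f y)) x =
      ((∫ x, ‖zonOp a f x‖ ^ 2 : ℝ) : ℂ) := by
    rw [← integral_complex_ofReal]
    congr 1
    funext x
    rw [zonOp_conj, Complex.mul_conj, Complex.normSq_eq_norm_sq]
  rw [zonForm, ← e1, h, e2, Complex.ofReal_re]

/-- A nonnegative symbol is the square of another one, so that the form is a norm squared. -/
theorem Bump.zonForm_nonneg (ψ : Bump) {a : ℕ →₀ ℝ} (ha : ∀ n, 0 ≤ a n) (hf : MemLp f 2 volume) :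
    0 ≤ zonForm f a := by
  have e : a = a.mapRange Real.sqrt Real.sqrt_zero * a.mapRange Real.sqrt Real.sqrt_zero := by
    ext n
    simp [Real.mul_self_sqrt (ha n)]
  rw [e, ← ψ.integral_norm_sq_zonOp _ hf]
  positivity

theorem Bump.zonForm_mono (ψ : Bump) {a b : ℕ →₀ ℝ} (hab : ∀ n, a n ≤ b n)
    (hf : MemLp f 2 volume) : zonForm f a ≤ zonForm f b := by
  have h := ψ.zonForm_nonneg (a := b - a) (fun n => sub_nonneg.2 (hab n)) hf
  rw [← sub_add_cancel b a, zonForm_add _ _ hf]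
  linarith

/-- A multiplier with symbol at most `1` is dominated by a spectral projection, which is a
contraction. -/
theorem Bump.zonForm_le (ψ : Bump) {a : ℕ →₀ ℝ} (ha : ∀ n, a n ≤ 1) (hf : MemLp f 2 volume) :
    zonForm f a ≤ ∫ x, ‖f x‖ ^ 2 := by
  -- `b` is idempotent and dominates `a`.
  set b : ℕ →₀ ℝ := Finsupp.indicator a.support fun _ _ => 1
  have hb : ∀ n, b n = if n ∈ a.support then 1 else 0 := fun n => by
    simp [b, Finsupp.indicator_apply]
  have hbb : b * b = b := by
    ext n
    rw [Finsupp.mul_apply, hb]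
    split_ifs <;> norm_num
  have hab : zonForm f a ≤ zonForm f b := ψ.zonForm_mono (fun n => by
    rw [hb]
    split_ifs with h
    · exact ha n
    · rw [Finsupp.notMem_support_iff.1 h]) hf
  have h1 := ψ.integral_norm_sq_zonOp b hf
  rw [hbb] at h1
  have hfi : Integrable (fun x => ‖f x‖ ^ 2) volume := hf.integrable_norm_pow two_ne_zero
  have hbi : Integrable (fun x => ‖zonOp b f x‖ ^ 2) volume :=
    (memLp_zonOp b one_le_two hf).integrable_norm_pow two_ne_zero
  have h2 : zonForm f b ≤ ∫ x, (‖zonOp b f x‖ ^ 2 + ‖f x‖ ^ 2) / 2 := by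
    rw [zonForm, ← RCLike.re_eq_complex_re, ← integral_re (integrable_zonOp_mul_conj b hf)]
    refine integral_mono (integrable_zonOp_mul_conj b hf).re ((hbi.add hfi).div_const 2)
      fun x => ?_
    have h3 : RCLike.re (zonOp b f x * conj (f x)) ≤ ‖zonOp b f x‖ * ‖f x‖ := by
      refine (RCLike.re_le_norm _).trans (le_of_eq ?_)
      rw [norm_mul, RCLike.norm_conj]
    have := two_mul_le_add_sq ‖zonOp b f x‖ ‖f x‖
    simp only
    linarith
  rw [integral_div, integral_add hbi hfi, h1] at h2
  linarith

theorem MemLp.eLpNorm_two_sq (hf : MemLp f 2 volume) :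
    eLpNorm f 2 volume ^ 2 = ENNReal.ofReal (∫ x, ‖f x‖ ^ 2) := by
  have hfi : Integrable (fun x => ‖f x‖ ^ 2) volume := hf.integrable_norm_pow two_ne_zero
  rw [ofReal_integral_eq_lintegral_ofReal hfi (Eventually.of_forall fun x => by positivity),
    eLpNorm_eq_lintegral_rpow_enorm_toReal two_ne_zero ENNReal.ofNat_ne_top, ← ENNReal.rpow_two,
    ← ENNReal.rpow_mul]
  simp [ENNReal.ofReal_pow, ofReal_norm]

theorem Bump.eLpNorm_zonOp_sq (ψ : Bump) (a : ℕ →₀ ℝ) (hf : MemLp f 2 volume) :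
    eLpNorm (zonOp a f) 2 volume ^ 2 = ENNReal.ofReal (zonForm f (a * a)) := by
  rw [MemLp.eLpNorm_two_sq (memLp_zonOp a one_le_two hf), ψ.integral_norm_sq_zonOp a hf]

/-- The square of this norm is the quadratic form of the squared symbol, which is monotone. -/
theorem Bump.eLpNorm_zonOp_mono (ψ : Bump) {a b : ℕ →₀ ℝ} (hab : ∀ n, |a n| ≤ |b n|)
    (hf : MemLp f 2 volume) : eLpNorm (zonOp a f) 2 volume ≤ eLpNorm (zonOp b f) 2 volume := by
  rw [← ENNReal.pow_le_pow_left_iff two_ne_zero, ψ.eLpNorm_zonOp_sq a hf, ψ.eLpNorm_zonOp_sq b hf]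
  refine ENNReal.ofReal_le_ofReal (ψ.zonForm_mono (fun n => ?_) hf)
  rw [Finsupp.mul_apply, Finsupp.mul_apply]
  exact abs_le_iff_mul_self_le.1 (hab n)

theorem Bump.eLpNorm_zonOp_le (ψ : Bump) {a : ℕ →₀ ℝ} (ha : ∀ n, |a n| ≤ 1)
    (hf : MemLp f 2 volume) : eLpNorm (zonOp a f) 2 volume ≤ eLpNorm f 2 volume := by
  rw [← ENNReal.pow_le_pow_left_iff two_ne_zero, ψ.eLpNorm_zonOp_sq a hf, MemLp.eLpNorm_two_sq hf]
  refine ENNReal.ofReal_le_ofReal (ψ.zonForm_le (fun n => ?_) hf)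
  rw [Finsupp.mul_apply, ← abs_mul_abs_self]
  exact mul_le_one₀ (ha n) (abs_nonneg _) (ha n)

end Hilbert

/-! ### The angular Littlewood-Paley projectors as spherical multipliers -/

section Projectors

open Polynomial

variable {f g : E3 → ℂ} {x : E3}

theorem SchurKernel.mono {k : S2 → S2 → ℂ} {M M' : ℝ≥0} (h : SchurKernel k M) (hM : M ≤ M') :
    SchurKernel k M' :=
  ⟨h.cont, fun η => (h.left η).trans (by gcongr), fun θ => (h.right θ).trans (by gcongr)⟩

theorem SymBound.schurKernel {a : ℕ →₀ ℝ} {A : ℝ} {B N : ℕ} (h : SymBound a A B N) :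
    SchurKernel (polyKer (zon a)) (2 * A ^ 2 * (B + 2) ^ 2 + 4).toNNReal := by
  refine SchurKernel.of_integral (continuous_uncurry_polyKer _) (fun η => ?_) fun θ => ?_
  · simp_rw [norm_polyKer]
    exact h.integral_abs_le η
  · simp_rw [polyKer_comm _ θ, norm_polyKer]
    exact h.integral_abs_le θ

/-- The multiplier symbol of `R̄_{≤ l}`. -/
abbrev Bump.low (ψ : Bump) (l : ℤ) : ℕ →₀ ℝ := mult ψ.toFun l

/-- The multiplier symbol of `R̄_l`. -/
abbrev Bump.band (ψ : Bump) (l : ℤ) : ℕ →₀ ℝ := mult ψ.phi l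

variable (ψ : Bump)

theorem Bump.low_apply (l : ℤ) (n : ℕ) : ψ.low l n = ψ.toFun ((2 : ℝ) ^ (-l) * n) :=
  mult_apply (fun _ hx => ψ.eq_zero_of_two_lt hx) l n

theorem Bump.band_apply (l : ℤ) (n : ℕ) : ψ.band l n = ψ.phi ((2 : ℝ) ^ (-l) * n) :=
  mult_apply (fun _ hx => ψ.phi_eq_zero_of_two_lt hx) l n

theorem Bump.R_eq (l : ℤ) (hf : SphereIntegrable f x) : ψ.R l f x = zonOp (ψ.band l) f x :=
  angMult_eq (fun _ hx => ψ.phi_eq_zero_of_two_lt hx) l hf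

theorem Bump.Rle_eq (l : ℤ) (hf : SphereIntegrable f x) : ψ.Rle l f x = zonOp (ψ.low l) f x :=
  angMult_eq (fun _ hx => ψ.eq_zero_of_two_lt hx) l hf

theorem Bump.low_add_band (l : ℤ) : ψ.low l + ψ.band (l + 1) = ψ.low (l + 1) := by
  ext n
  rw [Finsupp.add_apply, ψ.low_apply, ψ.low_apply, ψ.band_apply, Bump.phi, ← mul_assoc,
    show (2 : ℝ) * 2 ^ (-(l + 1)) = 2 ^ (-l) by
      rw [← zpow_one_add₀ two_ne_zero]; congr 1; ring]
  ring

theorem Bump.low_add_sum_band (L : ℕ) :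
    ψ.low (-1) + ∑ l ∈ Finset.range L, ψ.band l = ψ.low ((L : ℤ) - 1) := by
  induction L with
  | zero => simp
  | succ L ih =>
    rw [Finset.sum_range_succ, ← add_assoc, ih]
    have h := ψ.low_add_band ((L : ℤ) - 1)
    rw [sub_add_cancel] at h
    rw [h]
    congr 1
    push_cast
    ring

theorem Bump.low_nonneg (l : ℤ) (n : ℕ) : 0 ≤ ψ.low l n := by
  rw [ψ.low_apply]; exact (ψ.mem_Icc _).1

theorem Bump.low_le_one (l : ℤ) (n : ℕ) : ψ.low l n ≤ 1 := by
  rw [ψ.low_apply]; exact (ψ.mem_Icc _).2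

theorem Bump.band_nonneg (l : ℤ) (n : ℕ) : 0 ≤ ψ.band l n := by
  rw [ψ.band_apply]; exact ψ.phi_nonneg (by positivity)

theorem Bump.low_add_sum_band_le_one (s : Finset ℕ) (n : ℕ) :
    ψ.low (-1) n + ∑ l ∈ s, ψ.band l n ≤ 1 := by
  obtain ⟨L, hL⟩ := s.exists_nat_subset_range
  refine le_trans ?_ (ψ.low_le_one ((L : ℤ) - 1) n)
  rw [← ψ.low_add_sum_band, Finsupp.add_apply, Finsupp.finsetSum_apply]
  gcongr
  exact fun _ _ _ => ψ.band_nonneg _ _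

theorem Bump.lt_of_band_ne_zero {l : ℤ} {n : ℕ} (h : ψ.band l n ≠ 0) :
    2 / 5 * (2 : ℝ) ^ l < n ∧ (n : ℝ) ≤ 8 / 5 * (2 : ℝ) ^ l := by
  rw [ψ.band_apply] at h
  have h2 : (0 : ℝ) < 2 ^ l := by positivity
  have h0 : (0 : ℝ) ≤ 2 ^ (-l) * n := by positivity
  have e : (n : ℝ) = 2 ^ (-l) * n * 2 ^ l := by
    rw [mul_right_comm, ← zpow_add₀ two_ne_zero, neg_add_cancel, zpow_zero, one_mul]
  constructor
  · have h1 : 2 / 5 < (2 : ℝ) ^ (-l) * n := by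
      by_contra hc
      exact h (ψ.phi_eq_zero_of_le (by rw [abs_of_nonneg h0]; exact not_lt.1 hc))
    rw [e]
    gcongr
  · have h1 : (2 : ℝ) ^ (-l) * n ≤ 8 / 5 := by
      by_contra hc
      exact h (ψ.phi_eq_zero (by rw [abs_of_nonneg h0]; exact not_le.1 hc))
    rw [e]
    gcongr

/-- The support of `n ↦ φ(2^{-l} n)` contains no integer when `l < 0`. -/
theorem Bump.band_of_neg {l : ℤ} (hl : l < 0) : ψ.band l = 0 := by
  ext n
  by_contra h
  obtain ⟨h1, h2⟩ := ψ.lt_of_band_ne_zero h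
  have h3 : (2 : ℝ) ^ l ≤ 2 ^ (-1 : ℤ) := zpow_le_zpow_right₀ one_le_two (by omega)
  rw [zpow_neg_one] at h3
  have h4 : (n : ℝ) < (1 : ℕ) := by push_cast; linarith
  have h5 : n = 0 := by have : n < 1 := by exact_mod_cast h4
                        omega
  have h6 : (0 : ℝ) < 2 ^ l := by positivity
  rw [h5, Nat.cast_zero] at h1
  linarith

/-- All cutoffs at a negative scale are the projection to radial functions. -/
theorem Bump.low_of_neg {l : ℤ} (hl : l < 0) : ψ.low l = ψ.low (-1) := by
  obtain ⟨m, hm⟩ : ∃ m : ℕ, l = -1 - m := ⟨(-1 - l).toNat, by omega⟩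
  subst hm
  clear hl
  induction m with
  | zero => simp
  | succ m ih =>
    have h := ψ.low_add_band (-1 - ((m + 1 : ℕ) : ℤ))
    rw [ψ.band_of_neg (by push_cast; omega), add_zero] at h
    rw [h, ← ih]
    congr 1
    push_cast
    ring

theorem Bump.R_of_neg {l : ℤ} (hl : l < 0) (f : E3 → ℂ) : ψ.R l f = 0 := by
  funext x
  rw [Bump.R, angMult]
  simp_rw [← ψ.band_apply, ψ.band_of_neg hl]
  simp

theorem Bump.exists_schurKernel_band : ∃ M, ∀ l : ℤ, SchurKernel (polyKer (zon (ψ.band l))) M := by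
  obtain ⟨A, hA⟩ := ψ.exists_symBound_phi
  refine ⟨(2 * A ^ 2 * ((2 : ℕ) + 2) ^ 2 + 4).toNNReal, fun l => ?_⟩
  rcases lt_or_ge l 0 with hl | hl
  · rw [ψ.band_of_neg hl]
    have h0 : SchurKernel (polyKer (zon 0)) 0 :=
      ⟨continuous_uncurry_polyKer _, by simp [polyKer], by simp [polyKer]⟩
    exact h0.mono zero_le
  · lift l to ℕ using hl
    exact (hA l).schurKernel

theorem Bump.exists_schurKernel_low : ∃ M, ∀ l : ℤ, SchurKernel (polyKer (zon (ψ.low l))) M := by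
  obtain ⟨A, hA⟩ := ψ.exists_symBound
  obtain ⟨M, hM⟩ := exists_schurKernel (continuous_uncurry_polyKer (zon (ψ.low (-1))))
  refine ⟨max M (2 * A ^ 2 * ((2 : ℕ) + 2) ^ 2 + 4).toNNReal, fun l => ?_⟩
  rcases lt_or_ge l 0 with hl | hl
  · rw [ψ.low_of_neg hl]
    exact hM.mono (le_max_left _ _)
  · lift l to ℕ using hl
    exact (hA l).schurKernel.mono (le_max_right _ _)

theorem Bump.R_ae_eq (l : ℤ) {r : ℝ≥0∞} (hr : 1 ≤ r) (hf : MemLp f r volume) :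
    ψ.R l f =ᵐ[volume] zonOp (ψ.band l) f := by
  filter_upwards [MemLp.ae_sphereIntegrable hr hf] with x hx using ψ.R_eq l hx

theorem Bump.Rle_ae_eq (l : ℤ) {r : ℝ≥0∞} (hr : 1 ≤ r) (hf : MemLp f r volume) :
    ψ.Rle l f =ᵐ[volume] zonOp (ψ.low l) f := by
  filter_upwards [MemLp.ae_sphereIntegrable hr hf] with x hx using ψ.Rle_eq l hx

theorem Bump.memLp_R (l : ℤ) {r : ℝ≥0∞} (hr : 1 ≤ r) (hf : MemLp f r volume) :
    MemLp (ψ.R l f) r volume :=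
  (memLp_zonOp _ hr hf).ae_eq (ψ.R_ae_eq l hr hf).symm

theorem Bump.memLp_Rle (l : ℤ) {r : ℝ≥0∞} (hr : 1 ≤ r) (hf : MemLp f r volume) :
    MemLp (ψ.Rle l f) r volume :=
  (memLp_zonOp _ hr hf).ae_eq (ψ.Rle_ae_eq l hr hf).symm

theorem Bump.exists_eLpNorm_R_add_Rle_le : ∃ C : ℝ≥0, ∀ (l : ℤ) (r : ℝ≥0∞), 1 ≤ r →
    ∀ f : E3 → ℂ, MemLp f r volume → MemLp (ψ.R l f) r volume ∧ MemLp (ψ.Rle l f) r volume ∧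
      eLpNorm (ψ.R l f) r volume + eLpNorm (ψ.Rle l f) r volume ≤ C * eLpNorm f r volume := by
  obtain ⟨M, hM⟩ := ψ.exists_schurKernel_band
  obtain ⟨M', hM'⟩ := ψ.exists_schurKernel_low
  refine ⟨M + M', fun l r hr f hf => ⟨ψ.memLp_R l hr hf, ψ.memLp_Rle l hr hf, ?_⟩⟩
  rw [eLpNorm_congr_ae (ψ.R_ae_eq l hr hf), eLpNorm_congr_ae (ψ.Rle_ae_eq l hr hf),
    ENNReal.coe_add, add_mul]
  exact add_le_add ((hM l).eLpNorm_le hr hf.1) ((hM' l).eLpNorm_le hr hf.1)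

/-! ### Almost orthogonality -/

theorem angMult_congr_ae_sphere (χ : ℝ → ℝ) (l : ℤ)
    (h : ∀ᵐ θ : S2 ∂sphereMeasure, f (‖x‖ • (θ : E3)) = g (‖x‖ • (θ : E3))) :
    angMult χ l f x = angMult χ l g x := by
  refine tsum_congr fun n => ?_
  congr 1
  exact integral_congr_ae (h.mono fun θ hθ => by simp only [hθ])

theorem Bump.band_mul_band {l l' : ℤ} (h : 4 ≤ |l - l'|) : ψ.band l * ψ.band l' = 0 := by
  wlog hl : l' + 4 ≤ l generalizing l l'
  · rw [mul_comm]
    refine this (by rwa [abs_sub_comm]) ?_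
    rcases le_abs.1 h with h1 | h1 <;> omega
  ext n
  rw [Finsupp.mul_apply, Finsupp.zero_apply]
  by_contra hc
  obtain ⟨h1, -⟩ := ψ.lt_of_band_ne_zero (left_ne_zero_of_mul hc)
  obtain ⟨-, h2⟩ := ψ.lt_of_band_ne_zero (right_ne_zero_of_mul hc)
  have h3 : (2 : ℝ) ^ (l' + 4) ≤ 2 ^ l := zpow_le_zpow_right₀ one_le_two hl
  rw [zpow_add₀ two_ne_zero] at h3
  norm_num at h3
  have h4 : (0 : ℝ) < 2 ^ l' := by positivity
  linarith

theorem Bump.R_R_ae_eq_zero {l l' : ℤ} (h : 4 ≤ |l - l'|) (hf : LocallyIntegrable f volume) :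
    ψ.R l (ψ.R l' f) =ᵐ[volume] 0 := by
  have h1 := sphereIntegrable_of_locallyIntegrable hf
  filter_upwards [h1, ae_sphere_of_ae (h1.mono fun x hx => ψ.R_eq l' hx), ae_ne_zero]
    with x hx hx1 h0
  have e : ψ.R l (ψ.R l' f) x = ψ.R l (zonOp (ψ.band l') f) x :=
    angMult_congr_ae_sphere _ _ hx1
  rw [e, ψ.R_eq l (sphereIntegrable_sphOp h0 hx (continuous_uncurry_polyKer _)),
    ψ.zonOp_zonOp_apply _ _ h0 hx, mul_comm, ψ.band_mul_band h, zonOp_zero, Pi.zero_apply]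

/-- Three bands interact only if each is dominated by the sum of the other two. -/
theorem Bump.integral_band_mul_band_mul_band {l l₁ l₂ : ℤ}
    (h : med l l₁ l₂ + 4 ≤ max l (max l₁ l₂)) (θ θ' η : S2) :
    ∫ σ : S2, (zon (ψ.band l₁)).eval (dot σ θ) * (zon (ψ.band l₂)).eval (dot σ θ') *
      (zon (ψ.band l)).eval (dot σ η) ∂sphereMeasure = 0 := by
  have key : ∀ (i j k : ℤ), i + 4 ≤ k → j + 4 ≤ k → ∀ θ θ' η : S2,
      ∫ σ : S2, (zon (ψ.band i)).eval (dot σ θ) * (zon (ψ.band j)).eval (dot σ θ') *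
        (zon (ψ.band k)).eval (dot σ η) ∂sphereMeasure = 0 := by
    intro i j k hi hj θ θ' η
    refine integral_zon_mul_zon_mul_zon (D := ⌊8 / 5 * (2 : ℝ) ^ i⌋₊)
      (D' := ⌊8 / 5 * (2 : ℝ) ^ j⌋₊) (fun n hn => Nat.le_floor (ψ.lt_of_band_ne_zero hn).2)
      (fun n hn => Nat.le_floor (ψ.lt_of_band_ne_zero hn).2) (fun n hn => ?_) θ θ' η
    have h1 := (ψ.lt_of_band_ne_zero hn).1
    have h2 := Nat.floor_le (by positivity : 0 ≤ 8 / 5 * (2 : ℝ) ^ i)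
    have h3 := Nat.floor_le (by positivity : 0 ≤ 8 / 5 * (2 : ℝ) ^ j)
    have h4 : (2 : ℝ) ^ (i + 4) ≤ 2 ^ k := zpow_le_zpow_right₀ one_le_two hi
    have h5 : (2 : ℝ) ^ (j + 4) ≤ 2 ^ k := zpow_le_zpow_right₀ one_le_two hj
    rw [zpow_add₀ two_ne_zero] at h4 h5
    norm_num at h4 h5
    have h6 : (0 : ℝ) < 2 ^ i := by positivity
    have h7 : (0 : ℝ) < 2 ^ j := by positivity
    have h8 : ((⌊8 / 5 * (2 : ℝ) ^ i⌋₊ + ⌊8 / 5 * (2 : ℝ) ^ j⌋₊ : ℕ) : ℝ) < n := by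
      push_cast
      linarith
    exact_mod_cast h8
  rw [med] at h
  have h' : (l₁ + 4 ≤ l ∧ l₂ + 4 ≤ l) ∨ (l + 4 ≤ l₁ ∧ l₂ + 4 ≤ l₁) ∨
      (l + 4 ≤ l₂ ∧ l₁ + 4 ≤ l₂) := by omega
  rcases h' with ⟨h1, h2⟩ | ⟨h1, h2⟩ | ⟨h1, h2⟩
  · exact key l₁ l₂ l h1 h2 θ θ' η
  · rw [← key l₂ l l₁ h2 h1 θ' η θ]
    congr 1
    funext σ
    ring
  · rw [← key l₁ l l₂ h2 h1 θ η θ']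
    congr 1
    funext σ
    ring

theorem Bump.R_mul_R_ae_eq_zero {l l₁ l₂ : ℤ} (h : med l l₁ l₂ + 4 ≤ max l (max l₁ l₂))
    (hf : LocallyIntegrable f volume) (hg : LocallyIntegrable g volume) :
    ψ.R l (fun x => ψ.R l₁ f x * ψ.R l₂ g x) =ᵐ[volume] 0 := by
  have h1 := sphereIntegrable_of_locallyIntegrable hf
  have h2 := sphereIntegrable_of_locallyIntegrable hg
  filter_upwards [h1, h2, ae_sphere_of_ae (h1.mono fun x hx => ψ.R_eq l₁ hx),
    ae_sphere_of_ae (h2.mono fun x hx => ψ.R_eq l₂ hx), ae_ne_zero] with x hx hy hx1 hy1 h0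
  set F : S2 → ℂ := fun θ => f (‖x‖ • (θ : E3)) with hF
  set G : S2 → ℂ := fun θ => g (‖x‖ • (θ : E3)) with hG
  have hk := fun a => continuous_uncurry_polyKer (zon a)
  have e : ψ.R l (fun x => ψ.R l₁ f x * ψ.R l₂ g x) x =
      ψ.R l (fun x => zonOp (ψ.band l₁) f x * zonOp (ψ.band l₂) g x) x := by
    refine angMult_congr_ae_sphere _ _ ?_
    filter_upwards [hx1, hy1] with θ h3 h4
    rw [h3, h4]
  have e1 : (fun θ : S2 => zonOp (ψ.band l₁) f (‖x‖ • (θ : E3)) *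
      zonOp (ψ.band l₂) g (‖x‖ • (θ : E3))) =
      fun θ => sphConv (polyKer (zon (ψ.band l₁))) F θ * sphConv (polyKer (zon (ψ.band l₂))) G θ :=
    funext fun θ => by
      rw [zonOp, zonOp, sphOp_smul _ _ (norm_pos_iff.2 h0), sphOp_smul _ _ (norm_pos_iff.2 h0)]
  have hi : SphereIntegrable (fun x => zonOp (ψ.band l₁) f x * zonOp (ψ.band l₂) g x) x := by
    rw [SphereIntegrable, e1]
    exact integrable_sphere ((continuous_sphConv hx (hk _)).mul (continuous_sphConv hy (hk _)))
  rw [e, ψ.R_eq l hi, zonOp, sphOp_eq, e1, sphConv, Pi.zero_apply]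
  set η := dirS x
  -- The product of the two factors at `σ` is an integral over pairs of points; the integral in `σ`
  -- against the third kernel is then the one of `integral_band_mul_band_mul_band`.
  have hw : Integrable (fun p : S2 × S2 => F p.1 * G p.2) (sphereMeasure.prod sphereMeasure) :=
    Integrable.mul_prod hx hy
  have hkk : Continuous (Function.uncurry fun (p : S2 × S2) (σ : S2) =>
      polyKer (zon (ψ.band l₁)) p.1 σ * polyKer (zon (ψ.band l₂)) p.2 σ) := by
    unfold Function.uncurry
    fun_prop
  have e2 : ∀ σ, sphConv (polyKer (zon (ψ.band l₁))) F σ * sphConv (polyKer (zon (ψ.band l₂))) G σ =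
      ∫ p : S2 × S2, F p.1 * G p.2 *
        (polyKer (zon (ψ.band l₁)) p.1 σ * polyKer (zon (ψ.band l₂)) p.2 σ)
          ∂(sphereMeasure.prod sphereMeasure) := fun σ => by
    rw [sphConv, sphConv, ← integral_prod_mul]
    congr 1
    funext p
    ring
  simp_rw [e2]
  have hm : Continuous fun σ : S2 => polyKer (zon (ψ.band l)) σ η := by fun_prop
  rw [integral_mul_ker_swap hw hkk hm]
  refine integral_eq_zero_of_ae (Eventually.of_forall fun p => ?_)
  have h3 := ψ.integral_band_mul_band_mul_band h p.1 p.2 η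
  have h4 : ∫ σ, polyKer (zon (ψ.band l₁)) p.1 σ * polyKer (zon (ψ.band l₂)) p.2 σ *
      polyKer (zon (ψ.band l)) σ η ∂sphereMeasure = 0 := by
    rw [← Complex.ofReal_zero, ← h3, ← integral_complex_ofReal]
    congr 1
    funext σ
    rw [polyKer, polyKer, polyKer, dot_comm p.1, dot_comm p.2]
    push_cast
    rfl
  simp only [h4, mul_zero, Pi.zero_apply]

end Projectors

/-! ### Convergence of the decomposition in `L²` -/

section Convergence

open Polynomial

variable (ψ : Bump) {f g : E3 → ℂ}

theorem SchurKernel.norm_sphConv_le {k : S2 → S2 → ℂ} {M : ℝ≥0} (h : SchurKernel k M) {F : S2 → ℂ}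
    {S : ℝ} (hF : ∀ θ, ‖F θ‖ ≤ S) (η : S2) : ‖sphConv k F η‖ ≤ M * S := by
  have hS : 0 ≤ S := (norm_nonneg _).trans (hF η)
  have hk : Continuous fun θ => k θ η := h.cont.comp (by fun_prop : Continuous fun θ : S2 => (θ, η))
  have hi : Integrable (fun θ => ‖k θ η‖ * S) sphereMeasure := integrable_sphere (by fun_prop)
  have h1 : ∫ θ, ‖k θ η‖ ∂sphereMeasure ≤ M := by
    have h2 := h.left η
    rw [← ofReal_integral_norm_eq_lintegral_enorm (integrable_sphere hk)] at h2
    have h3 := ENNReal.toReal_mono ENNReal.coe_ne_top h2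
    rwa [ENNReal.toReal_ofReal (by positivity), ENNReal.coe_toReal] at h3
  refine (norm_integral_le_of_norm_le hi (Eventually.of_forall fun θ => ?_)).trans ?_
  · rw [norm_mul, mul_comm]
    gcongr
    exact hF θ
  · rw [integral_mul_const]
    gcongr

/-- Pointwise convergence is the approximate identity on each sphere; the uniform `L¹` bound of the
kernels provides the dominating function. -/
theorem Bump.tendsto_eLpNorm_sub_low_of_continuous (hg : Continuous g) (hgc : HasCompactSupport g) :
    Tendsto (fun L : ℕ => eLpNorm (g - zonOp (ψ.low L) g) 2 volume) atTop (𝓝 0) := by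
  obtain ⟨M, hM⟩ := ψ.exists_schurKernel_low
  obtain ⟨S, hS⟩ := hgc.exists_bound_of_continuous hg
  have hS0 : 0 ≤ S := (norm_nonneg _).trans (hS 0)
  obtain ⟨ρ, hρ⟩ := hgc.isBounded.subset_closedBall (0 : E3)
  have hg2 : MemLp g 2 volume := hg.memLp_of_hasCompactSupport hgc
  have h2 : ∀ L : ℕ, MemLp (g - zonOp (ψ.low L) g) 2 volume := fun L =>
    hg2.sub (memLp_zonOp _ one_le_two hg2)
  have hz : ∀ x, x ∉ Metric.closedBall (0 : E3) ρ → g x = 0 := fun x hx =>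
    image_eq_zero_of_notMem_tsupport fun h => hx (hρ h)
  have hlim : Tendsto (fun L : ℕ => ∫ x, ‖(g - zonOp (ψ.low L) g) x‖ ^ 2) atTop
      (𝓝 (∫ _ : E3, (0 : ℝ))) := by
    refine tendsto_integral_of_dominated_convergence
      (fun x => (Metric.closedBall (0 : E3) ρ).indicator (fun _ => (S + M * S) ^ 2) x)
      (fun L => ((h2 L).1.norm.pow 2)) ?_ (fun L => Eventually.of_forall fun x => ?_) ?_
    · exact (integrable_indicator_iff Metric.isClosed_closedBall.measurableSet).2
        (integrableOn_const (isCompact_closedBall _ _).measure_lt_top.ne)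
    · rw [norm_pow, norm_norm]
      by_cases hx : x ∈ Metric.closedBall (0 : E3) ρ
      · rw [Set.indicator_of_mem hx]
        gcongr
        refine (norm_sub_le _ _).trans (add_le_add (hS x) ?_)
        exact (hM L).norm_sphConv_le (fun θ => hS _) _
      · rw [Set.indicator_of_notMem hx, Pi.sub_apply, hz x hx, zonOp, sphOp]
        have : ∀ θ : S2, g (‖x‖ • (θ : E3)) = 0 := fun θ => hz _ (by
          rwa [mem_closedBall_zero_iff, norm_smul_S2 (norm_nonneg x), ← mem_closedBall_zero_iff])
        simp [this]
    · filter_upwards with x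
      have h3 := ψ.tendsto_integral_zon
        (hg.comp (by fun_prop : Continuous fun θ : S2 => ‖x‖ • (θ : E3))) (dirS x)
      have h4 := (tendsto_const_nhds (x := g x)).sub h3
      rw [Function.comp_apply, coe_dirS, norm_smul_direction, sub_self] at h4
      have h5 := (h4.norm).pow 2
      rw [norm_zero, zero_pow two_ne_zero] at h5
      exact h5
  rw [integral_zero] at hlim
  have h6 := ENNReal.tendsto_ofReal hlim
  rw [ENNReal.ofReal_zero] at h6
  have h7 := h6.ennrpow_const (1 / 2)
  rw [ENNReal.zero_rpow_of_pos (by norm_num)] at h7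
  refine h7.congr fun L => ?_
  rw [← MemLp.eLpNorm_two_sq (h2 L), ← ENNReal.rpow_two, ← ENNReal.rpow_mul]
  norm_num

theorem Bump.abs_low_le_one (l : ℤ) (n : ℕ) : |ψ.low l n| ≤ 1 := by
  rw [abs_of_nonneg (ψ.low_nonneg l n)]
  exact ψ.low_le_one l n

theorem zonOp_sub_ae_eq (a b : ℕ →₀ ℝ) (hf : MemLp f 2 volume) :
    zonOp (a - b) f =ᵐ[volume] zonOp a f - zonOp b f := by
  filter_upwards [MemLp.ae_sphereIntegrable one_le_two hf] with x hx using zonOp_sub_apply _ _ hx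

theorem zonOp_sub_fun_ae_eq (a : ℕ →₀ ℝ) (hf : MemLp f 2 volume) (hg : MemLp g 2 volume) :
    zonOp a (f - g) =ᵐ[volume] zonOp a f - zonOp a g := by
  filter_upwards [MemLp.ae_sphereIntegrable one_le_two hf,
    MemLp.ae_sphereIntegrable one_le_two hg] with x hx hy
  rw [Pi.sub_apply, zonOp, zonOp, zonOp, sphOp, sphOp, sphOp, ← integral_sub
    (integrable_mul_ker hx (continuous_uncurry_polyKer _) _)
    (integrable_mul_ker hy (continuous_uncurry_polyKer _) _)]
  congr 1
  funext θ
  rw [Pi.sub_apply, sub_mul]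

/-- By density of the continuous functions of compact support and the uniform boundedness of the
cutoffs on `L²`. -/
theorem Bump.tendsto_eLpNorm_sub_low (hf : MemLp f 2 volume) :
    Tendsto (fun L : ℕ => eLpNorm (f - zonOp (ψ.low L) f) 2 volume) atTop (𝓝 0) := by
  rw [ENNReal.tendsto_atTop_zero]
  intro ε hε
  have hε3 : ε / 3 ≠ 0 := (ENNReal.div_pos hε.ne' (by norm_num)).ne'
  obtain ⟨g, hgc, hfg, hg, hg2⟩ := hf.exists_hasCompactSupport_eLpNorm_sub_le
    ENNReal.ofNat_ne_top hε3
  obtain ⟨L0, hL0⟩ := ENNReal.tendsto_atTop_zero.1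
    (ψ.tendsto_eLpNorm_sub_low_of_continuous hg hgc) (ε / 3) (pos_iff_ne_zero.2 hε3)
  refine ⟨L0, fun L hL => ?_⟩
  set T := zonOp (ψ.low L)
  have e : f - T f =ᵐ[volume] (f - g) + (g - T g) - T (f - g) := by
    filter_upwards [zonOp_sub_fun_ae_eq (ψ.low L) hf hg2] with x hx
    simp only [Pi.sub_apply, Pi.add_apply, T] at hx ⊢
    rw [hx]
    ring
  have m1 : MemLp (f - g) 2 volume := hf.sub hg2
  have m2 : MemLp (g - T g) 2 volume := hg2.sub (memLp_zonOp _ one_le_two hg2)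
  have m3 : MemLp (T (f - g)) 2 volume := memLp_zonOp _ one_le_two m1
  rw [eLpNorm_congr_ae e]
  calc eLpNorm ((f - g) + (g - T g) - T (f - g)) 2 volume
      ≤ eLpNorm ((f - g) + (g - T g)) 2 volume + eLpNorm (T (f - g)) 2 volume :=
        eLpNorm_sub_le (m1.add m2).1 m3.1 one_le_two
    _ ≤ (eLpNorm (f - g) 2 volume + eLpNorm (g - T g) 2 volume) + eLpNorm (f - g) 2 volume :=
        add_le_add (eLpNorm_add_le m1.1 m2.1 one_le_two)
          (ψ.eLpNorm_zonOp_le (ψ.abs_low_le_one L) m1)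
    _ ≤ (ε / 3 + ε / 3) + ε / 3 := by
        gcongr
        exact hL0 L hL
    _ = ε := ENNReal.add_thirds ε

/-- A multiplier whose symbol lies between a low-frequency cutoff and `1` is at least as close to
the identity as the cutoff, up to a factor `2`. -/
theorem Bump.eLpNorm_sub_zonOp_le (hf : MemLp f 2 volume) {L : ℕ} {a : ℕ →₀ ℝ}
    (h1 : ∀ n, ψ.low L n ≤ a n) (h2 : ∀ n, a n ≤ 1) :
    eLpNorm (f - zonOp a f) 2 volume ≤ 2 * eLpNorm (f - zonOp (ψ.low L) f) 2 volume := by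
  have mT : ∀ b, MemLp (zonOp b f) 2 volume := fun b => memLp_zonOp b one_le_two hf
  set e : ℕ → ℝ≥0∞ := fun L => eLpNorm (f - zonOp (ψ.low L) f) 2 volume
  have hd : ∀ᶠ K : ℕ in atTop, eLpNorm (zonOp (a - ψ.low L) f) 2 volume ≤ e L + e K := by
    -- For large `K` the symbol `a` lies below `low K`, so that the form of `a - low L` is
    -- dominated by that of `low K - low L`.
    have hK : ∀ᶠ K : ℕ in atTop, ∀ n ∈ a.support, ψ.low K n = 1 :=
      (Finset.eventually_all _).2 fun n _ => ψ.mult_eventually_eq_one n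
    filter_upwards [hK, eventually_ge_atTop L] with K hK hLK
    have hmono : ∀ n, ψ.low L n ≤ ψ.low K n := fun n => by
      rw [ψ.low_apply, ψ.low_apply]
      refine ψ.antitoneOn (Set.mem_Ici.2 (by positivity)) (Set.mem_Ici.2 (by positivity)) ?_
      gcongr
      exact one_le_two
    calc eLpNorm (zonOp (a - ψ.low L) f) 2 volume
        ≤ eLpNorm (zonOp (ψ.low K - ψ.low L) f) 2 volume := by
          refine ψ.eLpNorm_zonOp_mono (fun n => ?_) hf
          rw [Finsupp.sub_apply, Finsupp.sub_apply, abs_of_nonneg (sub_nonneg.2 (h1 n)),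
            abs_of_nonneg (sub_nonneg.2 (hmono n))]
          gcongr
          by_cases hn : n ∈ a.support
          · rw [hK n hn]; exact h2 n
          · rw [Finsupp.notMem_support_iff.1 hn]; exact ψ.low_nonneg _ _
      _ = eLpNorm ((f - zonOp (ψ.low L) f) - (f - zonOp (ψ.low K) f)) 2 volume := by
          rw [eLpNorm_congr_ae (zonOp_sub_ae_eq _ _ hf)]
          congr 1
          ring
      _ ≤ e L + e K := eLpNorm_sub_le (hf.sub (mT _)).1 (hf.sub (mT _)).1 one_le_two
  have hd' : eLpNorm (zonOp (a - ψ.low L) f) 2 volume ≤ e L + 0 :=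
    ge_of_tendsto ((ψ.tendsto_eLpNorm_sub_low hf).const_add _) hd
  calc eLpNorm (f - zonOp a f) 2 volume
      = eLpNorm ((f - zonOp (ψ.low L) f) - zonOp (a - ψ.low L) f) 2 volume := by
        refine eLpNorm_congr_ae ?_
        filter_upwards [zonOp_sub_ae_eq a (ψ.low L) hf] with x hx
        simp only [Pi.sub_apply] at hx ⊢
        rw [hx]
        ring
    _ ≤ e L + eLpNorm (zonOp (a - ψ.low L) f) 2 volume :=
        eLpNorm_sub_le (hf.sub (mT _)).1 (mT _).1 one_le_two
    _ ≤ e L + (e L + 0) := by gcongr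
    _ = 2 * e L := by rw [add_zero, two_mul]

/-- A finite partial sum that contains the first `L` bands has a symbol between the cutoff at scale
`L - 1` and `1`, whichever other bands it contains; this makes the convergence unconditional. -/
theorem Bump.tendsto_eLpNorm_sub_sum (hf : MemLp f 2 volume) :
    Tendsto (fun s : Finset ℕ =>
      eLpNorm (f - (ψ.Rle (-1) f + ∑ l ∈ s, ψ.R (l : ℤ) f)) 2 volume) atTop (𝓝 0) := by
  rw [ENNReal.tendsto_nhds_zero]
  intro ε hε
  have hε2 : 0 < ε / 2 := ENNReal.div_pos hε.ne' (by norm_num)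
  obtain ⟨L, hL⟩ := ENNReal.tendsto_atTop_zero.1 (ψ.tendsto_eLpNorm_sub_low hf) (ε / 2) hε2
  filter_upwards [eventually_ge_atTop (Finset.range (L + 1))] with s hs
  have e : f - (ψ.Rle (-1) f + ∑ l ∈ s, ψ.R (l : ℤ) f) =ᵐ[volume]
      f - zonOp (ψ.low (-1) + ∑ l ∈ s, ψ.band l) f := by
    filter_upwards [MemLp.ae_sphereIntegrable one_le_two hf] with x hx
    simp only [Pi.sub_apply, Pi.add_apply, Finset.sum_apply]
    rw [zonOp_add_apply _ _ hx, zonOp_sum_apply _ _ hx, ψ.Rle_eq _ hx]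
    simp_rw [ψ.R_eq _ hx]
  rw [eLpNorm_congr_ae e]
  refine (ψ.eLpNorm_sub_zonOp_le hf (L := L) (fun n => ?_) fun n => ?_).trans ?_
  · have h := congrArg (fun a : ℕ →₀ ℝ => a n) (ψ.low_add_sum_band (L + 1))
    simp only [Nat.cast_add, Nat.cast_one, add_sub_cancel_right] at h
    rw [← h, Finsupp.add_apply, Finsupp.add_apply, Finsupp.finsetSum_apply,
      Finsupp.finsetSum_apply]
    gcongr
    exact fun _ _ _ => ψ.band_nonneg _ _
  · rw [Finsupp.add_apply, Finsupp.finsetSum_apply]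
    exact ψ.low_add_sum_band_le_one s n
  · calc _ ≤ 2 * (ε / 2) := by gcongr; exact hL L le_rfl
      _ = ε := ENNReal.mul_div_cancel two_ne_zero ENNReal.ofNat_ne_top

/-! ### The square function estimate -/

theorem Bump.eLpNorm_sq_add_sum (hf : MemLp f 2 volume) (L : ℕ) :
    eLpNorm (ψ.Rle (-1) f) 2 volume ^ 2 +
      ∑ l ∈ Finset.range L, eLpNorm (ψ.R (l : ℤ) f) 2 volume ^ 2 =
    ENNReal.ofReal (zonForm f (ψ.low (-1) * ψ.low (-1) +
      ∑ l ∈ Finset.range L, ψ.band l * ψ.band l)) := by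
  have hp : ∀ a : ℕ →₀ ℝ, 0 ≤ zonForm f (a * a) := fun a =>
    ψ.zonForm_nonneg (fun n => by rw [Finsupp.mul_apply]; exact mul_self_nonneg _) hf
  rw [zonForm_add _ _ hf, zonForm_sum _ _ hf, ENNReal.ofReal_add (hp _)
    (Finset.sum_nonneg fun l _ => hp _), ENNReal.ofReal_sum_of_nonneg fun l _ => hp _,
    eLpNorm_congr_ae (ψ.Rle_ae_eq _ one_le_two hf), ψ.eLpNorm_zonOp_sq _ hf]
  congr 1
  refine Finset.sum_congr rfl fun l _ => ?_
  rw [eLpNorm_congr_ae (ψ.R_ae_eq _ one_le_two hf), ψ.eLpNorm_zonOp_sq _ hf]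

theorem Bump.eLpNorm_sq_add_sum_le (hf : MemLp f 2 volume) (L : ℕ) :
    eLpNorm (ψ.Rle (-1) f) 2 volume ^ 2 +
      ∑ l ∈ Finset.range L, eLpNorm (ψ.R (l : ℤ) f) 2 volume ^ 2 ≤ eLpNorm f 2 volume ^ 2 := by
  rw [ψ.eLpNorm_sq_add_sum hf, MemLp.eLpNorm_two_sq hf]
  refine ENNReal.ofReal_le_ofReal (ψ.zonForm_le (fun n => ?_) hf)
  refine le_trans ?_ (ψ.low_add_sum_band_le_one (Finset.range L) n)
  simp only [Finsupp.add_apply, Finsupp.finsetSum_apply, Finsupp.mul_apply]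
  have hband : ∀ l : ℕ, ψ.band l n ≤ 1 := fun l => by
    rw [ψ.band_apply]; exact (le_abs_self _).trans (ψ.abs_phi_le _)
  refine add_le_add (mul_le_of_le_one_left (ψ.low_nonneg _ _) (ψ.low_le_one _ _))
    (Finset.sum_le_sum fun l _ => mul_le_of_le_one_left (ψ.band_nonneg _ _) (hband l))

theorem Bump.tsum_eLpNorm_sq_le (hf : MemLp f 2 volume) :
    eLpNorm (ψ.Rle (-1) f) 2 volume ^ 2 + ∑' l : ℕ, eLpNorm (ψ.R (l : ℤ) f) 2 volume ^ 2 ≤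
      eLpNorm f 2 volume ^ 2 := by
  refine le_of_tendsto' ((ENNReal.tendsto_nat_tsum _).const_add _) fun L => ?_
  exact ψ.eLpNorm_sq_add_sum_le hf L

theorem Bump.low_eq_zero_or_low_succ_eq_one (l : ℤ) (n : ℕ) :
    ψ.low l n = 0 ∨ ψ.low (l + 1) n = 1 := by
  rw [ψ.low_apply, ψ.low_apply]
  have h0 : (0 : ℝ) ≤ 2 ^ (-(l + 1)) * n := by positivity
  have e : (2 : ℝ) ^ (-l) * n = 2 * (2 ^ (-(l + 1)) * n) := by
    rw [← mul_assoc, ← zpow_one_add₀ two_ne_zero]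
    congr 2
    ring
  rcases le_or_gt ((2 : ℝ) ^ (-(l + 1)) * n) (4 / 5) with h | h
  · exact Or.inr (ψ.eq_one' (by rwa [abs_of_nonneg h0]))
  · exact Or.inl (ψ.eq_zero (by rw [e, abs_of_nonneg (by linarith)]; linarith))

/-- At most two of the numbers `low (-1) n`, `band l n` are nonzero, hence the square of their sum
is at most twice the sum of their squares. -/
theorem Bump.low_sq_le (L n : ℕ) : ψ.low ((L : ℤ) - 1) n ^ 2 ≤
    2 * (ψ.low (-1) n * ψ.low (-1) n + ∑ l ∈ Finset.range L, ψ.band l n * ψ.band l n) := by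
  set Q : ℕ → ℝ := fun L =>
    ψ.low (-1) n * ψ.low (-1) n + ∑ l ∈ Finset.range L, ψ.band l n * ψ.band l n
  have hQ0 : ∀ L, 0 ≤ Q L := fun L =>
    add_nonneg (mul_self_nonneg _) (Finset.sum_nonneg fun l _ => mul_self_nonneg _)
  have hQ : ∀ L, Q (L + 1) = Q L + ψ.band L n * ψ.band L n := fun L => by
    simp only [Q, Finset.sum_range_succ, add_assoc]
  -- Before the cutoff reaches `1`, only one summand is nonzero; the next one completes it to `1`.
  have key : ψ.low ((L : ℤ) - 1) n ^ 2 ≤ Q L ∨ (ψ.low ((L : ℤ) - 1) n = 1 ∧ 1 ≤ 2 * Q L) := by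
    induction L with
    | zero => exact Or.inl (by simp [Q, sq])
    | succ L ih =>
      have h := congrArg (fun a : ℕ →₀ ℝ => a n) (ψ.low_add_band ((L : ℤ) - 1))
      have h' := ψ.low_eq_zero_or_low_succ_eq_one ((L : ℤ) - 1) n
      simp only [sub_add_cancel, Finsupp.add_apply] at h h'
      rw [Nat.cast_add, Nat.cast_one, add_sub_cancel_right, hQ]
      rcases h' with h0 | h1
      · rw [h0, zero_add] at h
        left
        rw [← h, sq]
        linarith [hQ0 L]
      · right
        refine ⟨h1, ?_⟩
        rw [h1] at h
        rcases ih with h2 | ⟨-, h2⟩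
        · nlinarith [sq_nonneg (ψ.low ((L : ℤ) - 1) n - ψ.band L n)]
        · linarith [mul_self_nonneg (ψ.band L n)]
  rcases key with h | ⟨h1, h2⟩
  · linarith [hQ0 L]
  · rw [h1]
    linarith

theorem Bump.eLpNorm_sq_le (hf : MemLp f 2 volume) :
    eLpNorm f 2 volume ^ 2 ≤ 2 * (eLpNorm (ψ.Rle (-1) f) 2 volume ^ 2 +
      ∑' l : ℕ, eLpNorm (ψ.R (l : ℤ) f) 2 volume ^ 2) := by
  set Q := eLpNorm (ψ.Rle (-1) f) 2 volume ^ 2 + ∑' l : ℕ, eLpNorm (ψ.R (l : ℤ) f) 2 volume ^ 2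
  have h1 : ∀ L : ℕ, eLpNorm (zonOp (ψ.low L) f) 2 volume ^ 2 ≤ 2 * Q := fun L => by
    calc eLpNorm (zonOp (ψ.low L) f) 2 volume ^ 2
        ≤ 2 * (eLpNorm (ψ.Rle (-1) f) 2 volume ^ 2 +
          ∑ l ∈ Finset.range (L + 1), eLpNorm (ψ.R (l : ℤ) f) 2 volume ^ 2) := by
          rw [ψ.eLpNorm_sq_add_sum hf, ψ.eLpNorm_zonOp_sq _ hf,
            show (2 : ℝ≥0∞) = ENNReal.ofReal 2 by simp, ← ENNReal.ofReal_mul zero_le_two, two_mul,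
            ← zonForm_add _ _ hf]
          refine ENNReal.ofReal_le_ofReal (ψ.zonForm_mono (fun n => ?_) hf)
          have h := ψ.low_sq_le (L + 1) n
          rw [Nat.cast_add, Nat.cast_one, add_sub_cancel_right, sq, two_mul] at h
          simpa only [two_mul, Finsupp.add_apply, Finsupp.finsetSum_apply, Finsupp.mul_apply]
            using h
      _ ≤ 2 * Q := by
          gcongr
          exact add_le_add_right (ENNReal.sum_le_tsum _) _
  have h2 : ∀ L : ℕ, eLpNorm f 2 volume ≤
      (2 * Q) ^ (1 / 2 : ℝ) + eLpNorm (f - zonOp (ψ.low L) f) 2 volume := fun L => by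
    have h3 : eLpNorm (zonOp (ψ.low L) f) 2 volume ≤ (2 * Q) ^ (1 / 2 : ℝ) := by
      have h4 := ENNReal.rpow_le_rpow (h1 L) (by norm_num : (0 : ℝ) ≤ 1 / 2)
      rw [← ENNReal.rpow_two, ← ENNReal.rpow_mul] at h4
      norm_num at h4 ⊢
      exact h4
    calc eLpNorm f 2 volume = eLpNorm (zonOp (ψ.low L) f + (f - zonOp (ψ.low L) f)) 2 volume := by
          rw [add_sub_cancel]
      _ ≤ _ := (eLpNorm_add_le (memLp_zonOp _ one_le_two hf).1
          (hf.sub (memLp_zonOp _ one_le_two hf)).1 one_le_two).trans (by gcongr)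
  have h3 : eLpNorm f 2 volume ≤ (2 * Q) ^ (1 / 2 : ℝ) + 0 :=
    ge_of_tendsto' ((ψ.tendsto_eLpNorm_sub_low hf).const_add _) h2
  rw [add_zero] at h3
  calc eLpNorm f 2 volume ^ 2 ≤ ((2 * Q) ^ (1 / 2 : ℝ)) ^ 2 := by gcongr
    _ = 2 * Q := by
        rw [← ENNReal.rpow_two, ← ENNReal.rpow_mul]
        norm_num

end Convergence

/-! ### Commutation with radial multiplications and dilations -/

section Fourier

open Polynomial
open scoped SchwartzMap

variable {f g : E3 → ℂ}

theorem angMult_radial_mul (χ : ℝ → ℝ) (l : ℤ) (m : ℝ → ℂ) (f : E3 → ℂ) (x : E3) :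
    angMult χ l (fun y => m ‖y‖ * f y) x = m ‖x‖ * angMult χ l f x := by
  rw [angMult, angMult, ← tsum_mul_left]
  refine tsum_congr fun n => ?_
  rw [mul_left_comm]
  congr 1
  rw [← integral_const_mul]
  congr 1
  funext θ
  rw [norm_smul_S2 (norm_nonneg x), mul_assoc]

theorem direction_smul {s : ℝ} (hs : 0 < s) (x : E3) : direction (s • x) = direction x := by
  unfold direction
  by_cases hx : x = 0
  · simp [hx]
  · rw [if_neg hx, if_neg (by simp [hx, hs.ne']), norm_smul, Real.norm_of_nonneg hs.le, smul_smul,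
      mul_inv, mul_right_comm, inv_mul_cancel₀ hs.ne', one_mul]

theorem angMult_comp_smul (χ : ℝ → ℝ) (l : ℤ) {s : ℝ} (hs : 0 < s) (f : E3 → ℂ) (x : E3) :
    angMult χ l (fun y => f (s • y)) x = angMult χ l f (s • x) := by
  simp only [angMult, direction_smul hs, norm_smul, Real.norm_of_nonneg hs.le, smul_smul]

theorem angMult_congr_ae (χ : ℝ → ℝ) (l : ℤ) (h : f =ᵐ[volume] g) :
    angMult χ l f =ᵐ[volume] angMult χ l g := by
  filter_upwards [ae_sphere_of_ae h] with x hx using angMult_congr_ae_sphere χ l hx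

/-! ### Commutation with the Fourier transform -/

/-- The character `x ↦ e^{-i c ⟨x, ξ⟩}`. -/
def planeWave (c : ℝ) (x ξ : E3) : ℂ := Complex.exp (-(Complex.I * (c : ℂ) * (inner ℝ x ξ : ℂ)))

@[fun_prop]
theorem continuous_planeWave {α : Type*} [TopologicalSpace α] (c : ℝ) {u v : α → E3}
    (hu : Continuous u) (hv : Continuous v) : Continuous fun y => planeWave c (u y) (v y) := by
  unfold planeWave
  fun_prop

theorem norm_planeWave (c : ℝ) (x ξ : E3) : ‖planeWave c x ξ‖ = 1 := by
  rw [planeWave, show -(Complex.I * (c : ℂ) * (inner ℝ x ξ : ℂ)) =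
    ((-(c * inner ℝ x ξ) : ℝ) : ℂ) * Complex.I by push_cast; ring]
  exact Complex.norm_exp_ofReal_mul_I _

theorem fourierL1_eq (c : ℝ) (f : E3 → ℂ) (ξ : E3) :
    fourierL1 c f ξ = ∫ x, planeWave c x ξ * f x := rfl

theorem integrable_planeWave_mul (c : ℝ) (hf : Integrable f volume) (ξ : E3) :
    Integrable (fun x => planeWave c x ξ * f x) volume :=
  hf.bdd_mul (c := 1) (by fun_prop : Continuous fun x => planeWave c x ξ).aestronglyMeasurable
    (Eventually.of_forall fun x => (norm_planeWave c x ξ).le)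

theorem continuous_fourierL1 (c : ℝ) (hf : Integrable f volume) : Continuous (fourierL1 c f) := by
  refine continuous_of_dominated (bound := fun x => ‖f x‖)
    (fun ξ => (integrable_planeWave_mul c hf ξ).aestronglyMeasurable)
    (fun ξ => Eventually.of_forall fun x => ?_) hf.norm (Eventually.of_forall fun x => ?_)
  · rw [norm_mul]
    change ‖planeWave c x ξ‖ * _ ≤ _
    rw [norm_planeWave, one_mul]
  · exact (by fun_prop : Continuous fun ξ => planeWave c x ξ).mul continuous_const

/-- The integral of `G(⟨θ, ζ⟩) p(⟨θ, η⟩)` is symmetric in `ζ` and `η`: reflect in the plane that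
bisects them. -/
theorem integral_dot_mul_polyKer_comm (G : ℝ → ℂ) (p : ℝ[X]) (ζ η : S2) :
    ∫ θ : S2, G (dot θ ζ) * polyKer p θ η ∂sphereMeasure =
      ∫ θ : S2, G (dot θ η) * polyKer p θ ζ ∂sphereMeasure := by
  set U : E3 ≃ₗᵢ[ℝ] E3 := Submodule.reflection (Submodule.span ℝ {(ζ : E3) - η})ᗮ
  have h1 : U ζ = η := Submodule.reflection_sub (by simp)
  have h2 : U η = ζ := by rw [← h1]; exact Submodule.reflection_reflection _ _
  have e1 : sphereMap U ζ = η := Subtype.ext h1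
  have e2 : sphereMap U η = ζ := Subtype.ext h2
  rw [← integral_sphereMap U]
  congr 1
  funext θ
  have h3 := dot_sphereMap U θ η
  have h4 := dot_sphereMap U θ ζ
  rw [e2] at h3
  rw [e1] at h4
  rw [polyKer, h3, h4, polyKer]

/-- A zonal operator acts in the same way on the two variables of a plane wave. -/
theorem zonOp_planeWave (c : ℝ) (a : ℕ →₀ ℝ) (x ξ : E3) :
    zonOp a (fun y => planeWave c y ξ) x = zonOp a (planeWave c x) ξ := by
  have e1 : ∀ θ : S2, planeWave c (‖x‖ • (θ : E3)) ξ =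
      (fun t : ℝ => Complex.exp (-(Complex.I * c * ((‖x‖ * ‖ξ‖ * t : ℝ) : ℂ))))
        (dot θ (dirS ξ)) := fun θ => by
    rw [planeWave]
    conv_lhs => rw [← norm_smul_direction ξ, ← coe_dirS, inner_smul_left, inner_smul_right]
    simp only [dot, conj_trivial, mul_assoc]
  have e2 : ∀ θ : S2, planeWave c x (‖ξ‖ • (θ : E3)) =
      (fun t : ℝ => Complex.exp (-(Complex.I * c * ((‖x‖ * ‖ξ‖ * t : ℝ) : ℂ))))
        (dot θ (dirS x)) := fun θ => by
    rw [planeWave]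
    conv_lhs => rw [← norm_smul_direction x, ← coe_dirS, inner_smul_left, inner_smul_right,
      real_inner_comm]
    simp only [dot, conj_trivial, mul_assoc]
  unfold zonOp sphOp
  simp_rw [e1, e2]
  exact integral_dot_mul_polyKer_comm
    (fun t : ℝ => Complex.exp (-(Complex.I * c * ((‖x‖ * ‖ξ‖ * t : ℝ) : ℂ)))) _ _ _

/-- The operator is transposed to the plane wave and acts there on the other variable, in which it
leaves the integral. -/
theorem fourierL1_zonOp (c : ℝ) (a : ℕ →₀ ℝ) (hf : Integrable f volume) (ξ : E3) :
    fourierL1 c (zonOp a f) ξ = zonOp a (fourierL1 c f) ξ := by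
  have hw : MemLp (fun x => planeWave c x ξ) ⊤ volume :=
    memLp_top_of_bound (by fun_prop : Continuous fun x => planeWave c x ξ).aestronglyMeasurable 1
      (Eventually.of_forall fun x => (norm_planeWave c x ξ).le)
  have h := integral_zonOp_mul a (memLp_one_iff_integrable.2 hf) hw
  have e1 : fourierL1 c (zonOp a f) ξ = ∫ x, zonOp a f x * planeWave c x ξ := by
    rw [fourierL1_eq]
    congr 1
    funext x
    ring
  rw [e1, h]
  simp_rw [zonOp_planeWave]
  obtain ⟨M, hM0, hM⟩ := exists_bound_ker (continuous_uncurry_polyKer (zon a))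
  have hi : Integrable (Function.uncurry fun (x : E3) (θ : S2) =>
      f x * (planeWave c x (‖ξ‖ • (θ : E3)) * polyKer (zon a) θ (dirS ξ)))
      ((volume : Measure E3).prod sphereMeasure) := by
    refine (hf.comp_fst sphereMeasure).mul_bdd (c := M)
      (by fun_prop : Continuous fun p : E3 × S2 => planeWave c p.1 (‖ξ‖ • (p.2 : E3)) *
        polyKer (zon a) p.2 (dirS ξ)).aestronglyMeasurable (Eventually.of_forall fun p => ?_)
    rw [norm_mul, norm_planeWave, one_mul]
    exact hM _ _
  have h2 := integral_integral_swap hi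
  simp_rw [integral_const_mul] at h2
  refine h2.trans ?_
  rw [zonOp, sphOp]
  congr 1
  funext θ
  rw [fourierL1_eq, ← integral_mul_const]
  congr 1
  funext x
  ring

theorem Bump.fourierL1_R (ψ : Bump) (c : ℝ) (l : ℤ) (hf : Integrable f volume) :
    fourierL1 c (ψ.R l f) = ψ.R l (fourierL1 c f) := by
  funext ξ
  rw [ψ.R_eq l (sphereIntegrable_of_continuous (continuous_fourierL1 c hf) ξ),
    ← fourierL1_zonOp c _ hf]
  refine integral_congr_ae ?_
  filter_upwards [ψ.R_ae_eq l le_rfl (memLp_one_iff_integrable.2 hf)] with x hx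
  rw [hx]

theorem fourier_eq_fourierL1 (f : E3 → ℂ) : 𝓕 f = fourierL1 (2 * Real.pi) f := by
  funext ξ
  rw [Real.fourier_eq', fourierL1]
  congr 1
  funext x
  rw [smul_eq_mul]
  congr 2
  push_cast
  ring

/-- The transposition formula for the Fourier transform of a square integrable function against an
integrable one. -/
theorem integral_fourier_mul (F : Lp ℂ 2 (volume : Measure E3)) (hg : Integrable g volume)
    (hg2 : MemLp g 2 volume) (hgF : MemLp (fourierL1 (2 * Real.pi) g) 2 volume) :
    ∫ x, (𝓕 F : Lp ℂ 2 (volume : Measure E3)) x * g x =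
      ∫ x, F x * fourierL1 (2 * Real.pi) g x := by
  have hpair : ∀ (u : E3 → ℂ) (hu : MemLp u 2 volume) (G : Lp ℂ 2 (volume : Measure E3)),
      ∫ x, G x * u x = inner ℂ (hu.star.toLp _) G := by
    intro u hu G
    rw [L2.inner_def]
    refine integral_congr_ae ?_
    filter_upwards [hu.star.coeFn_toLp] with x hx
    rw [hx, RCLike.inner_apply, Pi.star_apply, RCLike.star_def, RCLike.conj_conj]
  have h : ∀ G : Lp ℂ 2 (volume : Measure E3),
      inner ℂ (hg2.star.toLp _) (𝓕 G : Lp ℂ 2 (volume : Measure E3)) =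
        inner ℂ (hgF.star.toLp _) G := by
    intro G
    refine DenseRange.induction_on (SchwartzMap.denseRange_toLpCLM (E := E3) (F := ℂ)
      (p := 2) (μ := volume) ENNReal.ofNat_ne_top) G ?_ fun φ => ?_
    · refine isClosed_eq ?_ (by fun_prop)
      have := (Lp.fourierTransformₗᵢ E3 ℂ).continuous
      exact (continuous_const.inner this)
    · rw [SchwartzMap.toLpCLM_apply, SchwartzMap.toLp_fourier_eq, ← hpair g hg2, ← hpair _ hgF]
      have e1 : ∫ x, ((𝓕 φ : 𝓢(E3, ℂ)).toLp 2 volume : E3 → ℂ) x * g x =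
          ∫ x, (𝓕 (φ : E3 → ℂ)) x * g x := by
        refine integral_congr_ae ?_
        filter_upwards [(𝓕 φ : 𝓢(E3, ℂ)).coeFn_toLp 2 volume] with x hx
        rw [hx, SchwartzMap.fourier_coe]
      have e2 : ∫ x, (φ.toLp 2 volume : E3 → ℂ) x * fourierL1 (2 * Real.pi) g x =
          ∫ x, φ x * 𝓕 g x := by
        refine integral_congr_ae ?_
        filter_upwards [φ.coeFn_toLp 2 volume] with x hx
        rw [hx, fourier_eq_fourierL1]
      rw [e1, e2]
      have h3 := VectorFourier.integral_fourierIntegral_smul_eq_flip (μ := (volume : Measure E3))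
        (ν := (volume : Measure E3)) (e := Real.fourierChar) (L := innerₗ E3) (f := φ) (g := g)
        Real.continuous_fourierChar continuous_inner φ.integrable hg
      rw [flip_innerₗ] at h3
      exact h3
  rw [hpair g hg2, hpair _ hgF, h]

/-- Tested against smooth functions of compact support, the operator and the Fourier transform are
both transposed to the test function, where `fourierL1_zonOp` applies. -/
theorem fourier_toLp_zonOp (a : ℕ →₀ ℝ) (F : Lp ℂ 2 (volume : Measure E3)) :
    (𝓕 ((memLp_zonOp a one_le_two (Lp.memLp F)).toLp (zonOp a F)) :
      Lp ℂ 2 (volume : Measure E3)) =ᵐ[volume]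
        zonOp a (𝓕 F : Lp ℂ 2 (volume : Measure E3)) := by
  have hT := memLp_zonOp a one_le_two (Lp.memLp F)
  have hT' := memLp_zonOp a one_le_two (Lp.memLp (𝓕 F : Lp ℂ 2 (volume : Measure E3)))
  refine ae_eq_of_integral_contDiff_smul_eq ((Lp.memLp _).locallyIntegrable one_le_two)
    (hT'.locallyIntegrable one_le_two) fun u hu huc => ?_
  have hv : ContDiff ℝ ∞ fun x => (u x : ℂ) := Complex.ofRealCLM.contDiff.comp hu
  have hvc : HasCompactSupport fun x => (u x : ℂ) :=
    huc.comp_left (g := fun t : ℝ => (t : ℂ)) Complex.ofReal_zero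
  set v : 𝓢(E3, ℂ) := hvc.toSchwartzMap hv
  have hvF : fourierL1 (2 * Real.pi) v = (𝓕 v : 𝓢(E3, ℂ)) := by
    rw [SchwartzMap.fourier_coe, fourier_eq_fourierL1]
  have hvF2 : MemLp (fourierL1 (2 * Real.pi) v) 2 volume := by
    rw [hvF]
    exact SchwartzMap.memLp _ 2 volume
  have hv2 : MemLp v 2 volume := v.memLp 2 volume
  have hzv : fourierL1 (2 * Real.pi) (zonOp a v) = zonOp a (fourierL1 (2 * Real.pi) v) :=
    funext fun ξ => fourierL1_zonOp _ a v.integrable ξ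
  have e : ∀ G : E3 → ℂ, ∫ x, u x • G x = ∫ x, G x * v x := fun G => by
    congr 1
    funext x
    rw [Complex.real_smul, mul_comm]
    rfl
  rw [e, e, integral_fourier_mul _ v.integrable hv2 hvF2,
    integral_zonOp_mul a (Lp.memLp _) hv2,
    integral_fourier_mul F (memLp_one_iff_integrable.1
      (memLp_zonOp a le_rfl (memLp_one_iff_integrable.2 v.integrable)))
      (memLp_zonOp a one_le_two hv2) (by rw [hzv]; exact memLp_zonOp a one_le_two hvF2),
    hzv, ← integral_zonOp_mul a (Lp.memLp F) hvF2]
  refine integral_congr_ae ?_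
  filter_upwards [hT.coeFn_toLp] with x hx
  rw [hx]

variable (ψ : Bump)

/-- `R̄_l` on equivalence classes of square integrable functions. -/
def Bump.RLp (l : ℤ) (F : Lp ℂ 2 (volume : Measure E3)) : Lp ℂ 2 (volume : Measure E3) :=
  (ψ.memLp_R l one_le_two (Lp.memLp F)).toLp (ψ.R l F)

theorem Bump.coeFn_RLp (l : ℤ) (F : Lp ℂ 2 (volume : Measure E3)) :
    ψ.RLp l F =ᵐ[volume] ψ.R l F := MemLp.coeFn_toLp _

theorem Bump.fourier_RLp (l : ℤ) (F : Lp ℂ 2 (volume : Measure E3)) :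
    (𝓕 (ψ.RLp l F) : Lp ℂ 2 (volume : Measure E3)) =ᵐ[volume]
      ψ.R l (𝓕 F : Lp ℂ 2 (volume : Measure E3)) := by
  have e : ψ.RLp l F = (memLp_zonOp (ψ.band l) one_le_two (Lp.memLp F)).toLp
      (zonOp (ψ.band l) F) :=
    MemLp.toLp_congr _ _ (ψ.R_ae_eq l one_le_two (Lp.memLp F))
  rw [e]
  exact (fourier_toLp_zonOp _ F).trans (ψ.R_ae_eq l one_le_two (Lp.memLp _)).symm

theorem Bump.fourierL2_RLp {c : ℝ} (hc : 0 < c) (l : ℤ) (F : Lp ℂ 2 (volume : Measure E3)) :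
    fourierL2 c (ψ.RLp l F) =ᵐ[volume] ψ.R l (fourierL2 c F) := by
  have hs : 0 < c / (2 * Real.pi) := by positivity
  have e : ψ.R l (fourierL2 c F) = fun ξ =>
      ψ.R l (𝓕 F : Lp ℂ 2 (volume : Measure E3)) ((c / (2 * Real.pi)) • ξ) :=
    funext fun ξ => angMult_comp_smul _ _ hs _ _
  rw [e]
  have hq : Measure.QuasiMeasurePreserving (fun ξ : E3 => (c / (2 * Real.pi)) • ξ)
      volume volume := by
    refine ⟨by fun_prop, ?_⟩
    rw [Measure.map_addHaar_smul _ hs.ne']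
    exact Measure.smul_absolutelyContinuous
  exact hq.ae (ψ.fourier_RLp l F)

theorem Bump.R_symbol_mul (c : ℝ) (k l : ℤ) (f : E3 → ℂ) (ζ : E3) :
    ψ.R l (fun ζ => ψ.symbol c k ζ * f ζ) ζ = ψ.symbol c k ζ * ψ.R l f ζ := by
  set m : ℝ → ℂ := fun t => (ψ.phi ((2 : ℝ) ^ (-k) * (|2 * Real.pi / c| * t)) : ℂ) with hm
  have hs : ψ.symbol c k = fun ζ => m ‖ζ‖ := funext fun ζ => by
    rw [Bump.symbol, norm_smul, Real.norm_eq_abs]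
  rw [hs]
  exact angMult_radial_mul ψ.phi l m f ζ

theorem Bump.freqLP_RLp (c : ℝ) (k l : ℤ) (F : Lp ℂ 2 (volume : Measure E3)) :
    ψ.freqLP c k (ψ.RLp l F) = ψ.RLp l (ψ.freqLP c k F) := by
  set G := ψ.freqLP c k F
  have hG : (𝓕 G : Lp ℂ 2 (volume : Measure E3)) = (ψ.memLp_symbol_mul c k (𝓕 F)).toLp _ :=
    FourierTransform.fourier_fourierInv_eq _
  have h : (ψ.memLp_symbol_mul c k (𝓕 (ψ.RLp l F))).toLp _ =
      (𝓕 (ψ.RLp l G) : Lp ℂ 2 (volume : Measure E3)) := by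
    refine Lp.ext ?_
    have h1 : (𝓕 G : Lp ℂ 2 (volume : Measure E3)) =ᵐ[volume]
        fun ζ => ψ.symbol c k ζ * (𝓕 F : Lp ℂ 2 (volume : Measure E3)) ζ := by
      rw [hG]
      exact MemLp.coeFn_toLp _
    filter_upwards [(ψ.memLp_symbol_mul c k (𝓕 (ψ.RLp l F))).coeFn_toLp, ψ.fourier_RLp l G,
      ψ.fourier_RLp l F, angMult_congr_ae ψ.phi l h1] with ζ h2 h3 h4 h5
    rw [h2, h3, h4]
    refine Eq.symm (h5.trans ?_)
    exact ψ.R_symbol_mul c k l _ ζ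
  rw [Bump.freqLP, h]
  exact FourierTransform.fourierInv_fourier_eq _

theorem Bump.R_spaceLP (l k : ℤ) (f : E3 → ℂ) :
    ψ.R l (ψ.spaceLP k f) = ψ.spaceLP k (ψ.R l f) :=
  funext fun x => angMult_radial_mul ψ.phi l (fun t : ℝ => (ψ.phi ((2 : ℝ) ^ (-k) * t) : ℂ)) f x

end Fourier

/-! ### Differentiation of zonal operators away from the origin -/

section Smooth

open Polynomial

variable {f g : E3 → ℂ} {x : E3}

/-- Differentiation under the integral over the sphere, in the second variable. -/
theorem hasFDerivAt_integral_sphere {Ψ : E3 × E3 → ℂ} {U : Set E3} (hU : IsOpen U)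
    (hΨ : ContDiffOn ℝ 1 Ψ (Set.univ ×ˢ U)) (hx : x ∈ U) :
    HasFDerivAt (fun y => ∫ θ : S2, Ψ (θ, y) ∂sphereMeasure)
      (∫ θ : S2, (fderiv ℝ Ψ (θ, x)).comp (ContinuousLinearMap.inr ℝ E3 E3) ∂sphereMeasure) x := by
  have hV : IsOpen (Set.univ ×ˢ U : Set (E3 × E3)) := isOpen_univ.prod hU
  obtain ⟨ε, hε, hεU⟩ := Metric.nhds_basis_closedBall.mem_iff.1 (hU.mem_nhds hx)
  have hD : ContinuousOn (fun p : E3 × E3 => (fderiv ℝ Ψ p).comp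
      (ContinuousLinearMap.inr ℝ E3 E3)) (Set.univ ×ˢ U) :=
    (hΨ.continuousOn_fderiv_of_isOpen hV le_rfl).clm_comp continuousOn_const
  have hDc : ∀ y ∈ U, Continuous fun θ : S2 => (fderiv ℝ Ψ ((θ : E3), y)).comp
      (ContinuousLinearMap.inr ℝ E3 E3) := fun y hy =>
    hD.comp_continuous (by fun_prop : Continuous fun θ : S2 => ((θ : E3), y)) fun θ => ⟨trivial, hy⟩
  have hΨc : ∀ y ∈ U, Continuous fun θ : S2 => Ψ ((θ : E3), y) := fun y hy =>
    hΨ.continuousOn.comp_continuous (by fun_prop : Continuous fun θ : S2 => ((θ : E3), y))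
      fun θ => ⟨trivial, hy⟩
  have hcomp : IsCompact (Metric.sphere (0 : E3) 1 ×ˢ Metric.closedBall x ε) :=
    (isCompact_sphere _ _).prod (isCompact_closedBall _ _)
  obtain ⟨M, hM⟩ := hcomp.exists_bound_of_continuousOn
    (hD.mono (Set.prod_mono (Set.subset_univ _) hεU))
  refine hasFDerivAt_integral_of_dominated_of_fderiv_le (bound := fun _ => M)
    (F' := fun y (θ : S2) => (fderiv ℝ Ψ (θ, y)).comp (ContinuousLinearMap.inr ℝ E3 E3))
    (Metric.closedBall_mem_nhds x hε) ?_ (integrable_sphere (hΨc x hx))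
    (hDc x hx).aestronglyMeasurable
    (Eventually.of_forall fun θ y hy => hM ((θ : E3), y) ⟨θ.2, hy⟩) (integrable_const _)
    (Eventually.of_forall fun θ y hy => ?_)
  · filter_upwards [hU.mem_nhds hx] with y hy
    exact (hΨc y hy).aestronglyMeasurable
  · have h1 : HasFDerivAt Ψ (fderiv ℝ Ψ ((θ : E3), y)) ((θ : E3), y) :=
      ((hΨ.differentiableOn one_ne_zero).differentiableAt
        (hV.mem_nhds (Set.mk_mem_prod (Set.mem_univ _) (hεU hy)))).hasFDerivAt
    have h2 : HasFDerivAt (fun y : E3 => ((θ : E3), y)) (ContinuousLinearMap.inr ℝ E3 E3) y :=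
      hasFDerivAt_prodMk_right _ _
    exact HasFDerivAt.comp (f := fun y : E3 => ((θ : E3), y)) y h1 h2

/-- The integrand of a zonal operator, as a function of two vectors. -/
def zonIntegrand (p : ℝ[X]) (f : E3 → ℂ) (z : E3 × E3) : ℂ :=
  f (‖z.2‖ • z.1) * ((p.eval (inner ℝ z.1 (‖z.2‖⁻¹ • z.2)) : ℝ) : ℂ)

theorem contDiffOn_zonIntegrand (p : ℝ[X]) (hf : ContDiff ℝ 1 f) :
    ContDiffOn ℝ 1 (zonIntegrand p f) (Set.univ ×ˢ {0}ᶜ) := by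
  have hn : ContDiffOn ℝ 1 (fun z : E3 × E3 => ‖z.2‖) (Set.univ ×ˢ {0}ᶜ) := fun z hz =>
    (contDiff_snd.contDiffAt.norm ℝ hz.2).contDiffWithinAt
  have hni : ContDiffOn ℝ 1 (fun z : E3 × E3 => ‖z.2‖⁻¹) (Set.univ ×ˢ {0}ᶜ) :=
    hn.inv fun z hz => norm_ne_zero_iff.2 hz.2
  refine (hf.comp_contDiffOn (hn.smul contDiffOn_fst)).mul ?_
  exact (Complex.ofRealCLM.contDiff.comp (contDiff_eval p)).comp_contDiffOn
    (contDiffOn_fst.inner ℝ (hni.smul contDiffOn_snd))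

theorem sphOp_polyKer_eq (p : ℝ[X]) (f : E3 → ℂ) (hx : x ≠ 0) :
    sphOp (polyKer p) f x = ∫ θ : S2, zonIntegrand p f (θ, x) ∂sphereMeasure := by
  simp only [sphOp, zonIntegrand, polyKer, dot, coe_dirS, direction, if_neg hx]

theorem hasFDerivAt_sphOp_polyKer (p : ℝ[X]) (hf : ContDiff ℝ 1 f) (hx : x ≠ 0) :
    HasFDerivAt (sphOp (polyKer p) f)
      (∫ θ : S2, (fderiv ℝ (zonIntegrand p f) (θ, x)).comp (ContinuousLinearMap.inr ℝ E3 E3)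
        ∂sphereMeasure) x := by
  refine (hasFDerivAt_integral_sphere isOpen_compl_singleton (contDiffOn_zonIntegrand p hf)
    hx).congr_of_eventuallyEq ?_
  filter_upwards [isOpen_compl_singleton.mem_nhds hx] with y hy using sphOp_polyKer_eq p f hy

theorem hasFDerivAt_zonIntegrand (p : ℝ[X]) (hf : ContDiff ℝ 1 f) (hx : x ≠ 0) (u : E3) :
    HasFDerivAt (zonIntegrand p f) (fderiv ℝ (zonIntegrand p f) (u, x)) (u, x) :=
  (((contDiffOn_zonIntegrand p hf).differentiableOn one_ne_zero).differentiableAt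
    ((isOpen_univ.prod isOpen_compl_singleton).mem_nhds
      (Set.mk_mem_prod (Set.mem_univ _) hx))).hasFDerivAt

theorem continuous_fderiv_zonIntegrand (p : ℝ[X]) (hf : ContDiff ℝ 1 f) (hx : x ≠ 0) :
    Continuous fun θ : S2 => fderiv ℝ (zonIntegrand p f) ((θ : E3), x) :=
  ((contDiffOn_zonIntegrand p hf).continuousOn_fderiv_of_isOpen
    (isOpen_univ.prod isOpen_compl_singleton) le_rfl).comp_continuous
    (by fun_prop : Continuous fun θ : S2 => ((θ : E3), x))
    fun θ => (⟨trivial, hx⟩ : ((θ : E3), x) ∈ Set.univ ×ˢ ({0}ᶜ : Set E3))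

theorem fderiv_sphOp_polyKer_apply (p : ℝ[X]) (hf : ContDiff ℝ 1 f) (hx : x ≠ 0) (v : E3) :
    fderiv ℝ (sphOp (polyKer p) f) x v =
      ∫ θ : S2, fderiv ℝ (zonIntegrand p f) (θ, x) (0, v) ∂sphereMeasure := by
  have hc := continuous_fderiv_zonIntegrand p hf hx
  rw [(hasFDerivAt_sphOp_polyKer p hf hx).fderiv, ContinuousLinearMap.integral_apply]
  · rfl
  · exact integrable_sphere (hc.clm_comp continuous_const)

/-- The kernel is homogeneous of degree `0` in `x`, so that a dilation of `x` dilates only the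
argument of `f`. -/
theorem scalingS_sphOp_polyKer (p : ℝ[X]) (hf : ContDiff ℝ 1 f) (hx : x ≠ 0) :
    scalingS (sphOp (polyKer p) f) x = sphOp (polyKer p) (scalingS f) x := by
  rw [scalingS, fderiv_sphOp_polyKer_apply p hf hx, sphOp_polyKer_eq p _ hx]
  congr 1
  funext θ
  have hexp : HasDerivAt (fun t : ℝ => Real.exp t • x) x 0 := by
    simpa using (Real.hasDerivAt_exp 0).smul_const x
  have h1 : HasDerivAt (fun t : ℝ => ((θ : E3), Real.exp t • x)) (0, x) 0 :=
    (hasDerivAt_const 0 (θ : E3)).prodMk hexp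
  have h2 : HasFDerivAt (zonIntegrand p f) (fderiv ℝ (zonIntegrand p f) (θ, x))
      ((θ : E3), Real.exp 0 • x) := by
    rw [Real.exp_zero, one_smul]
    exact hasFDerivAt_zonIntegrand p hf hx θ
  have h3 := h2.comp_hasDerivAt 0 h1
  have h4 : (zonIntegrand p f ∘ fun t : ℝ => ((θ : E3), Real.exp t • x)) = fun t =>
      f (Real.exp t • ‖x‖ • (θ : E3)) *
        ((p.eval (inner ℝ (θ : E3) (‖x‖⁻¹ • x)) : ℝ) : ℂ) := by
    funext t
    have ht := (Real.exp_pos t)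
    simp only [Function.comp_apply, zonIntegrand, norm_smul, Real.norm_of_nonneg ht.le, smul_smul,
      mul_inv]
    congr 5
    field_simp
  rw [h4] at h3
  have hexp' : HasDerivAt (fun t : ℝ => Real.exp t • ‖x‖ • (θ : E3)) (‖x‖ • (θ : E3)) 0 := by
    simpa using (Real.hasDerivAt_exp 0).smul_const (‖x‖ • (θ : E3))
  have h5 : HasFDerivAt f (fderiv ℝ f (‖x‖ • (θ : E3))) (Real.exp 0 • ‖x‖ • (θ : E3)) := by
    rw [Real.exp_zero, one_smul]
    exact (hf.differentiable one_ne_zero _).hasFDerivAt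
  exact h3.unique ((h5.comp_hasDerivAt 0 hexp').mul_const _)

theorem rot_zero {a b : Fin 3} (hab : a ≠ b) (y : E3) : rot hab 0 y = y := by
  simp [rot_apply, rotLin_apply]

/-- Zonal operators commute with rotations; the derivative of this identity in the angle of
rotation is the claim, after the rotation of the variable of integration has been dropped. -/
theorem fderiv_sphOp_polyKer_rotGen (p : ℝ[X]) (hf : ContDiff ℝ 1 f) (hx : x ≠ 0) (a b : Fin 3) :
    fderiv ℝ (sphOp (polyKer p) f) x (rotGen a b x) = sphOp (polyKer p) (Omega a b f) x := by
  rcases eq_or_ne a b with rfl | hab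
  · simp [rotGen, sphOp, Omega]
  rw [fderiv_sphOp_polyKer_apply p hf hx, sphOp_polyKer_eq p _ hx]
  have hc := continuous_fderiv_zonIntegrand p hf hx
  -- The term added here is the rotation of the variable of integration.
  have h0 : ∫ θ : S2, fderiv ℝ (zonIntegrand p f) (θ, x) (rotGen a b θ, 0) ∂sphereMeasure = 0 := by
    have h := integral_fderiv_rotGen (F := fun u => zonIntegrand p f (u, x)) isOpen_univ
      (fun θ => Set.mem_univ _) ((contDiffOn_zonIntegrand p hf).comp
        (by fun_prop : ContDiffOn ℝ 1 (fun u : E3 => (u, x)) Set.univ) fun u _ => ⟨trivial, hx⟩) a b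
    rw [← h]
    congr 1
    funext θ
    have h1 := (hasFDerivAt_zonIntegrand p hf hx θ).comp (θ : E3)
      (hasFDerivAt_prodMk_left (𝕜 := ℝ) (θ : E3) x)
    have h2 : fderiv ℝ (fun u => zonIntegrand p f (u, x)) (θ : E3) = _ := h1.fderiv
    rw [h2]
    rfl
  have i1 : Integrable (fun θ : S2 => fderiv ℝ (zonIntegrand p f) (θ, x) (0, rotGen a b x))
      sphereMeasure := integrable_sphere (by fun_prop)
  have i2 : Integrable (fun θ : S2 => fderiv ℝ (zonIntegrand p f) (θ, x) (rotGen a b θ, 0))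
      sphereMeasure := integrable_sphere (by fun_prop)
  rw [← add_zero (∫ θ : S2, fderiv ℝ (zonIntegrand p f) (θ, x) (0, rotGen a b x) ∂sphereMeasure),
    ← h0, ← integral_add i1 i2]
  congr 1
  funext θ
  rw [← map_add, Prod.mk_add_mk, zero_add, add_zero]
  have hr : ∀ y : E3, HasDerivAt (fun s => rot hab s y) (rotGen a b y) 0 := fun y => by
    have h := hasDerivAt_rot hab 0 y
    rwa [rot_zero] at h
  have h2 : HasFDerivAt (zonIntegrand p f) (fderiv ℝ (zonIntegrand p f) (θ, x))
      (rot hab 0 (θ : E3), rot hab 0 x) := by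
    rw [rot_zero, rot_zero]
    exact hasFDerivAt_zonIntegrand p hf hx θ
  have h3 := h2.comp_hasDerivAt 0 ((hr θ).prodMk (hr x))
  -- When `θ` and `x` are rotated together, the kernel does not change.
  have h4 : (zonIntegrand p f ∘ fun s : ℝ => (rot hab s (θ : E3), rot hab s x)) = fun s =>
      f (‖x‖ • rot hab s (θ : E3)) * ((p.eval (inner ℝ (θ : E3) (‖x‖⁻¹ • x)) : ℝ) : ℂ) := by
    funext s
    simp only [Function.comp_apply, zonIntegrand, LinearIsometryEquiv.norm_map, ← map_smul,
      LinearIsometryEquiv.inner_map_map]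
  rw [h4] at h3
  have h5 : HasFDerivAt f (fderiv ℝ f (‖x‖ • (θ : E3))) (‖x‖ • rot hab 0 (θ : E3)) := by
    rw [rot_zero]
    exact (hf.differentiable one_ne_zero _).hasFDerivAt
  have h6 := h3.unique ((h5.comp_hasDerivAt 0 ((hr θ).const_smul ‖x‖)).mul_const _)
  rw [h6, zonIntegrand, Omega_eq, map_smul (rotGen a b)]

theorem Omega_sphOp_polyKer (p : ℝ[X]) (hf : ContDiff ℝ 1 f) (hx : x ≠ 0) (a b : Fin 3) :
    Omega a b (sphOp (polyKer p) f) x = sphOp (polyKer p) (Omega a b f) x := by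
  rw [Omega_eq, fderiv_sphOp_polyKer_rotGen p hf hx]

/-! ### Zonal operators on continuously differentiable functions -/

/-- The radial field and the rotation fields span all directions away from the origin. -/
theorem norm_sq_smul_eq (x h : E3) : ‖x‖ ^ 2 • h = (inner ℝ x h : ℝ) • x +
    (wedge 0 1 x h • rotGen 0 1 x + wedge 0 2 x h • rotGen 0 2 x +
      wedge 1 2 x h • rotGen 1 2 x) := by
  rw [EuclideanSpace.real_norm_sq_eq]
  simp only [rotGen_apply, wedge]
  ext i
  fin_cases i <;>
    simp [Fin.sum_univ_three, PiLp.inner_apply] <;> ring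

theorem continuous_scalingS (hf : ContDiff ℝ 1 f) : Continuous (scalingS f) :=
  (hf.continuous_fderiv one_ne_zero).clm_apply continuous_id

theorem continuous_Omega (hf : ContDiff ℝ 1 f) (a b : Fin 3) : Continuous (Omega a b f) := by
  have h : Omega a b f = fun x => fderiv ℝ f x (rotGen a b x) := funext (Omega_eq a b f)
  rw [h]
  exact (hf.continuous_fderiv one_ne_zero).clm_apply (rotGen a b).continuous

end Smooth

/-! ### Continuous differentiability at the origin -/

section Origin

open Polynomial

variable {f g : E3 → ℂ} {x : E3}

theorem continuousAt_integral_sphere {V : Type*} [NormedAddCommGroup V] [NormedSpace ℝ V]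
    {D : E3 × E3 → V} {U : Set E3} (hU : IsOpen U) (hD : ContinuousOn D (Set.univ ×ˢ U))
    (hx : x ∈ U) : ContinuousAt (fun y => ∫ θ : S2, D (θ, y) ∂sphereMeasure) x := by
  obtain ⟨ε, hε, hεU⟩ := Metric.nhds_basis_closedBall.mem_iff.1 (hU.mem_nhds hx)
  have hcomp : IsCompact (Metric.sphere (0 : E3) 1 ×ˢ Metric.closedBall x ε) :=
    (isCompact_sphere _ _).prod (isCompact_closedBall _ _)
  obtain ⟨M, hM⟩ := hcomp.exists_bound_of_continuousOn
    (hD.mono (Set.prod_mono (Set.subset_univ _) hεU))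
  refine continuousAt_of_dominated (bound := fun _ => M) ?_ ?_ (integrable_const _)
    (Eventually.of_forall fun θ => ?_)
  · filter_upwards [hU.mem_nhds hx] with y hy
    exact (hD.comp_continuous (by fun_prop : Continuous fun θ : S2 => ((θ : E3), y))
      fun θ => Set.mk_mem_prod (Set.mem_univ _) hy).aestronglyMeasurable
  · filter_upwards [Metric.closedBall_mem_nhds x hε] with y hy
    exact Eventually.of_forall fun θ => hM ((θ : E3), y) (Set.mk_mem_prod θ.2 hy)
  · have h1 : ContinuousAt D ((θ : E3), x) := hD.continuousAt
      ((isOpen_univ.prod hU).mem_nhds (Set.mk_mem_prod (Set.mem_univ _) hx))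
    exact ContinuousAt.comp (f := fun y : E3 => ((θ : E3), y)) h1 (by fun_prop)

theorem continuousAt_fderiv_zonOp (a : ℕ →₀ ℝ) (hf : ContDiff ℝ 1 f) (hx : x ≠ 0) :
    ContinuousAt (fderiv ℝ (zonOp a f)) x := by
  have hU : IsOpen ({0}ᶜ : Set E3) := isOpen_compl_singleton
  have hc : ContinuousOn (fun p : E3 × E3 => (fderiv ℝ (zonIntegrand (zon a) f) p).comp
      (ContinuousLinearMap.inr ℝ E3 E3)) (Set.univ ×ˢ {0}ᶜ) :=
    ((contDiffOn_zonIntegrand (zon a) hf).continuousOn_fderiv_of_isOpen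
      (isOpen_univ.prod hU) le_rfl).clm_comp continuousOn_const
  refine (continuousAt_integral_sphere hU hc hx).congr ?_
  filter_upwards [hU.mem_nhds hx] with y hy
  exact (hasFDerivAt_sphOp_polyKer (zon a) hf hy).fderiv.symm

theorem exists_norm_zonOp_le (a : ℕ →₀ ℝ) : ∃ M : ℝ≥0, ∀ (F : E3 → ℂ) (x : E3) (S : ℝ),
    (∀ y, ‖y‖ = ‖x‖ → ‖F y‖ ≤ S) → ‖zonOp a F x‖ ≤ M * S := by
  obtain ⟨M, hM⟩ := exists_schurKernel (continuous_uncurry_polyKer (zon a))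
  exact ⟨M, fun F x S hS => hM.norm_sphConv_le
    (fun θ => hS _ (norm_smul_S2 (norm_nonneg x) θ)) _⟩

theorem abs_wedge_le (a b : Fin 3) (x y : E3) : |wedge a b x y| ≤ 2 * (‖x‖ * ‖y‖) := by
  have hx := fun i => PiLp.norm_apply_le x i
  have hy := fun i => PiLp.norm_apply_le y i
  simp only [Real.norm_eq_abs] at hx hy
  rw [wedge]
  calc |x a * y b - x b * y a| ≤ |x a * y b| + |x b * y a| := abs_sub _ _
    _ ≤ ‖x‖ * ‖y‖ + ‖x‖ * ‖y‖ := by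
        rw [abs_mul, abs_mul]
        gcongr
        exacts [hx a, hy b, hx b, hy a]
    _ = _ := by ring

theorem norm_rotGen_le (a b : Fin 3) (x : E3) : ‖rotGen a b x‖ ≤ 2 * ‖x‖ := by
  rcases eq_or_ne (rotGen a b x) 0 with h | h
  · rw [h, norm_zero]; positivity
  · have h1 := abs_wedge_le a b x (rotGen a b x)
    rw [← inner_rotGen, real_inner_self_eq_norm_sq, abs_of_nonneg (by positivity), sq,
      ← mul_assoc] at h1
    exact le_of_mul_le_mul_right h1 (norm_pos_iff.2 h)

/-- The derivative of `zonOp a f` is controlled by the fields that commute with `zonOp a`; the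
constant is `1` for the radial field and `2` for each of the three rotation fields. -/
theorem norm_fderiv_zonOp_le (a : ℕ →₀ ℝ) (hf : ContDiff ℝ 1 f) (hx : x ≠ 0) {S : ℝ}
    (h1 : ‖zonOp a (scalingS f) x‖ ≤ S) (h2 : ∀ i j, ‖zonOp a (Omega i j f) x‖ ≤ S) :
    ‖fderiv ℝ (zonOp a f) x‖ * ‖x‖ ≤ 7 * S := by
  have hx' := norm_pos_iff.2 hx
  set D := fderiv ℝ (zonOp a f) x with hD
  have hS : 0 ≤ S := (norm_nonneg _).trans h1
  have e1 : D x = zonOp a (scalingS f) x := scalingS_sphOp_polyKer (zon a) hf hx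
  have e2 : ∀ i j, D (rotGen i j x) = zonOp a (Omega i j f) x :=
    fderiv_sphOp_polyKer_rotGen (zon a) hf hx
  rw [← le_div_iff₀ hx']
  refine D.opNorm_le_bound (by positivity) fun h => ?_
  have h3 := congrArg D (norm_sq_smul_eq x h)
  simp only [map_add, map_smul, e1, e2] at h3
  have h4 : ‖x‖ ^ 2 * ‖D h‖ ≤ 7 * (‖x‖ * ‖h‖ * S) := by
    have h5 := congrArg norm h3
    rw [norm_smul, norm_pow, norm_norm] at h5
    rw [h5]
    have hw : ∀ i j, ‖wedge i j x h • zonOp a (Omega i j f) x‖ ≤ 2 * (‖x‖ * ‖h‖) * S :=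
      fun i j => by
        rw [norm_smul, Real.norm_eq_abs]
        gcongr
        exacts [abs_wedge_le i j x h, h2 i j]
    have hi : ‖inner ℝ x h • zonOp a (scalingS f) x‖ ≤ ‖x‖ * ‖h‖ * S := by
      rw [norm_smul]
      gcongr
      exact norm_inner_le_norm x h
    calc _ ≤ ‖x‖ * ‖h‖ * S + (2 * (‖x‖ * ‖h‖) * S + 2 * (‖x‖ * ‖h‖) * S +
          2 * (‖x‖ * ‖h‖) * S) :=
          norm_add_le_of_le hi (norm_add_le_of_le (norm_add_le_of_le (hw _ _) (hw _ _)) (hw _ _))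
      _ = _ := by ring
  have h6 : ‖D h‖ * ‖x‖ ≤ 7 * S * ‖h‖ := by
    refine le_of_mul_le_mul_left ?_ hx'
    linarith
  calc ‖D h‖ ≤ 7 * S * ‖h‖ / ‖x‖ := (le_div_iff₀ hx').2 h6
    _ = _ := by ring

/-- A function that vanishes to first order at the origin is mapped to a continuously
differentiable function. -/
theorem contDiff_zonOp_of_fderiv_eq_zero (a : ℕ →₀ ℝ) (hg : ContDiff ℝ 1 g) (h0 : g 0 = 0)
    (h1 : fderiv ℝ g 0 = 0) : ContDiff ℝ 1 (zonOp a g) := by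
  obtain ⟨M, hM⟩ := exists_norm_zonOp_le a
  have hgd : Differentiable ℝ g := hg.differentiable one_ne_zero
  have hT0 : zonOp a g 0 = 0 := by
    simp [zonOp, sphOp, h0]
  have hd0 : HasFDerivAt (zonOp a g) (0 : E3 →L[ℝ] ℂ) 0 := by
    refine HasFDerivAt.of_isLittleO (Asymptotics.isLittleO_iff.2 fun ε hε => ?_)
    have hlo := (hgd 0).hasFDerivAt.isLittleO
    rw [h1] at hlo
    have hε' : 0 < ε / (M + 1) := by positivity
    obtain ⟨δ, hδ, hb⟩ := Metric.eventually_nhds_iff.1 (Asymptotics.isLittleO_iff.1 hlo hε')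
    filter_upwards [Metric.ball_mem_nhds 0 hδ] with x hx
    rw [mem_ball_zero_iff] at hx
    have h2 := hM g x (ε / (M + 1) * ‖x‖) fun y hy => by
      have h3 := hb (y := y) (by rw [dist_zero_right, hy]; exact hx)
      simpa [h0, hy] using h3
    simp only [hT0, sub_zero, zero_apply]
    refine h2.trans ?_
    calc (M : ℝ) * (ε / (M + 1) * ‖x‖) = (M / (M + 1)) * (ε * ‖x‖) := by ring
      _ ≤ 1 * (ε * ‖x‖) := by
          gcongr
          rw [div_le_one (by positivity)]
          linarith
      _ = _ := one_mul _
  rw [contDiff_one_iff_fderiv]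
  refine ⟨fun x => ?_, continuous_iff_continuousAt.2 fun x => ?_⟩
  · rcases eq_or_ne x 0 with rfl | hx
    · exact hd0.differentiableAt
    · exact (hasFDerivAt_sphOp_polyKer (zon a) hg hx).differentiableAt
  rcases eq_or_ne x 0 with rfl | hx
  swap
  · exact continuousAt_fderiv_zonOp a hg hx
  rw [Metric.continuousAt_iff]
  intro ε hε
  set ε' := ε / (14 * M + 1)
  have hε' : 0 < ε' := by positivity
  obtain ⟨δ, hδ, hb⟩ := Metric.continuousAt_iff.1
    (hg.continuous_fderiv one_ne_zero).continuousAt ε' hε'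
  refine ⟨δ, hδ, fun {x} hx => ?_⟩
  rw [hd0.fderiv, dist_zero_right]
  rcases eq_or_ne x 0 with rfl | hx0
  · rwa [hd0.fderiv, norm_zero]
  rw [dist_zero_right] at hx
  have hb' : ∀ y : E3, ‖y‖ = ‖x‖ → ‖fderiv ℝ g y‖ ≤ ε' := fun y hy => by
    have h2 := hb (x := y) (by rw [dist_zero_right, hy]; exact hx)
    rw [h1, dist_zero_right] at h2
    exact h2.le
  have hS : ‖zonOp a (scalingS g) x‖ ≤ M * (ε' * (2 * ‖x‖)) := hM _ _ _ fun y hy => by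
    refine ((fderiv ℝ g y).le_opNorm y).trans ?_
    rw [hy]
    have := hb' y hy
    gcongr
    linarith [norm_nonneg x]
  have hO : ∀ i j, ‖zonOp a (Omega i j g) x‖ ≤ M * (ε' * (2 * ‖x‖)) := fun i j =>
    hM _ _ _ fun y hy => by
      rw [Omega_eq]
      refine ((fderiv ℝ g y).le_opNorm _).trans ?_
      have h2 := norm_rotGen_le i j y
      rw [hy] at h2
      have := hb' y hy
      gcongr
  have h3 := norm_fderiv_zonOp_le a hg hx0 hS hO
  have hx' := norm_pos_iff.2 hx0
  have h4 : ‖fderiv ℝ (zonOp a g) x‖ ≤ 14 * M * ε' := by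
    refine le_of_mul_le_mul_right ?_ hx'
    linarith
  refine h4.trans_lt ?_
  calc 14 * M * ε' < (14 * M + 1) * ε' := by linarith
    _ = ε := mul_div_cancel₀ _ (by positivity)

theorem zonOp_const (a : ℕ →₀ ℝ) (z : ℂ) (x : E3) : zonOp a (fun _ => z) x = a 0 * z := by
  rw [zonOp, sphOp, integral_const_mul, mul_comm]
  congr 1
  rw [← integral_zon a (dirS x), ← integral_complex_ofReal]
  rfl

/-- The coordinates are spherical harmonics of degree `1`. -/
theorem Bump.integral_coord_mul_zon (ψ : Bump) (a : ℕ →₀ ℝ) (i : Fin 3) (η : S2) :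
    ∫ σ : S2, (σ : E3) i * (zon a).eval (dot σ η) ∂sphereMeasure = a 1 * (η : E3) i := by
  -- `(4 π / 3) 𝔷_1(z) = z`, so that the `i`-th coordinate is a zonal kernel with axis `e_i`.
  set e : S2 := ⟨EuclideanSpace.single i 1, by simp⟩
  have hd : ∀ σ : S2, dot e σ = (σ : E3) i := fun σ => by
    simp [dot, e, EuclideanSpace.inner_single_left]
  have h := ψ.integral_zon_mul_zon (Finsupp.single 1 (4 * Real.pi / 3)) a e η
  have hs : Finsupp.single 1 (4 * Real.pi / 3) * a = Finsupp.single 1 (4 * Real.pi / 3 * a 1) := by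
    ext n
    rw [Finsupp.mul_apply, Finsupp.single_apply, Finsupp.single_apply]
    split_ifs with hn
    · subst hn
      rfl
    · rw [zero_mul]
  have hz : ∀ c z : ℝ, (zon (Finsupp.single 1 (4 * Real.pi / 3 * c))).eval z = c * z :=
    fun c z => by
      rw [zon_single, zonal_eq, leg_one, eval_X]
      have := Real.pi_pos.ne'
      push_cast
      field_simp
      ring
  have hz1 : ∀ z : ℝ, (zon (Finsupp.single 1 (4 * Real.pi / 3))).eval z = z := fun z => by
    simpa using hz 1 z
  rw [hs, hz] at h
  simp_rw [hz1, hd] at h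
  exact h

theorem Bump.zonOp_linear (ψ : Bump) (a : ℕ →₀ ℝ) (L : E3 →L[ℝ] ℂ) (x : E3) :
    zonOp a (fun y => L y) x = a 1 * L x := by
  have hL : ∀ y : E3, L y = ∑ i, (y i : ℂ) * L (EuclideanSpace.single i 1) := fun y => by
    conv_lhs => rw [← (EuclideanSpace.basisFun (Fin 3) ℝ).sum_repr y]
    simp [map_sum, map_smul, Complex.real_smul]
  have e : ∀ θ : S2, L (‖x‖ • (θ : E3)) * polyKer (zon a) θ (dirS x) =
      ∑ i, (‖x‖ * L (EuclideanSpace.single i 1)) *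
        (((θ : E3) i * (zon a).eval (dot θ (dirS x)) : ℝ) : ℂ) := fun θ => by
    rw [hL, Finset.sum_mul]
    refine Finset.sum_congr rfl fun i _ => ?_
    rw [polyKer, PiLp.smul_apply, smul_eq_mul]
    push_cast
    ring
  have hc := continuous_eval_dot (zon a) (dirS x)
  unfold zonOp sphOp
  simp_rw [e]
  rw [integral_finsetSum _ fun i _ => integrable_sphere (by fun_prop), hL x, Finset.mul_sum]
  refine Finset.sum_congr rfl fun i _ => ?_
  rw [integral_const_mul, integral_complex_ofReal, ψ.integral_coord_mul_zon, coe_dirS]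
  have h := congrArg (fun y : E3 => y i) (norm_smul_direction x)
  simp only [PiLp.smul_apply, smul_eq_mul] at h
  rw [← h]
  push_cast
  ring

/-- The first-order Taylor polynomial of `f` at the origin, on which the operator acts by the
coefficients `a 0` and `a 1`, is subtracted. -/
theorem Bump.contDiff_zonOp (ψ : Bump) (a : ℕ →₀ ℝ) (hf : ContDiff ℝ 1 f) :
    ContDiff ℝ 1 (zonOp a f) := by
  set L := fderiv ℝ f 0
  set g : E3 → ℂ := fun y => f y - (f 0 + L y) with hg
  have hgc : ContDiff ℝ 1 g := by fun_prop
  have hg0 : g 0 = 0 := by simp [hg]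
  have hg1 : fderiv ℝ g 0 = 0 := by
    have h1 : HasFDerivAt g (L - L) 0 :=
      (hf.differentiable one_ne_zero 0).hasFDerivAt.sub (L.hasFDerivAt.const_add (f 0))
    rw [h1.fderiv, sub_self]
  have hcont := hgc.continuous
  have e : zonOp a f = fun x => zonOp a g x + (a 0 * f 0 + a 1 * L x) := by
    funext x
    rw [← ψ.zonOp_linear, ← zonOp_const a (f 0) x]
    unfold zonOp sphOp
    have i1 : Integrable (fun θ : S2 => g (‖x‖ • (θ : E3)) * polyKer (zon a) θ (dirS x))
        sphereMeasure := integrable_sphere (by fun_prop)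
    have i2 : Integrable (fun θ : S2 => f 0 * polyKer (zon a) θ (dirS x))
        sphereMeasure := integrable_sphere (by fun_prop)
    have i3 : Integrable (fun θ : S2 => L (‖x‖ • (θ : E3)) * polyKer (zon a) θ (dirS x))
        sphereMeasure := integrable_sphere (by fun_prop)
    rw [← integral_add i2 i3, ← integral_add i1 (integrable_sphere (by fun_prop))]
    congr 1
    funext θ
    simp only [hg]
    ring
  rw [e]
  have := contDiff_zonOp_of_fderiv_eq_zero a hgc hg0 hg1
  fun_prop

variable (ψ : Bump)

theorem Bump.R_eq_zonOp (l : ℤ) (hf : Continuous f) : ψ.R l f = zonOp (ψ.band l) f :=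
  funext fun x => ψ.R_eq l (sphereIntegrable_of_continuous hf x)

theorem Bump.contDiff_R (l : ℤ) (hf : ContDiff ℝ 1 f) : ContDiff ℝ 1 (ψ.R l f) := by
  rw [ψ.R_eq_zonOp l hf.continuous]
  exact ψ.contDiff_zonOp _ hf

theorem Bump.Omega_R (l : ℤ) (hf : ContDiff ℝ 1 f) (a b : Fin 3) :
    Omega a b (ψ.R l f) = ψ.R l (Omega a b f) := by
  rw [ψ.R_eq_zonOp l hf.continuous, ψ.R_eq_zonOp l (continuous_Omega hf a b)]
  funext x
  rcases eq_or_ne x 0 with rfl | hx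
  · simp [Omega, zonOp, sphOp]
  · exact Omega_sphOp_polyKer _ hf hx a b

theorem Bump.scalingS_R (l : ℤ) (hf : ContDiff ℝ 1 f) :
    scalingS (ψ.R l f) = ψ.R l (scalingS f) := by
  rw [ψ.R_eq_zonOp l hf.continuous, ψ.R_eq_zonOp l (continuous_scalingS hf)]
  funext x
  rcases eq_or_ne x 0 with rfl | hx
  · simp [scalingS, zonOp, sphOp]
  · exact scalingS_sphOp_polyKer _ hf hx

end Origin

/-! ### Kernels of the rotation fields -/

section Rotation

open Polynomial

variable {f g : E3 → ℂ} {x : E3}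

/-- The kernel `p'(⟨θ, η⟩) (η_a θ_b - η_b θ_a)`, which is the result of applying `Ω_{ab}` in the
variable `η` to the zonal kernel `p(⟨θ, η⟩)`. -/
def wedgeKer (p : ℝ[X]) (a b : Fin 3) (θ η : S2) : ℂ :=
  (((derivative p).eval (dot θ η) * wedge a b η θ : ℝ) : ℂ)

@[fun_prop]
theorem continuous_wedge {α : Type*} [TopologicalSpace α] (a b : Fin 3) {u v : α → E3}
    (hu : Continuous u) (hv : Continuous v) : Continuous fun y => wedge a b (u y) (v y) := by
  unfold wedge
  fun_prop

theorem continuous_wedgeKer (p : ℝ[X]) (a b : Fin 3) :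
    Continuous (Function.uncurry (wedgeKer p a b)) := by
  have h : Continuous fun z : S2 × S2 => (derivative p).eval (dot z.1 z.2) :=
    (derivative p).continuous.comp (by fun_prop)
  unfold Function.uncurry wedgeKer
  fun_prop

theorem norm_wedgeKer_le (p : ℝ[X]) (a b : Fin 3) (θ η : S2) :
    ‖wedgeKer p a b θ η‖ ≤ |(derivative p).eval (dot θ η)| * √(1 - dot θ η ^ 2) := by
  rw [wedgeKer, Complex.norm_real, Real.norm_eq_abs, abs_mul]
  gcongr
  refine Real.abs_le_sqrt ?_
  rw [dot_comm]
  exact wedge_sq_le a b η θ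

theorem SymBound.schurKernel_wedgeKer {c : ℕ →₀ ℝ} {A : ℝ} {B N : ℕ} (h : SymBound c A B N)
    (a b : Fin 3) :
    SchurKernel (wedgeKer (zon c) a b) ((7 * A ^ 2 * (B + 2) ^ 4 + 4) * N).toNNReal := by
  have hk := continuous_wedgeKer (zon c) a b
  have hc : ∀ η, Continuous fun θ => |(derivative (zon c)).eval (dot θ η)| *
      √(1 - dot θ η ^ 2) := fun η => by
    have := continuous_eval_dot (derivative (zon c)) η
    fun_prop
  refine SchurKernel.of_integral hk (fun η => ?_) fun θ => ?_
  · refine (integral_mono (integrable_sphere ?_) (integrable_sphere (hc η))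
      fun θ => norm_wedgeKer_le _ _ _ _ _).trans (h.integral_abs_deriv_le η)
    exact (hk.comp (by fun_prop : Continuous fun θ : S2 => (θ, η))).norm
  · refine (integral_mono (integrable_sphere ?_) (integrable_sphere (hc θ))
      fun η => ?_).trans (h.integral_abs_deriv_le θ)
    · exact (hk.comp (by fun_prop : Continuous fun η : S2 => (θ, η))).norm
    · simp only
      rw [dot_comm η θ]
      exact norm_wedgeKer_le _ _ _ _ _

/-- The symbol of the spherical Laplacian (with the sign that makes it nonnegative) applied after
the multiplier `a`. -/
def lapMul (a : ℕ →₀ ℝ) : ℕ →₀ ℝ :=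
  Finsupp.onFinset a.support (fun n => (n : ℝ) * (n + 1) * a n) fun _ hn =>
    Finsupp.mem_support_iff.2 (right_ne_zero_of_mul hn)

theorem lapMul_apply (a : ℕ →₀ ℝ) (n : ℕ) : lapMul a n = (n : ℝ) * (n + 1) * a n := rfl

/-- Green's identity for zonal kernels. -/
theorem green_zon (q : ℝ[X]) (a : ℕ →₀ ℝ) (θ η : S2) :
    ∫ σ : S2, (derivative q).eval (dot σ η) * (derivative (zon a)).eval (dot σ θ) *
      (dot η θ - dot η σ * dot σ θ) ∂sphereMeasure =
    ∫ σ : S2, q.eval (dot σ η) * (zon (lapMul a)).eval (dot σ θ) ∂sphereMeasure := by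
  have hq := continuous_eval_dot q η
  have hq' := continuous_eval_dot (derivative q) η
  induction a using Finsupp.induction_linear with
  | zero =>
    have h0 : lapMul 0 = 0 := by ext n; simp [lapMul_apply]
    simp [h0]
  | add a b ha hb =>
    have h0 : lapMul (a + b) = lapMul a + lapMul b := by
      ext n
      simp only [lapMul_apply, Finsupp.add_apply]
      ring
    have h1 := continuous_eval_dot (derivative (zon a)) θ
    have h2 := continuous_eval_dot (derivative (zon b)) θ
    have h3 := continuous_eval_dot (zon (lapMul a)) θ
    have h4 := continuous_eval_dot (zon (lapMul b)) θ
    have hd : Continuous fun σ : S2 => dot η θ - dot η σ * dot σ θ := by fun_prop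
    have i1 : Integrable (fun σ : S2 => (derivative q).eval (dot σ η) *
      (derivative (zon a)).eval (dot σ θ) * (dot η θ - dot η σ * dot σ θ)) sphereMeasure :=
      integrable_sphere (by fun_prop)
    have i2 : Integrable (fun σ : S2 => (derivative q).eval (dot σ η) *
      (derivative (zon b)).eval (dot σ θ) * (dot η θ - dot η σ * dot σ θ)) sphereMeasure :=
      integrable_sphere (by fun_prop)
    have i3 : Integrable (fun σ : S2 => q.eval (dot σ η) * (zon (lapMul a)).eval (dot σ θ))
      sphereMeasure := integrable_sphere (by fun_prop)
    have i4 : Integrable (fun σ : S2 => q.eval (dot σ η) * (zon (lapMul b)).eval (dot σ θ))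
      sphereMeasure := integrable_sphere (by fun_prop)
    rw [h0]
    simp only [map_add, eval_add, mul_add, add_mul]
    rw [integral_add i1 i2, integral_add i3 i4, ha, hb]
  | single n c =>
    have h0 : lapMul (Finsupp.single n c) = ((n : ℝ) * (n + 1)) • Finsupp.single n c := by
      ext m
      rw [lapMul_apply, Finsupp.smul_apply, smul_eq_mul, Finsupp.single_apply]
      split_ifs with h
      · rw [h]
      · simp
    have h1 : zon (Finsupp.single n c) = (c * ((2 * (n : ℝ) + 1) / (4 * Real.pi))) • leg n := by
      rw [zon, Finsupp.linearCombination_single, smul_smul]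
    rw [h0, map_smul, h1]
    simp only [derivative_smul, eval_smul, smul_eq_mul]
    set w := c * ((2 * (n : ℝ) + 1) / (4 * Real.pi))
    have e1 : ∀ σ : S2, (derivative q).eval (dot σ η) * (w * (derivative (leg n)).eval (dot σ θ)) *
        (dot η θ - dot η σ * dot σ θ) = w * ((derivative q).eval (dot σ η) *
          (derivative (leg n)).eval (dot σ θ) * (dot η θ - dot η σ * dot σ θ)) := fun σ => by ring
    have e2 : ∀ σ : S2, q.eval (dot σ η) * ((n : ℝ) * (n + 1) * (w * (leg n).eval (dot σ θ))) =
        w * ((n : ℝ) * (n + 1)) * (q.eval (dot σ η) * (leg n).eval (dot σ θ)) := fun σ => by ring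
    simp_rw [e1, e2]
    rw [integral_const_mul, integral_const_mul, green_leg]
    ring

/-- The sum of squares of the rotation fields is the spherical Laplacian. -/
theorem Bump.sum_kerComp_wedgeKer (ψ : Bump) (a m : ℕ →₀ ℝ) (θ η : S2) :
    kerComp (wedgeKer (zon a) 0 1) (wedgeKer (zon m) 0 1) θ η +
      kerComp (wedgeKer (zon a) 0 2) (wedgeKer (zon m) 0 2) θ η +
      kerComp (wedgeKer (zon a) 1 2) (wedgeKer (zon m) 1 2) θ η =
    -polyKer (zon (lapMul a * m)) θ η := by
  have hc := fun i j => continuous_wedgeKer (zon a) i j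
  have hc' := fun i j => continuous_wedgeKer (zon m) i j
  have hi : ∀ i j, Integrable (fun σ => wedgeKer (zon a) i j θ σ * wedgeKer (zon m) i j σ η)
      sphereMeasure := fun i j => integrable_sphere
    (((hc i j).comp (by fun_prop : Continuous fun σ : S2 => (θ, σ))).mul
      ((hc' i j).comp (by fun_prop : Continuous fun σ : S2 => (σ, η))))
  have hi2 : Integrable (fun σ => wedgeKer (zon a) 0 1 θ σ * wedgeKer (zon m) 0 1 σ η +
      wedgeKer (zon a) 0 2 θ σ * wedgeKer (zon m) 0 2 σ η) sphereMeasure := (hi 0 1).add (hi 0 2)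
  rw [kerComp, kerComp, kerComp, ← integral_add (hi 0 1) (hi 0 2), ← integral_add hi2 (hi 1 2)]
  have h1 := green_zon (zon m) a θ η
  have h2 := ψ.integral_zon_mul_zon (lapMul a) m θ η
  have h3 : ∫ σ : S2, (zon m).eval (dot σ η) * (zon (lapMul a)).eval (dot σ θ) ∂sphereMeasure =
      (zon (lapMul a * m)).eval (dot θ η) := by
    rw [← h2]
    congr 1
    funext σ
    rw [dot_comm σ θ, mul_comm]
  rw [h3] at h1
  rw [polyKer, ← h1, ← integral_complex_ofReal, ← integral_neg]
  congr 1
  funext σ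
  rw [← wedge_mul_wedge_sum σ θ η]
  simp only [wedgeKer, wedge_swap _ _ σ η, dot_comm θ σ]
  push_cast
  ring

theorem continuous_kerComp {k k' : S2 → S2 → ℂ} (hk : Continuous (Function.uncurry k))
    (hk' : Continuous (Function.uncurry k')) : Continuous (Function.uncurry (kerComp k k')) := by
  obtain ⟨M, hM0, hM⟩ := exists_bound_ker hk
  obtain ⟨M', hM0', hM'⟩ := exists_bound_ker hk'
  refine continuous_of_dominated (bound := fun _ => M * M') (fun z => ?_)
    (fun z => Eventually.of_forall fun σ => ?_) (integrable_const _)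
    (Eventually.of_forall fun σ => ?_)
  · exact ((hk.comp (by fun_prop : Continuous fun σ : S2 => (z.1, σ))).mul
      (hk'.comp (by fun_prop : Continuous fun σ : S2 => (σ, z.2)))).aestronglyMeasurable
  · rw [norm_mul]
    exact mul_le_mul (hM _ _) (hM' _ _) (norm_nonneg _) hM0
  · exact (hk.comp (by fun_prop : Continuous fun z : S2 × S2 => (z.1, σ))).mul
      (hk'.comp (by fun_prop : Continuous fun z : S2 × S2 => (σ, z.2)))

/-- The rotation fields of `zonOp a f`, composed with those of `zonOp m`, sum to the spherical
Laplacian up to the sign. -/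
theorem Bump.sum_sphOp_wedgeKer (ψ : Bump) (a m : ℕ →₀ ℝ) (hx : x ≠ 0)
    (hf : SphereIntegrable f x) :
    sphOp (wedgeKer (zon m) 0 1) (sphOp (wedgeKer (zon a) 0 1) f) x +
      sphOp (wedgeKer (zon m) 0 2) (sphOp (wedgeKer (zon a) 0 2) f) x +
      sphOp (wedgeKer (zon m) 1 2) (sphOp (wedgeKer (zon a) 1 2) f) x =
    -zonOp (lapMul a * m) f x := by
  have hc := fun p i j => continuous_wedgeKer p i j
  have hk : ∀ i j, Continuous (Function.uncurry
      (kerComp (wedgeKer (zon a) i j) (wedgeKer (zon m) i j))) :=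
    fun i j => continuous_kerComp (hc _ i j) (hc _ i j)
  rw [sphOp_sphOp hx hf (hc _ _ _) (hc _ _ _), sphOp_sphOp hx hf (hc _ _ _) (hc _ _ _),
    sphOp_sphOp hx hf (hc _ _ _) (hc _ _ _)]
  unfold zonOp sphOp
  have hi := fun i j => integrable_mul_ker hf (hk i j) (dirS x)
  have hi2 : Integrable (fun θ : S2 => f (‖x‖ • (θ : E3)) *
      kerComp (wedgeKer (zon a) 0 1) (wedgeKer (zon m) 0 1) θ (dirS x) +
      f (‖x‖ • (θ : E3)) * kerComp (wedgeKer (zon a) 0 2) (wedgeKer (zon m) 0 2) θ (dirS x))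
      sphereMeasure := (hi 0 1).add (hi 0 2)
  rw [← integral_add (hi 0 1) (hi 0 2), ← integral_add hi2 (hi 1 2), ← integral_neg]
  congr 1
  funext θ
  rw [← mul_neg, ← ψ.sum_kerComp_wedgeKer]
  ring

/-! ### The rotation fields in the sense of distributions -/

theorem fderiv_zonIntegrand_rotGen (p : ℝ[X]) (hf : ContDiff ℝ 1 f) (hx : x ≠ 0) {i j : Fin 3}
    (hij : i ≠ j) (θ : S2) :
    fderiv ℝ (fun u => zonIntegrand p f (u, x)) (θ : E3) (rotGen i j θ) =
      Omega i j f (‖x‖ • (θ : E3)) * polyKer p θ (dirS x) +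
        f (‖x‖ • (θ : E3)) * wedgeKer p i j (dirS x) θ := by
  set y : E3 := ‖x‖⁻¹ • x with hy
  have hyd : (dirS x : E3) = y := by rw [coe_dirS, direction, if_neg hx]
  have hr : HasDerivAt (fun s => rot hij s (θ : E3)) (rotGen i j θ) 0 := by
    have h := hasDerivAt_rot hij 0 (θ : E3)
    rwa [rot_zero] at h
  have h1 : HasFDerivAt (fun u => zonIntegrand p f (u, x))
      (fderiv ℝ (fun u => zonIntegrand p f (u, x)) (θ : E3)) (rot hij 0 (θ : E3)) := by
    rw [rot_zero]
    exact (((contDiffOn_zonIntegrand p hf).comp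
      (by fun_prop : ContDiffOn ℝ 1 (fun u : E3 => (u, x)) Set.univ)
      fun u _ => ⟨trivial, hx⟩).differentiableOn one_ne_zero).differentiableAt univ_mem
      |>.hasFDerivAt
  have h2 : HasFDerivAt f (fderiv ℝ f (‖x‖ • (θ : E3))) (‖x‖ • rot hij 0 (θ : E3)) := by
    rw [rot_zero]
    exact (hf.differentiable one_ne_zero _).hasFDerivAt
  have h3 : HasDerivAt (fun s => f (‖x‖ • rot hij s (θ : E3)))
      (fderiv ℝ f (‖x‖ • (θ : E3)) (‖x‖ • rotGen i j θ)) 0 :=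
    h2.comp_hasDerivAt 0 (hr.const_smul ‖x‖)
  have h4 : HasDerivAt (fun s => inner ℝ (rot hij s (θ : E3)) y) (wedge i j θ y) 0 := by
    have h := hr.inner ℝ (hasDerivAt_const (0 : ℝ) y)
    rw [inner_zero_right, zero_add, inner_rotGen] at h
    exact h
  have h5 : HasDerivAt (fun s => p.eval (inner ℝ (rot hij s (θ : E3)) y))
      ((derivative p).eval (inner ℝ (θ : E3) y) * wedge i j θ y) 0 := by
    have h := p.hasDerivAt (inner ℝ (rot hij 0 (θ : E3)) y)
    have h' := h.comp (0 : ℝ) h4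
    rw [rot_zero] at h'
    exact h'
  have h6 : HasDerivAt (fun s => zonIntegrand p f (rot hij s (θ : E3), x))
      (fderiv ℝ (fun u => zonIntegrand p f (u, x)) (θ : E3) (rotGen i j θ)) 0 :=
    HasFDerivAt.comp_hasDerivAt (l := fun u => zonIntegrand p f (u, x))
      (f := fun s => rot hij s (θ : E3)) 0 h1 hr
  have h7 := h6.unique (h3.fun_mul h5.ofReal_comp)
  rw [h7, rot_zero, Omega_eq, map_smul (rotGen i j), polyKer, wedgeKer, dot_comm (dirS x) θ, dot,
    hyd]

/-- The rotation field is moved to the kernel by an integration by parts on the sphere. -/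
theorem zonOp_Omega (a : ℕ →₀ ℝ) (i j : Fin 3) (hf : ContDiff ℝ 1 f) (hx : x ≠ 0) :
    zonOp a (Omega i j f) x = -sphOp (fun θ η => wedgeKer (zon a) i j η θ) f x := by
  rcases eq_or_ne i j with rfl | hij
  · have h0 : ∀ u v : E3, wedge i i u v = 0 := fun u v => by simp only [wedge]; ring
    simp [zonOp, sphOp, Omega, wedgeKer, h0]
  set p := zon a
  have h := integral_fderiv_rotGen (F := fun u => zonIntegrand p f (u, x)) isOpen_univ
    (fun θ => Set.mem_univ _) ((contDiffOn_zonIntegrand p hf).comp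
      (by fun_prop : ContDiffOn ℝ 1 (fun u : E3 => (u, x)) Set.univ) fun u _ => ⟨trivial, hx⟩) i j
  have hc1 := continuous_Omega hf i j
  have hc2 := hf.continuous
  have i1 : Integrable (fun θ : S2 => Omega i j f (‖x‖ • (θ : E3)) * polyKer p θ (dirS x))
      sphereMeasure := integrable_sphere (by fun_prop)
  have i2 : Integrable (fun θ : S2 => f (‖x‖ • (θ : E3)) * wedgeKer p i j (dirS x) θ)
      sphereMeasure := integrable_sphere ((hc2.comp (by fun_prop)).mul
        ((continuous_wedgeKer p i j).comp (by fun_prop : Continuous fun θ : S2 => (dirS x, θ))))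
  rw [eq_neg_iff_add_eq_zero, ← h, zonOp, sphOp, sphOp, ← integral_add i1 i2]
  congr 1
  funext θ
  exact (fderiv_zonIntegrand_rotGen p hf hx hij θ).symm

end Rotation

/-! ### The Bernstein property -/

section Bernstein

open Polynomial

variable (ψ : Bump) {f : E3 → ℂ}

/-- A smooth cutoff that is `1` where `φ` and its translates by at most `1` live on `[0, ∞)`. -/
def Bump.fat (x : ℝ) : ℝ := ψ.toFun (x / 4) - ψ.toFun (4 * x)

theorem Bump.fat_eq_one {x : ℝ} (h1 : 2 / 5 < x) (h2 : x ≤ 16 / 5) : ψ.fat x = 1 := by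
  rw [Bump.fat, ψ.eq_one', ψ.eq_zero, sub_zero]
  · rw [abs_of_pos (by linarith)]; linarith
  · rw [abs_of_pos (by linarith)]; linarith

theorem Bump.fat_eq_zero_of_le {x : ℝ} (hx : |x| ≤ 1 / 5) : ψ.fat x = 0 := by
  rw [Bump.fat, ψ.eq_one', ψ.eq_one', sub_self]
  · rw [abs_mul, abs_of_pos (by norm_num : (0 : ℝ) < 4)]; linarith
  · rw [abs_div, abs_of_pos (by norm_num : (0 : ℝ) < 4)]; linarith

theorem Bump.fat_eq_zero_of_lt {x : ℝ} (hx : 7 < |x|) : ψ.fat x = 0 := by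
  rw [Bump.fat, ψ.eq_zero, ψ.eq_zero, sub_self]
  · rw [abs_mul, abs_of_pos (by norm_num : (0 : ℝ) < 4)]; linarith
  · rw [abs_div, abs_of_pos (by norm_num : (0 : ℝ) < 4)]; linarith

theorem Bump.contDiff_fat : ContDiff ℝ 2 ψ.fat := by
  have h : ContDiff ℝ 2 ψ.toFun := by exact_mod_cast contDiff_infty.1 ψ.smooth 2
  unfold Bump.fat
  fun_prop

/-- The smooth function `x⁻¹`, cut off away from the origin. -/
def Bump.cutInv (x : ℝ) : ℝ := ψ.fat x * x⁻¹

theorem Bump.cutInv_eq_zero_of_le {x : ℝ} (hx : |x| ≤ 1 / 5) : ψ.cutInv x = 0 := by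
  rw [Bump.cutInv, ψ.fat_eq_zero_of_le hx, zero_mul]

theorem Bump.cutInv_eq_zero_of_lt {x : ℝ} (hx : 7 < |x|) : ψ.cutInv x = 0 := by
  rw [Bump.cutInv, ψ.fat_eq_zero_of_lt hx, zero_mul]

theorem Bump.contDiff_cutInv : ContDiff ℝ 2 ψ.cutInv := by
  rw [contDiff_iff_contDiffAt]
  intro x
  rcases eq_or_ne x 0 with rfl | hx
  · refine (contDiffAt_const (c := (0 : ℝ))).congr_of_eventuallyEq ?_
    filter_upwards [Icc_mem_nhds (by norm_num : -(1 / 5 : ℝ) < 0) (by norm_num : (0 : ℝ) < 1 / 5)]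
      with x hx using ψ.cutInv_eq_zero_of_le (abs_le.2 hx)
  · exact ψ.contDiff_fat.contDiffAt.mul (contDiffAt_inv ℝ hx)

/-- Sampled at the points `n h`, this function is `h⁻² / (n (n + 1))` where `n h` lies in the
support of `φ` and `h ≤ 1`: up to the factor `h⁻²`, the inverse of the symbol of the spherical
Laplacian. -/
def Bump.cutInvPair (h x : ℝ) : ℝ := ψ.cutInv x * ψ.cutInv (x + h)

theorem Bump.cutInvPair_eq_zero (h : ℝ) {x : ℝ} (hx : ((7 : ℕ) : ℝ) < x) :
    ψ.cutInvPair h x = 0 := by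
  push_cast at hx
  rw [Bump.cutInvPair, ψ.cutInv_eq_zero_of_lt (by rwa [abs_of_pos (by linarith)]), zero_mul]

theorem Bump.exists_symBound_cutInvPair :
    ∃ A, ∀ l : ℕ, SymBound (mult (ψ.cutInvPair ((2 ^ l : ℕ) : ℝ)⁻¹) l) A 7 (2 ^ l) := by
  obtain ⟨A, hA⟩ := exists_bound_of_compact ψ.contDiff_cutInv fun x hx => ψ.cutInv_eq_zero_of_lt hx
  have hA0 : 0 ≤ A := (abs_nonneg _).trans (hA 0).1
  have hd1 : ContDiff ℝ 1 (deriv ψ.cutInv) := by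
    have h : ContDiff ℝ (1 + 1) ψ.cutInv := by rw [one_add_one_eq_two]; exact ψ.contDiff_cutInv
    exact (contDiff_succ_iff_deriv.1 h).2.2
  have hD : ∀ x, HasDerivAt ψ.cutInv (deriv ψ.cutInv x) x := fun x =>
    (ψ.contDiff_cutInv.differentiable two_ne_zero x).hasDerivAt
  have hD2 : ∀ x, HasDerivAt (deriv ψ.cutInv) (deriv (deriv ψ.cutInv) x) x := fun x =>
    (hd1.differentiable one_ne_zero x).hasDerivAt
  refine ⟨4 * A ^ 2, fun l => ?_⟩
  set h : ℝ := ((2 ^ l : ℕ) : ℝ)⁻¹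
  have e1 : deriv (ψ.cutInvPair h) = fun x =>
      deriv ψ.cutInv x * ψ.cutInv (x + h) + ψ.cutInv x * deriv ψ.cutInv (x + h) := funext fun x =>
    ((hD x).mul ((hD (x + h)).comp_add_const x h)).deriv
  have e2 : ∀ x, deriv (deriv (ψ.cutInvPair h)) x =
      deriv (deriv ψ.cutInv) x * ψ.cutInv (x + h) + deriv ψ.cutInv x * deriv ψ.cutInv (x + h) +
        (deriv ψ.cutInv x * deriv ψ.cutInv (x + h) +
          ψ.cutInv x * deriv (deriv ψ.cutInv) (x + h)) := fun x => by
    rw [e1]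
    exact (((hD2 x).mul ((hD (x + h)).comp_add_const x h)).add
      ((hD x).mul ((hD2 (x + h)).comp_add_const x h))).deriv
  have hm : ∀ {u v : ℝ}, |u| ≤ A → |v| ≤ A → |u * v| ≤ A ^ 2 := fun {u v} hu hv => by
    rw [abs_mul, sq]
    exact mul_le_mul hu hv (abs_nonneg _) hA0
  have hs := symBound_of_fun (N := 2 ^ l) (A := 4 * A ^ 2) (χ := ψ.cutInvPair h)
    Nat.one_le_two_pow ?_ (fun x => ?_) (fun x => ?_) ?_ (fun x hx => ψ.cutInvPair_eq_zero h hx)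
  · convert hs using 1
    funext n
    exact mult_natCast_apply (fun x hx => ψ.cutInvPair_eq_zero h hx) l n
  · have hc := ψ.contDiff_cutInv
    unfold Bump.cutInvPair
    fun_prop
  · exact (hm (hA x).1 (hA (x + h)).1).trans (by linarith [sq_nonneg A])
  · rw [e2]
    have h1 := hm (hA x).2.2 (hA (x + h)).1
    have h2 := hm (hA x).2.1 (hA (x + h)).2.1
    have h3 := hm (hA x).1 (hA (x + h)).2.2
    calc _ ≤ (A ^ 2 + A ^ 2) + (A ^ 2 + A ^ 2) :=
          (abs_add_le _ _).trans (add_le_add ((abs_add_le _ _).trans (add_le_add h1 h2))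
            ((abs_add_le _ _).trans (add_le_add h2 h3)))
      _ = 4 * A ^ 2 := by ring
  · have h0 : ψ.cutInv =ᶠ[𝓝 0] fun _ => 0 := by
      filter_upwards [Icc_mem_nhds (by norm_num : -(1 / 5 : ℝ) < 0)
        (by norm_num : (0 : ℝ) < 1 / 5)] with x hx using ψ.cutInv_eq_zero_of_le (abs_le.2 hx)
    rw [e1]
    simp [h0.deriv_eq, h0.eq_of_nhds]

theorem Bump.exists_symBound_fat : ∃ A, ∀ l : ℕ, SymBound (mult ψ.fat l) A 7 (2 ^ l) := by
  refine exists_symBound_mult ψ.contDiff_fat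
    (fun x hx => ψ.fat_eq_zero_of_lt (by push_cast at hx; exact hx)) ?_
  have h0 : ψ.fat =ᶠ[𝓝 0] fun _ => 0 := by
    filter_upwards [Icc_mem_nhds (by norm_num : -(1 / 5 : ℝ) < 0) (by norm_num : (0 : ℝ) < 1 / 5)]
      with x hx using ψ.fat_eq_zero_of_le (abs_le.2 hx)
  rw [h0.deriv_eq, deriv_const]

theorem Bump.mult_fat_apply (l n : ℕ) : mult ψ.fat l n = ψ.fat ((n : ℝ) / ((2 ^ l : ℕ) : ℝ)) :=
  mult_natCast_apply (B := 7)
    (fun x hx => ψ.fat_eq_zero_of_lt (by rwa [abs_of_pos (by linarith)])) l n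

theorem Bump.lt_div_of_band_ne_zero {l n : ℕ} (h : ψ.band l n ≠ 0) :
    2 / 5 < (n : ℝ) / ((2 ^ l : ℕ) : ℝ) ∧ (n : ℝ) / ((2 ^ l : ℕ) : ℝ) ≤ 8 / 5 := by
  have h2 := ψ.lt_of_band_ne_zero h
  rw [zpow_natCast] at h2
  push_cast
  rw [lt_div_iff₀ (by positivity), div_le_iff₀ (by positivity)]
  exact h2

theorem Bump.band_mul_fat (l : ℕ) : ψ.band l * mult ψ.fat l = ψ.band l := by
  ext n
  rw [Finsupp.mul_apply]
  by_cases h : ψ.band l n = 0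
  · rw [h, zero_mul]
  · obtain ⟨h1, h2⟩ := ψ.lt_div_of_band_ne_zero h
    rw [ψ.mult_fat_apply, ψ.fat_eq_one h1 (by linarith), mul_one]

/-- On the band `l` the symbol `cutInvPair` inverts the spherical Laplacian up to the factor
`2^{2 l}`. -/
theorem Bump.band_mul_lapMul (l : ℕ) :
    ψ.band l * (lapMul (mult ψ.fat l) * mult (ψ.cutInvPair ((2 ^ l : ℕ) : ℝ)⁻¹) l) =
      (((2 ^ l : ℕ) : ℝ) ^ 2) • ψ.band l := by
  ext n
  rw [Finsupp.smul_apply, smul_eq_mul, Finsupp.mul_apply, Finsupp.mul_apply, lapMul_apply]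
  by_cases h : ψ.band l n = 0
  · rw [h, zero_mul, mul_zero]
  obtain ⟨h1, h2⟩ := ψ.lt_div_of_band_ne_zero h
  rw [mult_natCast_apply (fun x hx => ψ.cutInvPair_eq_zero _ hx), ψ.mult_fat_apply,
    Bump.cutInvPair, Bump.cutInv, Bump.cutInv]
  have hN : (1 : ℝ) ≤ ((2 ^ l : ℕ) : ℝ) := by exact_mod_cast Nat.one_le_two_pow
  set N : ℝ := ((2 ^ l : ℕ) : ℝ)
  have hN0 : 0 < N := by linarith
  have hn : (0 : ℝ) < n := by
    have h3 : 0 < (n : ℝ) / N := by linarith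
    exact (div_pos_iff_of_pos_right hN0).1 h3
  have hNi : N⁻¹ ≤ 1 := inv_le_one_of_one_le₀ hN
  have hNp : 0 < N⁻¹ := inv_pos.2 hN0
  rw [ψ.fat_eq_one h1 (by linarith),
    ψ.fat_eq_one (x := (n : ℝ) / N + N⁻¹) (by linarith) (by linarith)]
  have e : (n : ℝ) / N + N⁻¹ = (n + 1) / N := by
    field_simp
  rw [e]
  field_simp

theorem zonOp_smul (c : ℝ) (a : ℕ →₀ ℝ) (f : E3 → ℂ) (x : E3) :
    zonOp (c • a) f x = c * zonOp a f x := by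
  rw [zonOp, sphOp, zonOp, sphOp, ← integral_const_mul]
  congr 1
  funext θ
  rw [polyKer, polyKer, map_smul, eval_smul, smul_eq_mul]
  push_cast
  ring

variable {r : ℝ≥0∞}

/-- Multipliers act on `R̄_l f` through the product of the symbols. -/
theorem Bump.zonOp_R_ae_eq (a : ℕ →₀ ℝ) (l : ℤ) (hr : 1 ≤ r) (hf : MemLp f r volume) :
    zonOp a (ψ.R l f) =ᵐ[volume] zonOp (ψ.band l * a) f := by
  have h1 : zonOp a (ψ.R l f) =ᵐ[volume] zonOp a (zonOp (ψ.band l) f) :=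
    sphOp_congr_ae _ (ψ.R_ae_eq l hr hf)
  filter_upwards [h1, MemLp.ae_sphereIntegrable hr hf, ae_ne_zero] with x hx h2 h3
  rw [hx, ψ.zonOp_zonOp_apply _ _ h3 h2]

theorem hasCompactSupport_Omega {η : E3 → ℂ} (hη : HasCompactSupport η) (i j : Fin 3) :
    HasCompactSupport (Omega i j η) := by
  refine (hη.fderiv ℝ).mono fun x hx => ?_
  rw [Function.mem_support] at hx ⊢
  intro h
  exact hx (by rw [Omega, h]; simp)

/-- The weak derivative `Ω_{ij} R̄_l f` is obtained by differentiating the kernel of a slightly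
larger multiplier. -/
theorem Bump.isWeakOmega_R (l : ℕ) (hr : 1 ≤ r) (hf : MemLp f r volume) (i j : Fin 3) :
    IsWeakOmega i j (ψ.R l f)
      (sphOp (wedgeKer (zon (mult ψ.fat l)) i j) (ψ.R l f)) := by
  intro η hη hηc
  have hη1 : ContDiff ℝ 1 η := by exact_mod_cast contDiff_infty.1 hη 1
  -- All integrals below pair `L^r` with the conjugate exponent; for `r = ∞` this is `L¹`.
  have := ENNReal.HolderConjugate.conjExponent hr
  set q := r.conjExponent
  set a := mult ψ.fat l
  have hF := ψ.memLp_R l hr hf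
  have hO : MemLp (Omega i j η) q volume :=
    (continuous_Omega hη1 i j).memLp_of_hasCompactSupport (hasCompactSupport_Omega hηc i j)
  have hq : MemLp η q volume := hη1.continuous.memLp_of_hasCompactSupport hηc
  have h1 : ψ.R l f =ᵐ[volume] zonOp a (ψ.R l f) := by
    filter_upwards [ψ.zonOp_R_ae_eq a l hr hf, ψ.R_ae_eq l hr hf] with x h1 h2
    rw [h1, h2, ψ.band_mul_fat]
  calc ∫ x, ψ.R l f x * Omega i j η x = ∫ x, zonOp a (ψ.R l f) x * Omega i j η x :=
        integral_congr_ae (h1.mono fun x hx => by simp only [← hx])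
    _ = ∫ x, ψ.R l f x * zonOp a (Omega i j η) x := integral_zonOp_mul a hF hO
    _ = ∫ x, -(ψ.R l f x * sphOp (fun θ κ => wedgeKer (zon a) i j κ θ) η x) := by
        refine integral_congr_ae (ae_ne_zero.mono fun x hx => ?_)
        simp only
        rw [zonOp_Omega a i j hη1 hx, mul_neg]
    _ = _ := by
        rw [integral_neg, integral_sphOp_mul (continuous_wedgeKer _ i j) hF hq]

/-- `R̄_l f` is recovered from its rotational derivatives by kernels of the same type, since
`∑ Ω_{ij}²` is inverted on the band `l`. -/
theorem Bump.R_eq_sum_sphOp (l : ℕ) (hr : 1 ≤ r) (hf : MemLp f r volume) :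
    let k := fun i j => wedgeKer (zon (mult (ψ.cutInvPair ((2 ^ l : ℕ) : ℝ)⁻¹) l)) i j
    let h := fun i j => sphOp (wedgeKer (zon (mult ψ.fat l)) i j) (ψ.R l f)
    (((2 ^ l : ℕ) : ℂ) ^ 2) • ψ.R l f =ᵐ[volume]
      -(sphOp (k 0 1) (h 0 1) + sphOp (k 0 2) (h 0 2) + sphOp (k 1 2) (h 1 2)) := by
  intro k h
  have hF := ψ.memLp_R l hr hf
  filter_upwards [ψ.zonOp_R_ae_eq _ l hr hf, MemLp.ae_sphereIntegrable hr hF, ae_ne_zero,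
    ψ.R_ae_eq l hr hf] with x h1 h2 h3 h4
  simp only [Pi.smul_apply, Pi.neg_apply, Pi.add_apply, k, h]
  rw [ψ.sum_sphOp_wedgeKer _ _ h3 h2, neg_neg, h1, ψ.band_mul_lapMul, zonOp_smul, h4]
  push_cast
  rfl

theorem sum_pairs {M : Type*} [AddCommMonoid M] (F : Fin 3 × Fin 3 → M) :
    ∑ p ∈ pairs, F p = F (0, 1) + F (0, 2) + F (1, 2) := by
  have h : pairs = {(0, 1), (0, 2), (1, 2)} := by decide
  rw [h, Finset.sum_insert (by decide), Finset.sum_insert (by decide), Finset.sum_singleton,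
    add_assoc]

/-- The upper bound is the `L¹` bound `O(2^l)` of the kernels `wedgeKer` in Schur's test; for the
lower bound `2^{2 l} R̄_l f` is recovered from its rotational derivatives at the cost of another
factor `O(2^l)`. -/
theorem Bump.exists_bernstein : ∃ C : ℝ≥0, ∀ (l : ℤ) (r : ℝ≥0∞), 1 ≤ r →
    ∀ f : E3 → ℂ, MemLp f r volume → ∃ h : Fin 3 → Fin 3 → E3 → ℂ,
      (∀ a b : Fin 3, MemLp (h a b) r volume ∧ IsWeakOmega a b (ψ.R l f) (h a b)) ∧
      ∑ p ∈ pairs, eLpNorm (h p.1 p.2) r volume ≤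
        C * ((2 : ℝ≥0∞) ^ l * eLpNorm (ψ.R l f) r volume) ∧
      (2 : ℝ≥0∞) ^ l * eLpNorm (ψ.R l f) r volume ≤
        C * ∑ p ∈ pairs, eLpNorm (h p.1 p.2) r volume := by
  obtain ⟨A, hA⟩ := ψ.exists_symBound_fat
  obtain ⟨A', hA'⟩ := ψ.exists_symBound_cutInvPair
  set c := (7 * A ^ 2 * ((7 : ℕ) + 2) ^ 4 + 4).toNNReal
  set c' := (7 * A' ^ 2 * ((7 : ℕ) + 2) ^ 4 + 4).toNNReal
  refine ⟨3 * c + c', fun l r hr f hf => ?_⟩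
  rcases lt_or_ge l 0 with hl | hl
  -- For `l < 0` the band contains no integer and `R̄_l f = 0`.
  · have h0 := ψ.R_of_neg hl f
    refine ⟨fun _ _ => 0, fun a b => ⟨MemLp.zero, fun η _ _ => ?_⟩, ?_, ?_⟩ <;> simp [h0]
  lift l to ℕ using hl
  have hF := ψ.memLp_R l hr hf
  set F := ψ.R l f with hFdef
  set N : ℕ := 2 ^ l with hN
  have hNz : (2 : ℝ≥0∞) ^ (l : ℤ) = (N : ℝ≥0∞) := by
    rw [zpow_natCast, hN]
    push_cast
    rfl
  have hN0 : (N : ℝ≥0∞) ≠ 0 := by simp [hN]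
  have hNt : (N : ℝ≥0∞) ≠ ⊤ := ENNReal.natCast_ne_top N
  have hcoe : ∀ t : ℝ, 0 ≤ t → (((t * (N : ℝ)).toNNReal : ℝ≥0) : ℝ≥0∞) = t.toNNReal * N :=
    fun t ht => by
      rw [Real.toNNReal_mul ht, Real.toNNReal_natCast, ENNReal.coe_mul, ENNReal.coe_natCast]
  set h : Fin 3 → Fin 3 → E3 → ℂ := fun i j => sphOp (wedgeKer (zon (mult ψ.fat l)) i j) F
  have hh : ∀ i j, MemLp (h i j) r volume := fun i j =>
    memLp_sphOp (continuous_wedgeKer _ i j) hr hF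
  have hup : ∀ i j, eLpNorm (h i j) r volume ≤ c * (N * eLpNorm F r volume) := fun i j => by
    have h1 := ((hA l).schurKernel_wedgeKer i j).eLpNorm_le hr hF.1
    rw [hcoe _ (by positivity)] at h1
    rwa [← mul_assoc]
  refine ⟨h, fun i j => ⟨hh i j, ψ.isWeakOmega_R l hr hf i j⟩, ?_, ?_⟩
  · rw [sum_pairs, hNz]
    calc _ ≤ c * (N * eLpNorm F r volume) + c * (N * eLpNorm F r volume) +
          c * (N * eLpNorm F r volume) := add_le_add (add_le_add (hup _ _) (hup _ _)) (hup _ _)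
      _ = ((3 * c : ℝ≥0) : ℝ≥0∞) * (N * eLpNorm F r volume) := by
          push_cast
          ring
      _ ≤ _ := by
          gcongr
          exact le_self_add
  · rw [sum_pairs, hNz]
    set k := fun i j => wedgeKer (zon (mult (ψ.cutInvPair ((2 ^ l : ℕ) : ℝ)⁻¹) l)) i j
    have hlow : ∀ i j, eLpNorm (sphOp (k i j) (h i j)) r volume ≤
        c' * N * eLpNorm (h i j) r volume := fun i j => by
      have h1 := ((hA' l).schurKernel_wedgeKer i j).eLpNorm_le hr (hh i j).1
      rwa [hcoe _ (by positivity)] at h1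
    have hm : ∀ i j, MemLp (sphOp (k i j) (h i j)) r volume := fun i j =>
      memLp_sphOp (continuous_wedgeKer _ i j) hr (hh i j)
    have h2 := eLpNorm_congr_ae (p := r) (ψ.R_eq_sum_sphOp l hr hf)
    rw [eLpNorm_neg, eLpNorm_const_smul] at h2
    have h3 : (N : ℝ≥0∞) * (N * eLpNorm F r volume) ≤ N * (c' * (eLpNorm (h 0 1) r volume +
        eLpNorm (h 0 2) r volume + eLpNorm (h 1 2) r volume)) := by
      have e : ‖((2 ^ l : ℕ) : ℂ) ^ 2‖ₑ = (N : ℝ≥0∞) * N := by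
        rw [enorm_pow, sq, ← hN, ← ofReal_norm, Complex.norm_natCast, ENNReal.ofReal_natCast]
      rw [e] at h2
      rw [← mul_assoc, h2]
      calc _ ≤ c' * N * eLpNorm (h 0 1) r volume + c' * N * eLpNorm (h 0 2) r volume +
            c' * N * eLpNorm (h 1 2) r volume :=
            (eLpNorm_add_le ((hm 0 1).add (hm 0 2)).1 (hm 1 2).1 hr).trans
              (add_le_add ((eLpNorm_add_le (hm 0 1).1 (hm 0 2).1 hr).trans
                (add_le_add (hlow _ _) (hlow _ _))) (hlow _ _))
        _ = _ := by ring
    -- One factor `N` of `N² ‖R̄_l f‖` is consumed by the kernels `k i j`.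
    rw [ENNReal.mul_le_mul_iff_right hN0 hNt] at h3
    refine h3.trans ?_
    gcongr
    exact le_add_self

end Bernstein

end AngularLP

end

theorem mainTheorem6 (ψ : AngularLP.Bump) :
    -- commutation
    (∀ l : ℤ,
      (∀ f : AngularLP.E3 → ℂ, ContDiff ℝ 1 f →
        ContDiff ℝ 1 (ψ.R l f) ∧
        (∀ a b : Fin 3,
          AngularLP.Omega a b (ψ.R l f) = ψ.R l (AngularLP.Omega a b f)) ∧
        AngularLP.scalingS (ψ.R l f) = ψ.R l (AngularLP.scalingS f)) ∧
      (∀ (k : ℤ) (f : AngularLP.E3 → ℂ), ψ.R l (ψ.spaceLP k f) = ψ.spaceLP k (ψ.R l f)) ∧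
      (∀ c : ℝ, 0 < c →
        (∀ f : AngularLP.E3 → ℂ, Integrable f volume →
          Integrable (ψ.R l f) volume ∧
          AngularLP.fourierL1 c (ψ.R l f) = ψ.R l (AngularLP.fourierL1 c f)) ∧
        (∀ f : Lp ℂ 2 (volume : Measure AngularLP.E3),
          ∃ hf : MemLp (ψ.R l f) 2 volume,
            AngularLP.fourierL2 c (hf.toLp (ψ.R l f)) =ᵐ[volume]
              ψ.R l (AngularLP.fourierL2 c f) ∧
            ∀ k : ℤ, ψ.freqLP c k (hf.toLp (ψ.R l f)) =ᵐ[volume] ψ.R l (ψ.freqLP c k f)))) ∧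
    -- almost orthogonal partition of unity and product rule
    (∀ f : AngularLP.E3 → ℂ, MemLp f 2 volume →
      Tendsto (fun s : Finset ℕ =>
          eLpNorm (f - (ψ.Rle (-1) f + ∑ l ∈ s, ψ.R (l : ℤ) f)) 2 volume) atTop (𝓝 0)) ∧
    (∀ l l' : ℤ, 4 ≤ |l - l'| → ∀ f : AngularLP.E3 → ℂ, LocallyIntegrable f volume →
      ψ.R l (ψ.R l' f) =ᵐ[volume] 0) ∧
    (∃ C : ℝ≥0, ∀ f : AngularLP.E3 → ℂ, MemLp f 2 volume →
      eLpNorm f 2 volume ^ 2 ≤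
        C * (eLpNorm (ψ.Rle (-1) f) 2 volume ^ 2 +
          ∑' l : ℕ, eLpNorm (ψ.R (l : ℤ) f) 2 volume ^ 2) ∧
      eLpNorm (ψ.Rle (-1) f) 2 volume ^ 2 + ∑' l : ℕ, eLpNorm (ψ.R (l : ℤ) f) 2 volume ^ 2 ≤
        C * eLpNorm f 2 volume ^ 2) ∧
    (∀ l l₁ l₂ : ℤ, AngularLP.med l l₁ l₂ + 4 ≤ max l (max l₁ l₂) →
      ∀ f g : AngularLP.E3 → ℂ, LocallyIntegrable f volume → LocallyIntegrable g volume →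
        ψ.R l (fun x => ψ.R l₁ f x * ψ.R l₂ g x) =ᵐ[volume] 0) ∧
    -- boundedness on `L^r`, uniformly in `l` and `r`
    (∃ C : ℝ≥0, ∀ (l : ℤ) (r : ℝ≥0∞), 1 ≤ r → ∀ f : AngularLP.E3 → ℂ, MemLp f r volume →
      MemLp (ψ.R l f) r volume ∧ MemLp (ψ.Rle l f) r volume ∧
      eLpNorm (ψ.R l f) r volume + eLpNorm (ψ.Rle l f) r volume ≤ C * eLpNorm f r volume) ∧
    -- Bernstein property, uniformly in `l` and `r`
    (∃ C : ℝ≥0, ∀ (l : ℤ) (r : ℝ≥0∞), 1 ≤ r → ∀ f : AngularLP.E3 → ℂ, MemLp f r volume →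
      ∃ h : Fin 3 → Fin 3 → AngularLP.E3 → ℂ,
        (∀ a b : Fin 3, MemLp (h a b) r volume ∧
          AngularLP.IsWeakOmega a b (ψ.R l f) (h a b)) ∧
        ∑ p ∈ AngularLP.pairs, eLpNorm (h p.1 p.2) r volume ≤
          C * ((2 : ℝ≥0∞) ^ l * eLpNorm (ψ.R l f) r volume) ∧
        (2 : ℝ≥0∞) ^ l * eLpNorm (ψ.R l f) r volume ≤
          C * ∑ p ∈ AngularLP.pairs, eLpNorm (h p.1 p.2) r volume) := by
  refine ⟨fun l => ⟨fun f hf => ⟨ψ.contDiff_R l hf, ψ.Omega_R l hf, ψ.scalingS_R l hf⟩,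
    ψ.R_spaceLP l, fun c hc => ⟨fun f hf => ⟨?_, ψ.fourierL1_R c l hf⟩, fun f =>
      ⟨ψ.memLp_R l one_le_two (Lp.memLp f), ψ.fourierL2_RLp hc l f, fun k => ?_⟩⟩⟩,
    fun f hf => ψ.tendsto_eLpNorm_sub_sum hf, fun l l' h f hf => ψ.R_R_ae_eq_zero h hf,
    ⟨2, fun f hf => ⟨ψ.eLpNorm_sq_le hf, ?_⟩⟩,
    fun l l₁ l₂ h f g hf hg => ψ.R_mul_R_ae_eq_zero h hf hg,
    ψ.exists_eLpNorm_R_add_Rle_le, ψ.exists_bernstein⟩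
  · exact memLp_one_iff_integrable.1 (ψ.memLp_R l le_rfl (memLp_one_iff_integrable.2 hf))
  · have h := ψ.coeFn_RLp l (ψ.freqLP c k f)
    rw [← ψ.freqLP_RLp c k l f] at h
    exact h
  · exact (ψ.tsum_eLpNorm_sq_le hf).trans (le_mul_of_one_le_left zero_le one_le_two)
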